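/- **Setting.** Let $\mathbb F$ be an algebraically closed field of characteristic $p>3$ and let $\alpha\in\mathbb F$, $\alpha\neq 0,-1$. Let $\mathfrak g=D(2,1;\alpha)$ be the Lie superalgebra with even basis $h_i,e_i,f_i$ $(i=1,2,3)$ and odd basis $x_1,\dots,x_4,y_1,\dots,y_4$. The even part is the direct sum of three copies of $\mathfrak{sl}(2)$: $[e_i,f_i]=h_i$, $[h_i,e_i]=2e_i$, $[h_i,f_i]=-2f_i$. Writing $k$ for $x$ or $y$, the even part acts on the odd part by $$[h_1,x_i]=x_i,\ [h_1,y_i]=-y_i,\ [e_1,y_i]=x_i,\ [f_1,x_i]=y_i\ (1\le i\le 4),$$ $$[h_2,k_j]=k_j,\ [f_2,k_j]=k_{j+2}\ (j=1,2),\quad [h_2,k_l]=-k_l,\ [e_2,k_l]=k_{l-2}\ (l=3,4),$$ $$[h_3,k_i]=(-1)^{i+1}k_i\ (1\le i\le4),\quad [e_3,k_s]=k_{s-1}\ (s=2,4),\quad [f_3,k_t]=k_{t+1}\ (t=1,3),$$ and the brackets of odd elements are $$\begin{aligned} &[x_1,y_2]=-2e_2,\quad [x_1,y_3]=-2\alpha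 e_3,\quad [x_1,y_4]=-(1+\alpha)h_1+h_2+\alpha h_3,\\ &[x_2,y_1]=2e_2,\quad [x_2,y_4]=2\alpha f_3,\quad [x_2,y_3]=(1+\alpha)h_1-h_2+\alpha h_3,\\ &[x_3,y_1]=2\alpha e_3,\quad [x_3,y_4]=2f_2,\quad [x_3,y_2]=(1+\alpha)h_1+h_2-\alpha h_3,\\ &[x_4,y_2]=-2\alpha f_3,\quad [x_4,y_3]=-2f_2,\quad [x_4,y_1]=-(1+\alpha)h_1-h_2-\alpha h_3,\\ &[y_2,y_3]=2(1+\alpha)f_1,\quad [y_1,y_4]=-2(1+\alpha)f_1,\quad [x_2,x_3]=-2(1+\alpha)e_1,\quad [x_1,x_4]=2(1+\alpha)e_1; \end{aligned}$$ all brackets of basis elements not determined by these through super-antisymmetry are $0$. The $p$-mapping on $\mathfrak g_{\bar0}$ is given by $h_i^{[p]}=h_i$, $e_i^{[p]}=f_i^{[p]}=0$. Let $\mathfrak h=\langle h_1,h_2,h_3\rangle$ and $\mathfrak n^+=\langle e_1,e_2,e_3,x_1,x_2,x_3,x_4\rangle$. Let $\epsilon_1,\epsilon_2,\epsilon_3$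 be the basis of $\mathfrak h^*$ dual to $h_1,h_2,h_3$, and write $\lambda=(\lambda_1,\lambda_2,\lambda_3)$ for $\lambda=\sum\lambda_i\epsilon_i$. Let $\chi\in\mathfrak g_{\bar0}^*$ with $\chi(e_i)=0$ for $i=1,2,3$, and let $\lambda\in\mathfrak h^*$ satisfy $\lambda(h)^p-\lambda(h^{[p]})=\chi(h)^p$ for all $h\in\mathfrak h$. Let $u_\chi$ denote the $\chi$-reduced enveloping algebra (the quotient of the universal enveloping superalgebra by the relations $x^p-x^{[p]}=\chi(x)^p$ for even $x$), and let $Z_\chi(\lambda)=u_\chi(\mathfrak g)\otimes_{u_\chi(\mathfrak h\oplus\mathfrak n^+)}\mathbb F v$ be the baby Verma module, where $v$ is even, $hv=\lambda(h)v$ for $h\in\mathfrak h$, and $\mathfrak n^+v=0$. A linear map $\varphi:\mathfrak g\to M=Z_\chi(\lambda)$, homogeneous of parity $|\varphi|$, is a derivation if $\varphi([x,y])=(-1)^{|\varphi||x|}x\varphi(y)-(-1)^{|y|(|\varphi|+|x|)}y\varphi(x)$ for all homogeneous $x,y$. Let $\mathrm{Der}(\mathfrak g,M)$ be the span of the homogeneous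 derivations, $\mathrm{Ider}(\mathfrak g,M)$ the span of the maps $x\mapsto(-1)^{|x||m|}xm$ with $m\in M$ homogeneous, and $\mathrm H^1(\mathfrak g,M)=\mathrm{Der}(\mathfrak g,M)/\mathrm{Ider}(\mathfrak g,M)$. Its superdimension $\mathrm{sdim}$ is the pair (dimension of the space of classes of even derivations, dimension of the space of classes of odd derivations). If $\lambda$ is one of the weights below (which have integral coordinates), $\beta=(\beta_1,\beta_2,\beta_3)$ is an integral weight and $\theta=(j_1,j_2,j_3,j_4)\in\{0,1\}^4$, put $$w_\beta^\theta=f_1^{k_1}f_2^{k_2}f_3^{k_3}y_1^{j_1}y_2^{j_2}y_3^{j_3}y_4^{j_4}\otimes v,$$ where $0\le k_i\le p-1$ and, modulo $p$, $$k_1\equiv\tfrac{\lambda_1-\beta_1-j_1-j_2-j_3-j_4}2,\quad k_2\equiv\tfrac{\lambda_2-\beta_2+j_1+j_2-j_3-j_4}2,\quad k_3\equiv\tfrac{\lambda_3-\beta_3+j_1-j_2+j_3-j_4}2 .$$ In the formulas below, in the value at a basis element $b$ of $\mathfrak g$ the symbol $w^{\theta}$ stands for $w_{\beta}^{\theta}$,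 with $\beta$ the integral weight of $b$: $0$ for $h_i$, $\pm2\epsilon_i$ for $e_i,f_i$, and $(1,1,1),(1,1,-1),(1,-1,1),(1,-1,-1)$ for $x_1,\dots,x_4$ and $(-1,1,1),(-1,1,-1),(-1,-1,1),(-1,-1,-1)$ for $y_1,\dots,y_4$. Basis elements that are not listed are mapped to $0$. * $\psi_1=\psi_1(a_1,a_2,a_3,c_1,c_2,c_3)$, with parameters in $\mathbb F$; put $A=(1+\alpha)a_1$ and $C=(1+\alpha)c_1$: $$\begin{aligned} h_i\mapsto{}& a_iw^{1111},\qquad f_i\mapsto c_iw^{1111}\quad(i=1,2,3),\\ e_1\mapsto{}&-8Cw^{0000}+2c_2w^{1100}-2\alpha c_3w^{1010}+(A-a_2+\alpha a_3)w^{1001}-(A-a_2-\alpha a_3)w^{0110}-a_1w^{1111},\\ e_2\mapsto{}&2Cw^{1100}-a_2w^{1111},\qquad e_3\mapsto-a_3w^{1111},\\ x_1\mapsto{}&4C(w^{1000}+w^{0100}+w^{0010}+w^{0001})+(A-a_2-\alpha a_3)w^{1110}+(A-a_2+\alpha a_3)w^{1101}\\&-(A+a_2-\alpha a_3)w^{1011}-(A+a_2+\alpha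 a_3)w^{0111},\\ x_2\mapsto{}&4C(w^{0100}+w^{0001})-2\alpha c_3w^{1110}+(A-a_2+\alpha a_3)w^{1101}+2\alpha c_3w^{1011}-(A+a_2+\alpha a_3)w^{0111},\\ x_3\mapsto{}&4C(w^{0010}+w^{0001})-2c_2w^{1110}-2c_2w^{1101}-(A+a_2-\alpha a_3)w^{1011}-(A+a_2+\alpha a_3)w^{0111},\\ x_4\mapsto{}&4Cw^{0001}-2c_2w^{1101}+2\alpha c_3w^{1011}-(A+a_2+\alpha a_3)w^{0111},\\ y_1\mapsto{}&-2C(w^{1011}+w^{0111}),\quad y_2\mapsto-2Cw^{0111},\quad y_3\mapsto-2C(w^{1011}+w^{0111}),\quad y_4\mapsto-2Cw^{0111}. \end{aligned}$$ * $\psi_2$: $e_1\mapsto2\alpha w^{0101}$, $e_3\mapsto w^{1111}$, $x_1\mapsto-2\alpha w^{1101}+2\alpha w^{0111}$, $x_3\mapsto2\alpha w^{0111}$. * $\psi_3$: $e_1\mapsto-2w^{0011}$, $e_2\mapsto w^{1111}$, $x_1\mapsto2w^{1011}+2w^{0111}$, $x_2\mapsto2w^{0111}$. * $\psi_4$: $e_1\mapsto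 w^{1110}$, $x_i\mapsto-w^{1111}$ for $i=1,2,3,4$. **Theorem.** With these conventions (note that $2p+2=2$ etc. in $\mathbb F$): 1. If $\lambda=(2p+2,2p-2,2p-2)=(2,-2,-2)$ and $\chi(f_i)^p=0$ for $i=1,2,3$, then every $\psi_1(a_1,a_2,a_3,c_1,c_2,c_3)$ is an even derivation, every element of $\mathrm H^1(\mathfrak g,Z_\chi(\lambda))$ is the class of $\psi_1(a_1,a_2,a_3,c_1,c_2,c_3)$ for exactly one $(a_1,a_2,a_3,c_1,c_2,c_3)\in\mathbb F^6$, and $\mathrm{sdim}\,\mathrm H^1(\mathfrak g,Z_\chi(\lambda))=(6,0)$. 2. If $\lambda=(2p+2,2p-2,2p)=(2,-2,0)$ and $\chi(f_i)^p=0$ for $i=1,2,3$, then $\psi_2$ is an even derivation, $\mathrm H^1(\mathfrak g,Z_\chi(\lambda))$ is spanned by its class, and the superdimension is $(1,0)$. 3. If $\lambda=(2p+2,2p,2p-2)=(2,0,-2)$ and $\chi(f_i)^p=0$ for $i=1,2,3$, then $\psi_3$ is an even derivation, $\mathrm H^1(\mathfrak g,Z_\chi(\lambda))$ is spanned by its class,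 and the superdimension is $(1,0)$. 4. If $\lambda=(2p+3,2p-3,2p-3)=(3,-3,-3)$ and $\chi(f_i)^p=0$ for $i=1,2,3$, then $\psi_4$ is an odd derivation, $\mathrm H^1(\mathfrak g,Z_\chi(\lambda))$ is spanned by its class, and the superdimension is $(0,1)$. 5. In all other cases $\mathrm H^1(\mathfrak g,Z_\chi(\lambda))=0$, with superdimension $(0,0)$. -/

import Mathlib

noncomputable section

/-! ## Derivations and the first cohomology of a Lie superalgebra

A Lie superalgebra is given by a vector space `g`, a bracket `B` and a `ZMod 2`-grading `G`;
a module by a vector space `M`, a grading `GM` and the action `ρ`. -/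

section Cohomology

variable {F g M : Type*} [Field F] [AddCommGroup g] [Module F g] [AddCommGroup M] [Module F M]

/-- The sign `(-1)^{ij}` attached to two parities. -/
def superSign (F : Type*) [Field F] (i j : ZMod 2) : F := (-1) ^ (i * j).val

/-- The homogeneous derivations `g → M` of parity `i`. -/
def DerHom (B : g →ₗ[F] g →ₗ[F] g) (G : ZMod 2 → Submodule F g)
    (ρ : g →ₗ[F] Module.End F M) (GM : ZMod 2 → Submodule F M) (i : ZMod 2) :
    Submodule F (g →ₗ[F] M) where
  carrier := {φ | (∀ j, ∀ x ∈ G j, φ x ∈ GM (i + j)) ∧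
    ∀ j k, ∀ x ∈ G j, ∀ y ∈ G k,
      φ (B x y) = superSign F i j • ρ x (φ y) - superSign F k (i + j) • ρ y (φ x)}
  add_mem' := by
    rintro φ ψ ⟨h1, h2⟩ ⟨h3, h4⟩
    refine ⟨fun j x hx => add_mem (h1 j x hx) (h3 j x hx), fun j k x hx y hy => ?_⟩
    simp only [LinearMap.add_apply, h2 j k x hx y hy, h4 j k x hx y hy, map_add, smul_add]
    abel
  zero_mem' := ⟨fun j x _ => by simp, fun j k x _ y _ => by simp⟩
  smul_mem' := by
    rintro c φ ⟨h1, h2⟩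
    refine ⟨fun j x hx => Submodule.smul_mem _ c (h1 j x hx), fun j k x hx y hy => ?_⟩
    simp only [LinearMap.smul_apply, h2 j k x hx y hy, map_smul, smul_sub]
    rw [smul_comm c, smul_comm c]

/-- `Der(g, M)`: the span of all homogeneous derivations. -/
def Der (B : g →ₗ[F] g →ₗ[F] g) (G : ZMod 2 → Submodule F g)
    (ρ : g →ₗ[F] Module.End F M) (GM : ZMod 2 → Submodule F M) : Submodule F (g →ₗ[F] M) :=
  ⨆ i, DerHom B G ρ GM i

/-- `Ider(g, M)`: the span of the inner derivations `D_m`, `m` homogeneous, where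
`D_m x = (-1)^{|x||m|} x m` for homogeneous `x`. -/
def Ider (G : ZMod 2 → Submodule F g)
    (ρ : g →ₗ[F] Module.End F M) (GM : ZMod 2 → Submodule F M) : Submodule F (g →ₗ[F] M) :=
  Submodule.span F {D | ∃ i, ∃ m ∈ GM i, ∀ j, ∀ x ∈ G j, D x = superSign F j i • ρ x m}

/-- The first cohomology group `H¹(g, M) = Der(g, M) / Ider(g, M)`. -/
abbrev H1 (B : g →ₗ[F] g →ₗ[F] g) (G : ZMod 2 → Submodule F g)
    (ρ : g →ₗ[F] Module.End F M) (GM : ZMod 2 → Submodule F M) : Type _ :=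
  (Der B G ρ GM) ⧸ (Ider G ρ GM).submoduleOf (Der B G ρ GM)

/-- The class in `H¹(g, M)` of a derivation. -/
def H1.cls (B : g →ₗ[F] g →ₗ[F] g) (G : ZMod 2 → Submodule F g)
    (ρ : g →ₗ[F] Module.End F M) (GM : ZMod 2 → Submodule F M) :
    Der B G ρ GM →ₗ[F] H1 B G ρ GM :=
  ((Ider G ρ GM).submoduleOf (Der B G ρ GM)).mkQ

/-- The homogeneous component of parity `i` of `H¹(g, M)`: classes of derivations of parity
`i`. -/
def H1.part (B : g →ₗ[F] g →ₗ[F] g) (G : ZMod 2 → Submodule F g)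
    (ρ : g →ₗ[F] Module.End F M) (GM : ZMod 2 → Submodule F M) (i : ZMod 2) :
    Submodule F (H1 B G ρ GM) :=
  ((DerHom B G ρ GM i).submoduleOf (Der B G ρ GM)).map (H1.cls B G ρ GM)

/-- The superdimension (even dimension, odd dimension) of `H¹(g, M)`. -/
def H1.sdim (B : g →ₗ[F] g →ₗ[F] g) (G : ZMod 2 → Submodule F g)
    (ρ : g →ₗ[F] Module.End F M) (GM : ZMod 2 → Submodule F M) : Cardinal × Cardinal :=
  (Module.rank F (H1.part B G ρ GM 0), Module.rank F (H1.part B G ρ GM 1))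

end Cohomology

/-! ## The Lie superalgebra `D(2,1;α)` -/

namespace D21

/-- The 17 basis elements. The `x`'s and `y`'s are the pure tensors of `V₁ ⊠ V₂ ⊠ V₃`:
with signs `(±,±,±)` for the `ω_{±1} ⊗ ω_{±2} ⊗ ω_{±3}`,
`x1 = +++`, `x2 = ++-`, `x3 = +-+`, `x4 = +--`, `y1 = -++`, `y2 = -+-`, `y3 = --+`,
`y4 = ---`. -/
inductive Gen
  | h1 | h2 | h3 | e1 | e2 | e3 | f1 | f2 | f3 | x1 | x2 | x3 | x4 | y1 | y2 | y3 | y4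
  deriving DecidableEq

open Gen

instance : Fintype Gen where
  elems := {h1, h2, h3, e1, e2, e3, f1, f2, f3, x1, x2, x3, x4, y1, y2, y3, y4}
  complete := by intro b; cases b <;> decide

/-- The basis elements `h_i`, `e_i`, `f_i` of the `i`-th copy of `sl(2)` (indexed from 0): here the `h_i`. -/
def hG : Fin 3 → Gen := ![h1, h2, h3]

/-- The elements `e_i`. -/
def eG : Fin 3 → Gen := ![e1, e2, e3]

/-- The elements `f_i`. -/
def fG : Fin 3 → Gen := ![f1, f2, f3]

/-- Parity of a basis element. -/
def par : Gen → ZMod 2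
  | x1 | x2 | x3 | x4 | y1 | y2 | y3 | y4 => 1
  | _ => 0

/-- The positive basis elements, spanning `n⁺`. -/
def IsPos : Gen → Prop
  | e1 | e2 | e3 | x1 | x2 | x3 | x4 => True
  | _ => False

/-- The weight of a basis element with respect to `(h1, h2, h3)`. -/
def wt : Gen → Fin 3 → ℤ
  | h1 | h2 | h3 => ![0, 0, 0]
  | e1 => ![2, 0, 0]
  | e2 => ![0, 2, 0]
  | e3 => ![0, 0, 2]
  | f1 => ![-2, 0, 0]
  | f2 => ![0, -2, 0]
  | f3 => ![0, 0, -2]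
  | x1 => ![1, 1, 1]
  | x2 => ![1, 1, -1]
  | x3 => ![1, -1, 1]
  | x4 => ![1, -1, -1]
  | y1 => ![-1, 1, 1]
  | y2 => ![-1, 1, -1]
  | y3 => ![-1, -1, 1]
  | y4 => ![-1, -1, -1]

variable {F : Type*} [Field F]

/-- The underlying vector space of `D(2,1;α)`, with basis `Gen`. -/
abbrev Alg (F : Type*) : Type _ := Gen → F

/-- The basis vectors of `D(2,1;α)`. -/
def bas (F : Type*) [Field F] (b : Gen) : Alg F := Pi.single b 1

/-- The multiplication table; every unordered pair of basis elements with a nonzero bracket is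
listed in exactly one order. -/
def half (α : F) : Gen → Gen → Alg F
  -- the Cartan subalgebra acts by the weights
  | h1, b => (wt b 0 : F) • bas F b
  | h2, b => (wt b 1 : F) • bas F b
  | h3, b => (wt b 2 : F) • bas F b
  -- the three copies of `sl(2)`
  | e1, f1 => bas F h1
  | e2, f2 => bas F h2
  | e3, f3 => bas F h3
  -- even times odd
  | e1, y1 => bas F x1
  | e1, y2 => bas F x2
  | e1, y3 => bas F x3
  | e1, y4 => bas F x4
  | f1, x1 => bas F y1
  | f1, x2 => bas F y2
  | f1, x3 => bas F y3
  | f1, x4 => bas F y4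
  | e2, x3 => bas F x1
  | e2, x4 => bas F x2
  | e2, y3 => bas F y1
  | e2, y4 => bas F y2
  | f2, x1 => bas F x3
  | f2, x2 => bas F x4
  | f2, y1 => bas F y3
  | f2, y2 => bas F y4
  | e3, x2 => bas F x1
  | e3, x4 => bas F x3
  | e3, y2 => bas F y1
  | e3, y4 => bas F y3
  | f3, x1 => bas F x2
  | f3, x3 => bas F x4
  | f3, y1 => bas F y2
  | f3, y3 => bas F y4
  -- odd times odd
  | x1, y2 => (-2 : F) • bas F e2
  | x1, y3 => (-2 * α) • bas F e3
  | x1, y4 => (-(1 + α)) • bas F h1 + bas F h2 + α • bas F h3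
  | x2, y1 => (2 : F) • bas F e2
  | x2, y4 => (2 * α) • bas F f3
  | x2, y3 => (1 + α) • bas F h1 - bas F h2 + α • bas F h3
  | x3, y1 => (2 * α) • bas F e3
  | x3, y4 => (2 : F) • bas F f2
  | x3, y2 => (1 + α) • bas F h1 + bas F h2 - α • bas F h3
  | x4, y2 => (-2 * α) • bas F f3
  | x4, y3 => (-2 : F) • bas F f2
  | x4, y1 => (-(1 + α)) • bas F h1 - bas F h2 - α • bas F h3
  | y2, y3 => (2 * (1 + α)) • bas F f1
  | y1, y4 => (-2 * (1 + α)) • bas F f1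
  | x2, x3 => (-2 * (1 + α)) • bas F e1
  | x1, x4 => (2 * (1 + α)) • bas F e1
  | _, _ => 0

/-- The bracket of two basis elements: the table, extended by super-antisymmetry
`[b, c] = -(-1)^{|b||c|} [c, b]`. -/
def basBracket (α : F) (b c : Gen) : Alg F :=
  half α b c - superSign F (par b) (par c) • half α c b

/-- The bracket of `D(2,1;α)`. -/
def bracket (α : F) : Alg F →ₗ[F] Alg F →ₗ[F] Alg F :=
  (Pi.basisFun F Gen).constr F fun b => (Pi.basisFun F Gen).constr F fun c => basBracket α b c

/-- The `ZMod 2`-grading of `D(2,1;α)`. -/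
def gr (F : Type*) [Field F] (i : ZMod 2) : Submodule F (Alg F) :=
  Submodule.span F {x | ∃ b, par b = i ∧ x = bas F b}

theorem bas_mem_gr (b : Gen) {i : ZMod 2} (h : par b = i) : bas F b ∈ gr F i :=
  Submodule.subset_span ⟨b, h, rfl⟩

/-- The even basis elements as elements of the even part. -/
def evenBas (F : Type*) [Field F] (b : Gen) (h : par b = 0) : gr F 0 := ⟨bas F b, bas_mem_gr b h⟩

theorem par_hG : ∀ i, par (hG i) = 0 := by decide
theorem par_eG : ∀ i, par (eG i) = 0 := by decide
theorem par_fG : ∀ i, par (fG i) = 0 := by decide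

/-- `h_i` as an element of the even part. -/
def hE (F : Type*) [Field F] (i : Fin 3) : gr F 0 := evenBas F (hG i) (par_hG i)

/-- `e_i` as an element of the even part. -/
def eE (F : Type*) [Field F] (i : Fin 3) : gr F 0 := evenBas F (eG i) (par_eG i)

/-- `f_i` as an element of the even part. -/
def fE (F : Type*) [Field F] (i : Fin 3) : gr F 0 := evenBas F (fG i) (par_fG i)

/-- The `p`-mapping on the even basis elements: `h_i ↦ h_i`, `e_i, f_i ↦ 0`. -/
def pMap (F : Type*) [Field F] : Gen → Alg F
  | h1 => bas F h1
  | h2 => bas F h2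
  | h3 => bas F h3
  | _ => 0

/-- The defining relations of the `χ`-reduced enveloping algebra: the super-commutation relations
`bc - (-1)^{|b||c|} cb = [b, c]`, and the relations `b^p - b^{[p]} = χ(b)^p` for even `b`. As the
supercommutator is bilinear and `x ↦ x^p - x^{[p]}` is `p`-semilinear on the even part, it is
enough to impose both on basis elements. -/
inductive Rel (p : ℕ) (α : F) (χ : Module.Dual F (gr F 0)) :
    TensorAlgebra F (Alg F) → TensorAlgebra F (Alg F) → Prop
  | comm (b c : Gen) : Rel p α χ
      (TensorAlgebra.ι F (bas F b) * TensorAlgebra.ι F (bas F c))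
      (superSign F (par b) (par c) •
          (TensorAlgebra.ι F (bas F c) * TensorAlgebra.ι F (bas F b)) +
        TensorAlgebra.ι F (bracket α (bas F b) (bas F c)))
  | pow (b : Gen) (hb : par b = 0) : Rel p α χ
      (TensorAlgebra.ι F (bas F b) ^ p)
      (TensorAlgebra.ι F (pMap F b) +
        algebraMap F (TensorAlgebra F (Alg F)) (χ (evenBas F b hb) ^ p))

/-- The `χ`-reduced enveloping algebra `u_χ(g)` of `g = D(2,1;α)`. -/
abbrev RedEnv (p : ℕ) (α : F) (χ : Module.Dual F (gr F 0)) : Type _ := RingQuot (Rel p α χ)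

/-- The canonical map `g → u_χ(g)`. -/
def toEnv (p : ℕ) (α : F) (χ : Module.Dual F (gr F 0)) : Alg F →ₗ[F] RedEnv p α χ :=
  (RingQuot.mkAlgHom F (Rel p α χ)).toLinearMap ∘ₗ TensorAlgebra.ι F

/-- `Λ_χ`: the `λ ∈ h*`, in coordinates `λ = (λ(h1), λ(h2), λ(h3))`, with
`λ(h)^p - λ(h^{[p]}) = χ(h)^p` for all `h = ∑ c_i h_i`, where `h^{[p]} = ∑ c_i^p h_i`. -/
def weightSet (p : ℕ) (χ : Module.Dual F (gr F 0)) : Set (Fin 3 → F) :=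
  {lam | ∀ c : Fin 3 → F,
    (∑ i, c i * lam i) ^ p - ∑ i, c i ^ p * lam i = χ (∑ i, c i • hE F i) ^ p}

/-- The left ideal of `u_χ(g)` generated by `n⁺` and all `h_i - λ(h_i)`. -/
def vermaIdeal (p : ℕ) (α : F) (χ : Module.Dual F (gr F 0)) (lam : Fin 3 → F) :
    Submodule (RedEnv p α χ) (RedEnv p α χ) :=
  Submodule.span (RedEnv p α χ)
    ({u | ∃ b, IsPos b ∧ u = toEnv p α χ (bas F b)} ∪
      {u | ∃ i, u = toEnv p α χ (bas F (hG i)) - algebraMap F (RedEnv p α χ) (lam i)})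

/-- The baby Verma module `Z_χ(λ) = u_χ(g) ⊗_{u_χ(h ⊕ n⁺)} K_λ`. Since `K_λ` is the quotient of
`u_χ(h ⊕ n⁺)` by the left ideal generated by `n⁺` and the `h_i - λ(h_i)`, this is the quotient of
`u_χ(g)` by the left ideal with the same generators. -/
abbrev BabyVerma (p : ℕ) (α : F) (χ : Module.Dual F (gr F 0)) (lam : Fin 3 → F) : Type _ :=
  RedEnv p α χ ⧸ vermaIdeal p α χ lam

/-- The generator `1 ⊗ v` of the baby Verma module. -/
def hwv (p : ℕ) (α : F) (χ : Module.Dual F (gr F 0)) (lam : Fin 3 → F) : BabyVerma p α χ lam :=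
  (vermaIdeal p α χ lam).mkQ 1

/-- The action of `g` on the baby Verma module. -/
def action (p : ℕ) (α : F) (χ : Module.Dual F (gr F 0)) (lam : Fin 3 → F) :
    Alg F →ₗ[F] Module.End F (BabyVerma p α χ lam) :=
  (Algebra.lsmul F F (BabyVerma p α χ lam)).toLinearMap ∘ₗ toEnv p α χ

/-- The grading of the baby Verma module in which `1 ⊗ v` is even: a product of basis elements of
`g`, applied to `1 ⊗ v`, has as parity the sum of the parities of the factors. -/
def vermaGr (p : ℕ) (α : F) (χ : Module.Dual F (gr F 0)) (lam : Fin 3 → F) (i : ZMod 2) :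
    Submodule F (BabyVerma p α χ lam) :=
  Submodule.span F {z | ∃ l : List Gen, (l.map par).sum = i ∧
    z = (l.map fun b => toEnv p α χ (bas F b)).prod • hwv p α χ lam}

/-- The smallest nonnegative integer in the residue class of `n / 2` modulo `p`. -/
def halfMod (p : ℕ) (n : ℤ) : ℕ := ((n : ZMod p) * (2 : ZMod p)⁻¹).val

/-- The vector `w_β^θ = f1^{k1} f2^{k2} f3^{k3} y1^{j1} y2^{j2} y3^{j3} y4^{j4} ⊗ v`, where
`θ = (j1, j2, j3, j4)`, `l` is an integral weight, and `k1, k2, k3` are the exponents in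
`{0, …, p-1}` for which it has weight `β` in the baby Verma module of highest weight `l`. -/
def w (p : ℕ) (α : F) (χ : Module.Dual F (gr F 0)) (lam : Fin 3 → F) (l β : Fin 3 → ℤ)
    (j1 j2 j3 j4 : ℕ) : BabyVerma p α χ lam :=
  (toEnv p α χ (bas F f1) ^ halfMod p (l 0 - β 0 - j1 - j2 - j3 - j4) *
    toEnv p α χ (bas F f2) ^ halfMod p (l 1 - β 1 + j1 + j2 - j3 - j4) *
    toEnv p α χ (bas F f3) ^ halfMod p (l 2 - β 2 + j1 - j2 + j3 - j4) *
    toEnv p α χ (bas F y1) ^ j1 * toEnv p α χ (bas F y2) ^ j2 *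
    toEnv p α χ (bas F y3) ^ j3 * toEnv p α χ (bas F y4) ^ j4) • hwv p α χ lam

/-- The linear map `ψ₁` for `λ = (2,-2,-2)` with its six parameters: `a i` is the coefficient of
the value at `h_i`, and `c i` the coefficient of the value at `f_i`. -/
def psi1 (p : ℕ) (α : F) (χ : Module.Dual F (gr F 0)) (lam : Fin 3 → F) (a c : Fin 3 → F) :
    Alg F →ₗ[F] BabyVerma p α χ lam :=
  (Pi.basisFun F Gen).constr F fun b =>
    let W : ℕ → ℕ → ℕ → ℕ → BabyVerma p α χ lam := w p α χ lam ![2, -2, -2] (wt b)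
    let A : F := (1 + α) * a 0
    let C : F := (1 + α) * c 0
    match b with
    | h1 => a 0 • W 1 1 1 1
    | h2 => a 1 • W 1 1 1 1
    | h3 => a 2 • W 1 1 1 1
    | f1 => c 0 • W 1 1 1 1
    | f2 => c 1 • W 1 1 1 1
    | f3 => c 2 • W 1 1 1 1
    | e1 => (-8 * C) • W 0 0 0 0 + (2 * c 1) • W 1 1 0 0 - (2 * α * c 2) • W 1 0 1 0
        + (A - a 1 + α * a 2) • W 1 0 0 1 - (A - a 1 - α * a 2) • W 0 1 1 0 - a 0 • W 1 1 1 1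
    | e2 => (2 * C) • W 1 1 0 0 - a 1 • W 1 1 1 1
    | e3 => -(a 2 • W 1 1 1 1)
    | x1 => (4 * C) • (W 1 0 0 0 + W 0 1 0 0 + W 0 0 1 0 + W 0 0 0 1)
        + (A - a 1 - α * a 2) • W 1 1 1 0 + (A - a 1 + α * a 2) • W 1 1 0 1
        - (A + a 1 - α * a 2) • W 1 0 1 1 - (A + a 1 + α * a 2) • W 0 1 1 1
    | x2 => (4 * C) • (W 0 1 0 0 + W 0 0 0 1)
        - (2 * α * c 2) • W 1 1 1 0 + (A - a 1 + α * a 2) • W 1 1 0 1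
        + (2 * α * c 2) • W 1 0 1 1 - (A + a 1 + α * a 2) • W 0 1 1 1
    | x3 => (4 * C) • (W 0 0 1 0 + W 0 0 0 1)
        - (2 * c 1) • W 1 1 1 0 - (2 * c 1) • W 1 1 0 1
        - (A + a 1 - α * a 2) • W 1 0 1 1 - (A + a 1 + α * a 2) • W 0 1 1 1
    | x4 => (4 * C) • W 0 0 0 1
        - (2 * c 1) • W 1 1 0 1 + (2 * α * c 2) • W 1 0 1 1 - (A + a 1 + α * a 2) • W 0 1 1 1
    | y1 => (-2 * C) • (W 1 0 1 1 + W 0 1 1 1)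
    | y2 => (-2 * C) • W 0 1 1 1
    | y3 => (-2 * C) • (W 1 0 1 1 + W 0 1 1 1)
    | y4 => (-2 * C) • W 0 1 1 1

/-- The linear map `ψ₂` for `λ = (2,-2,0)`, normalized to have parameter 1. -/
def psi2 (p : ℕ) (α : F) (χ : Module.Dual F (gr F 0)) (lam : Fin 3 → F) :
    Alg F →ₗ[F] BabyVerma p α χ lam :=
  (Pi.basisFun F Gen).constr F fun b =>
    let W : ℕ → ℕ → ℕ → ℕ → BabyVerma p α χ lam := w p α χ lam ![2, -2, 0] (wt b)
    match b with
    | e1 => (2 * α) • W 0 1 0 1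
    | e3 => W 1 1 1 1
    | x1 => (-2 * α) • W 1 1 0 1 + (2 * α) • W 0 1 1 1
    | x3 => (2 * α) • W 0 1 1 1
    | _ => 0

/-- The linear map `ψ₃` for `λ = (2,0,-2)`, normalized to have parameter 1. -/
def psi3 (p : ℕ) (α : F) (χ : Module.Dual F (gr F 0)) (lam : Fin 3 → F) :
    Alg F →ₗ[F] BabyVerma p α χ lam :=
  (Pi.basisFun F Gen).constr F fun b =>
    let W : ℕ → ℕ → ℕ → ℕ → BabyVerma p α χ lam := w p α χ lam ![2, 0, -2] (wt b)
    match b with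
    | e1 => (-2 : F) • W 0 0 1 1
    | e2 => W 1 1 1 1
    | x1 => (2 : F) • W 1 0 1 1 + (2 : F) • W 0 1 1 1
    | x2 => (2 : F) • W 0 1 1 1
    | _ => 0

/-- The linear map `ψ₄` for `λ = (3,-3,-3)`, normalized to have parameter 1. -/
def psi4 (p : ℕ) (α : F) (χ : Module.Dual F (gr F 0)) (lam : Fin 3 → F) :
    Alg F →ₗ[F] BabyVerma p α χ lam :=
  (Pi.basisFun F Gen).constr F fun b =>
    let W : ℕ → ℕ → ℕ → ℕ → BabyVerma p α χ lam := w p α χ lam ![3, -3, -3] (wt b)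
    match b with
    | e1 => W 1 1 1 0
    | x1 => -W 1 1 1 1
    | x2 => -W 1 1 1 1
    | x3 => -W 1 1 1 1
    | x4 => -W 1 1 1 1
    | _ => 0

/-- The homogeneous derivations of parity `i` from `D(2,1;α)` to the baby Verma module. -/
abbrev DerHomZ (p : ℕ) (α : F) (χ : Module.Dual F (gr F 0)) (lam : Fin 3 → F) (i : ZMod 2) :
    Submodule F (Alg F →ₗ[F] BabyVerma p α χ lam) :=
  DerHom (bracket α) (gr F) (action p α χ lam) (vermaGr p α χ lam) i

/-- `Der(g, Z_χ(λ))`. -/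
abbrev DerZ (p : ℕ) (α : F) (χ : Module.Dual F (gr F 0)) (lam : Fin 3 → F) :
    Submodule F (Alg F →ₗ[F] BabyVerma p α χ lam) :=
  Der (bracket α) (gr F) (action p α χ lam) (vermaGr p α χ lam)

/-- `H¹(g, Z_χ(λ))`. -/
abbrev H1Z (p : ℕ) (α : F) (χ : Module.Dual F (gr F 0)) (lam : Fin 3 → F) : Type _ :=
  H1 (bracket α) (gr F) (action p α χ lam) (vermaGr p α χ lam)

/-- The class in `H¹(g, Z_χ(λ))` of a derivation. -/
abbrev clsZ (p : ℕ) (α : F) (χ : Module.Dual F (gr F 0)) (lam : Fin 3 → F) :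
    DerZ p α χ lam →ₗ[F] H1Z p α χ lam :=
  H1.cls (bracket α) (gr F) (action p α χ lam) (vermaGr p α χ lam)

/-- The superdimension of `H¹(g, Z_χ(λ))`. -/
abbrev sdimZ (p : ℕ) (α : F) (χ : Module.Dual F (gr F 0)) (lam : Fin 3 → F) :
    Cardinal × Cardinal :=
  H1.sdim (bracket α) (gr F) (action p α χ lam) (vermaGr p α χ lam)

theorem DerHomZ_le (p : ℕ) (α : F) (χ : Module.Dual F (gr F 0)) (lam : Fin 3 → F) (i : ZMod 2) :
    DerHomZ p α χ lam i ≤ DerZ p α χ lam :=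
  le_iSup (DerHomZ p α χ lam) i

end D21

end

/-! # The first cohomology of `D(2,1;α)` with values in baby Verma modules

Let `Z` be a baby Verma module. A derivation `φ : g → Z` is the same as an extension of the
trivial module by `Z`, and it is inner if and only if the extension splits.

If the `p`-character is nonzero at some even basis element `b`, the central element
`b^p - b^{[p]}` acts on `Z` by a nonzero scalar and on the trivial module by zero, so that all
extensions split (`mem_ider_of_ne_zero`).

Otherwise let `δ` be the linear form on `Z` that takes the coefficient of the lowest monomial
`f₁^{p-1} f₂^{p-1} f₃^{p-1} y₁ y₂ y₃ y₄ ⊗ v`. It vanishes on `n⁺ Z`, it is an eigenvector for `h`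
of weight `μ = λ - (2, -2, -2)`, and it vanishes on no nonzero submodule (`IsTopForm`,
`zRep_isTopForm`). If the extension of `δ` by zero remains a highest weight vector, killed by the
`f_i^p`, in the dual of the extension `Z ⊕ F`, then the submodule that it generates is spanned by
`16 p³ = dim Z` monomials; so some vector outside `Z` is killed by it, and this vector splits the
extension (`IsTopForm.exists_inner_of_highest`). Thus `φ` is inner when `δ (φ a) = 0` for `a` in
`h` and `n⁺`, and `δ (f_i^{p-1} φ(f_i)) = 0`.

These numbers are governed by the weight `μ`. On `n⁺` they are determined by the values at
`e₂, e₃, x₄`, which generate `n⁺`; the value at such an `a` can be nonzero only when `μ` is the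
weight of `a`. If `μ ≠ 0`, the values on `h` vanish after subtraction of an inner derivation, and
the values belonging to the `f_i` vanish because `f_i^{p-1} φ(f_i)` is an invariant. If `μ = 0`,
the six values belonging to the `h_i` and `f_i` vanish on all inner derivations. So `H¹` embeds
into a space of dimension `6` for `μ = 0`, of dimension `1` if `μ` is the weight of `e₃`, `e₂` or
`x₄`, and into zero otherwise, and `ψ₁, …, ψ₄` show that the embeddings are surjective
(`H1Z_of_wt_zero`, `H1Z_of_wt`, `derHom_le_ider`).

The facts about `Z` that this rests on are obtained from a model on the space with the monomials
`f₁^{k₁} f₂^{k₂} f₃^{k₃} y_J` as a basis (`modelRep_isRep`, `exists_equiv_model`). The action on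
it, and that the `ψ_i` are derivations, come down to finitely many identities between formal
combinations of monomials with coefficients in `ℤ[α, λ₁, λ₂, λ₃, …]`, in which exponents `p - k`
are written as `-k`; they do not depend on `p` and are verified by computation (`defect_check`,
`dual_check`, `psi1_check`).
-/

namespace D21
open Gen

/-! ### Formal linear combinations with polynomial coefficients -/

/-- A term `coef * X_{i₁} ⋯ X_{iᵣ} * key` of a formal linear combination; `mon` is the list
`[i₁, …, iᵣ]`, kept in increasing order. -/
structure Term (κ : Type) where
  coef : ℤ
  mon : List ℕ
  key : κ

/-- Formal linear combinations of elements of `κ`, with coefficients in `ℤ[X₀, X₁, …]`. They are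
plain lists, in which a key may occur several times, so that the kernel can compute with them. -/
abbrev Comb (κ : Type) := List (Term κ)

/-- Multiplication of a monomial by a variable. -/
def insMon (n : ℕ) : List ℕ → List ℕ
  | [] => [n]
  | m :: l => if Nat.ble n m then n :: m :: l else m :: insMon n l

/-- Multiplication of monomials. -/
def mulMon (a b : List ℕ) : List ℕ := a.foldr insMon b

/-- Multiplication of a formal combination by `c * m`. -/
def scale {κ : Type} (c : ℤ) (m : List ℕ) (l : Comb κ) : Comb κ :=
  l.map fun t => ⟨c * t.coef, mulMon m t.mon, t.key⟩

/-- Linear extension: every key `k` of `l` is replaced by the combination `A k`. -/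
def subst {κ κ' : Type} (l : Comb κ) (A : κ → Comb κ') : Comb κ' :=
  l.flatMap fun t => scale t.coef t.mon (A t.key)

/-- Addition of one term, collecting like terms. -/
def addTerm {κ : Type} [DecidableEq κ] (s : Term κ) : Comb κ → Comb κ
  | [] => [s]
  | t :: l => if t.key = s.key ∧ t.mon = s.mon then ⟨s.coef + t.coef, s.mon, s.key⟩ :: l
    else t :: addTerm s l

/-- Collection of like terms. -/
def collect {κ : Type} [DecidableEq κ] : Comb κ → Comb κ
  | [] => []
  | t :: l => addTerm t (collect l)

/-- A sufficient test for a combination to be zero: all coefficients vanish after like terms have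
been collected. -/
def isZero {κ : Type} [DecidableEq κ] (l : Comb κ) : Bool :=
  (collect l).all fun t => t.coef == 0

section Eval

variable {F M N : Type*} [Field F] [AddCommGroup M] [Module F M] [AddCommGroup N] [Module F N]
  {κ κ' : Type}

/-- The value of a formal combination when `X_i` is given the value `v i` and the key `k` the
value `f k`. -/
def ev (v : ℕ → F) (f : κ → M) (l : Comb κ) : M :=
  (l.map fun t => ((t.coef : F) * (t.mon.map v).prod) • f t.key).sum

theorem ev_nil (v : ℕ → F) (f : κ → M) : ev v f [] = 0 := rfl

theorem ev_cons (v : ℕ → F) (f : κ → M) (t : Term κ) (l : Comb κ) :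
    ev v f (t :: l) = ((t.coef : F) * (t.mon.map v).prod) • f t.key + ev v f l := by
  simp [ev]

theorem ev_append (v : ℕ → F) (f : κ → M) (l l' : Comb κ) :
    ev v f (l ++ l') = ev v f l + ev v f l' := by
  simp [ev]

theorem prod_insMon (v : ℕ → F) (n : ℕ) (l : List ℕ) :
    ((insMon n l).map v).prod = v n * (l.map v).prod := by
  induction l with
  | nil => simp [insMon]
  | cons m l ih =>
    unfold insMon
    split_ifs
    · simp
    · simp [ih, mul_left_comm]

theorem prod_mulMon (v : ℕ → F) (a b : List ℕ) :
    ((mulMon a b).map v).prod = (a.map v).prod * (b.map v).prod := by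
  unfold mulMon
  induction a with
  | nil => simp
  | cons n a ih => simp [prod_insMon, ih, mul_assoc]

theorem ev_scale (v : ℕ → F) (f : κ → M) (c : ℤ) (m : List ℕ) (l : Comb κ) :
    ev v f (scale c m l) = ((c : F) * (m.map v).prod) • ev v f l := by
  induction l with
  | nil => simp [scale, ev]
  | cons t l ih =>
    have h : scale c m (t :: l) = ⟨c * t.coef, mulMon m t.mon, t.key⟩ :: scale c m l := rfl
    rw [h, ev_cons, ev_cons, ih, smul_add, smul_smul]
    congr 2
    simp only [prod_mulMon]
    push_cast
    ring

theorem ev_map_mul (v : ℕ → F) (f : κ' → M) (c : ℤ) (g : κ → κ') (l : Comb κ) :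
    ev v f (l.map fun t => ⟨c * t.coef, t.mon, g t.key⟩) = (c : F) • ev v (fun k => f (g k)) l := by
  induction l with
  | nil => simp [ev]
  | cons t l ih =>
    rw [List.map_cons, ev_cons, ev_cons, ih, smul_add, smul_smul]
    push_cast
    rw [mul_assoc]

theorem ev_subst (v : ℕ → F) (f : κ' → M) (l : Comb κ) (A : κ → Comb κ') :
    ev v f (subst l A) = ev v (fun k => ev v f (A k)) l := by
  induction l with
  | nil => simp [subst, ev]
  | cons t l ih =>
    have h : subst (t :: l) A = scale t.coef t.mon (A t.key) ++ subst l A := rfl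
    rw [h, ev_append, ev_cons, ih, ev_scale]

theorem ev_addTerm [DecidableEq κ] (v : ℕ → F) (f : κ → M) (s : Term κ) (l : Comb κ) :
    ev v f (addTerm s l) = ((s.coef : F) * (s.mon.map v).prod) • f s.key + ev v f l := by
  induction l with
  | nil => simp [addTerm, ev]
  | cons t l ih =>
    unfold addTerm
    split_ifs with h
    · rw [ev_cons, ev_cons, ← add_assoc, h.1, h.2, ← add_smul]
      push_cast
      rw [add_mul]
    · rw [ev_cons, ev_cons, ih, add_left_comm]

theorem ev_collect [DecidableEq κ] (v : ℕ → F) (f : κ → M) (l : Comb κ) :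
    ev v f (collect l) = ev v f l := by
  induction l with
  | nil => rfl
  | cons t l ih => rw [collect, ev_addTerm, ih, ev_cons]

theorem ev_eq_zero [DecidableEq κ] (v : ℕ → F) (f : κ → M) {l : Comb κ} (h : isZero l = true) :
    ev v f l = 0 := by
  rw [← ev_collect]
  refine List.sum_eq_zero fun x hx => ?_
  obtain ⟨t, ht, rfl⟩ := List.mem_map.1 hx
  have := List.all_eq_true.1 h t ht
  simp [beq_iff_eq.1 this]

theorem map_ev (φ : M →ₗ[F] N) (v : ℕ → F) (f : κ → M) (l : Comb κ) :
    φ (ev v f l) = ev v (fun k => φ (f k)) l := by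
  simp [ev, map_list_sum, Function.comp_def]

theorem ev_congr (v : ℕ → F) {f f' : κ → M} {l : Comb κ} (h : ∀ t ∈ l, f t.key = f' t.key) :
    ev v f l = ev v f' l := by
  unfold ev
  congr 1
  exact List.map_congr_left fun t ht => by rw [h t ht]

theorem ev_add_smul (v : ℕ → F) (c : F) (f g : κ → M) (l : Comb κ) :
    ev v (fun k => c • f k + g k) l = c • ev v f l + ev v g l := by
  induction l with
  | nil => simp [ev]
  | cons t l ih => rw [ev_cons, ev_cons, ev_cons, ih]; module

theorem ev_mem (v : ℕ → F) (S : Submodule F M) {f : κ → M} {l : Comb κ}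
    (h : ∀ t ∈ l, f t.key ∈ S) : ev v f l ∈ S := by
  refine S.list_sum_mem fun x hx => ?_
  obtain ⟨t, ht, rfl⟩ := List.mem_map.1 hx
  exact S.smul_mem _ (h t ht)

theorem ev_apply (v : ℕ → F) (f : κ → Module.End F M) (l : Comb κ) (m : M) :
    ev v f l m = ev v (fun k => f k m) l :=
  map_ev (LinearMap.applyₗ m) v f l

theorem mul_ev (v : ℕ → F) (X : Module.End F M) (f : κ → Module.End F M) (l : Comb κ) :
    X * ev v f l = ev v (fun k => X * f k) l :=
  map_ev (LinearMap.mulLeft F X) v f l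

theorem ev_mul (v : ℕ → F) (X : Module.End F M) (f : κ → Module.End F M) (l : Comb κ) :
    ev v f l * X = ev v (fun k => f k * X) l :=
  map_ev (LinearMap.mulRight F X) v f l

end Eval

/-! ### Structure constants -/

/-- The table `half` as formal combinations, with `X₀` in the role of `α`. -/
def halfL : Gen → Gen → Comb Gen
  | h1, b => if wt b 0 = 0 then [] else [⟨wt b 0, [], b⟩]
  | h2, b => if wt b 1 = 0 then [] else [⟨wt b 1, [], b⟩]
  | h3, b => if wt b 2 = 0 then [] else [⟨wt b 2, [], b⟩]
  | e1, f1 => [⟨1, [], h1⟩]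
  | e2, f2 => [⟨1, [], h2⟩]
  | e3, f3 => [⟨1, [], h3⟩]
  | e1, y1 => [⟨1, [], x1⟩]
  | e1, y2 => [⟨1, [], x2⟩]
  | e1, y3 => [⟨1, [], x3⟩]
  | e1, y4 => [⟨1, [], x4⟩]
  | f1, x1 => [⟨1, [], y1⟩]
  | f1, x2 => [⟨1, [], y2⟩]
  | f1, x3 => [⟨1, [], y3⟩]
  | f1, x4 => [⟨1, [], y4⟩]
  | e2, x3 => [⟨1, [], x1⟩]
  | e2, x4 => [⟨1, [], x2⟩]
  | e2, y3 => [⟨1, [], y1⟩]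
  | e2, y4 => [⟨1, [], y2⟩]
  | f2, x1 => [⟨1, [], x3⟩]
  | f2, x2 => [⟨1, [], x4⟩]
  | f2, y1 => [⟨1, [], y3⟩]
  | f2, y2 => [⟨1, [], y4⟩]
  | e3, x2 => [⟨1, [], x1⟩]
  | e3, x4 => [⟨1, [], x3⟩]
  | e3, y2 => [⟨1, [], y1⟩]
  | e3, y4 => [⟨1, [], y3⟩]
  | f3, x1 => [⟨1, [], x2⟩]
  | f3, x3 => [⟨1, [], x4⟩]
  | f3, y1 => [⟨1, [], y2⟩]
  | f3, y3 => [⟨1, [], y4⟩]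
  | x1, y2 => [⟨-2, [], e2⟩]
  | x1, y3 => [⟨-2, [0], e3⟩]
  | x1, y4 => [⟨-1, [], h1⟩, ⟨-1, [0], h1⟩, ⟨1, [], h2⟩, ⟨1, [0], h3⟩]
  | x2, y1 => [⟨2, [], e2⟩]
  | x2, y4 => [⟨2, [0], f3⟩]
  | x2, y3 => [⟨1, [], h1⟩, ⟨1, [0], h1⟩, ⟨-1, [], h2⟩, ⟨1, [0], h3⟩]
  | x3, y1 => [⟨2, [0], e3⟩]
  | x3, y4 => [⟨2, [], f2⟩]
  | x3, y2 => [⟨1, [], h1⟩, ⟨1, [0], h1⟩, ⟨1, [], h2⟩, ⟨-1, [0], h3⟩]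
  | x4, y2 => [⟨-2, [0], f3⟩]
  | x4, y3 => [⟨-2, [], f2⟩]
  | x4, y1 => [⟨-1, [], h1⟩, ⟨-1, [0], h1⟩, ⟨-1, [], h2⟩, ⟨-1, [0], h3⟩]
  | y2, y3 => [⟨2, [], f1⟩, ⟨2, [0], f1⟩]
  | y1, y4 => [⟨-2, [], f1⟩, ⟨-2, [0], f1⟩]
  | x2, x3 => [⟨-2, [], e1⟩, ⟨-2, [0], e1⟩]
  | x1, x4 => [⟨2, [], e1⟩, ⟨2, [0], e1⟩]
  | _, _ => []

/-- Parity as a Boolean. -/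
def odd : Gen → Bool
  | x1 | x2 | x3 | x4 | y1 | y2 | y3 | y4 => true
  | _ => false

/-- The sign `(-1)^{|a||b|}`. -/
def sgn (a b : Gen) : ℤ := if odd a && odd b then -1 else 1

/-- The bracket of two basis elements as a formal combination. -/
def brL (a b : Gen) : Comb Gen := halfL a b ++ scale (-sgn a b) [] (halfL b a)

/-- All basis elements. -/
def gens : List Gen := [h1, h2, h3, e1, e2, e3, f1, f2, f3, x1, x2, x3, x4, y1, y2, y3, y4]

theorem mem_gens (a : Gen) : a ∈ gens := by cases a <;> decide

variable {F : Type*} [Field F]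

theorem ev_halfL {v : ℕ → F} (a b : Gen) : ev v (bas F) (halfL a b) = half (v 0) a b := by
  cases a <;> cases b <;>
    simp [halfL, half, wt, ev, add_smul, sub_eq_add_neg, mul_add] <;> abel

theorem par_eq (a : Gen) : par a = if odd a then 1 else 0 := by cases a <;> rfl

theorem superSign_par (a b : Gen) : superSign F (par a) (par b) = (sgn a b : F) := by
  rw [par_eq, par_eq, sgn]
  have h : (1 : ZMod 2).val = 1 := rfl
  cases odd a <;> cases odd b <;> simp [superSign, h]

theorem bracket_bas (α : F) (a b : Gen) : bracket α (bas F a) (bas F b) = basBracket α a b := by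
  have h (c : Gen) : bas F c = Pi.basisFun F Gen c := by simp [bas]
  simp only [bracket, h, Module.Basis.constr_basis]

theorem ev_brL {v : ℕ → F} (a b : Gen) :
    ev v (bas F) (brL a b) = bracket (v 0) (bas F a) (bas F b) := by
  rw [bracket_bas, basBracket, brL, ev_append, ev_scale, ev_halfL, ev_halfL, superSign_par]
  simp [sub_eq_add_neg]

/-! ### The action on the monomials `f₁^{k₁} f₂^{k₂} f₃^{k₃} y_J v` as a computation -/

/-- The label of the vector `f₁^{k₁} f₂^{k₂} f₃^{k₃} y_J v`, where `y_J` is the product of the list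
`J` of odd negative basis elements. A negative exponent `k` stands for `p + k`. -/
structure Ix where
  k1 : ℤ
  k2 : ℤ
  k3 : ℤ
  J : List Gen
  deriving DecidableEq

/-- `isY y = true` for `y = y₁, …, y₄`. -/
def isY : Gen → Bool
  | y1 | y2 | y3 | y4 => true
  | _ => false

/-- The normal form of `y y_J v`: the factor `y` is moved to its place, where `y_j² = 0` and
`y y_j = -y_j y + [y, y_j]` with `[y, y_j]` a multiple of `f₁`. -/
def ins (y : Gen) : List Gen → Comb Ix
  | [] => [⟨1, [], 0, 0, 0, [y]⟩]
  | j :: J =>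
    if Nat.blt (Gen.ctorIdx y) (Gen.ctorIdx j) then [⟨1, [], 0, 0, 0, y :: j :: J⟩]
    else if y = j then []
    else ((ins y J).map fun t => ⟨-t.coef, t.mon, t.key.k1, t.key.k2, t.key.k3, j :: t.key.J⟩) ++
      (brL y j).map fun t => ⟨t.coef, t.mon, 1, 0, 0, J⟩

/-- The expansion of `a f^k` as a combination of the products `f^{k-l} b`, labelled by `(l, b)`, for
`f = f_i` and `e = e_i`:
`a f^k = f^k a + k f^{k-1} [a, f] + k (k - 1) / 2 f^{k-2} [[a, f], f]`. The last summand occurs for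
`a = e` only, where `[[e, f], f] = -2 f`. -/
def pass (e f : Gen) (k : ℤ) (a : Gen) : Comb (ℤ × Gen) :=
  ⟨1, [], 0, a⟩ :: if k = 0 then [] else
    ((brL a f).map fun t => ⟨k * t.coef, t.mon, 1, t.key⟩) ++
      if a = e then [⟨-k * (k - 1), [], 2, f⟩] else []

/-- Whether the exponent `k` passes the bound `p` when `m` is added to it. -/
def carries (k m : ℤ) : Bool := decide (k < 0) && decide (0 ≤ k + m)

/-- Multiplication of a monomial by `f₁^{k₁} f₂^{k₂} f₃^{k₃}`. The result is zero when an exponent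
reaches `p`, as `f_i^p = 0`. -/
def shift (k1 k2 k3 : ℤ) (i : Ix) : Comb Ix :=
  if carries k1 i.k1 || carries k2 i.k2 || carries k3 i.k3 then []
  else [⟨1, [], k1 + i.k1, k2 + i.k2, k3 + i.k3, i.J⟩]

/-- The action of `a` on `f₁^{k₁} f₂^{k₂} f₃^{k₃} u`, when `R b` is the normal form of `b u`. -/
def passAll (R : Gen → Comb Ix) (k1 k2 k3 : ℤ) (a : Gen) : Comb Ix :=
  subst (pass e1 f1 k1 a) fun s => subst (pass e2 f2 k2 s.2) fun t =>
    subst (pass e3 f3 k3 t.2) fun u =>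
      subst (R u.2) (shift (k1 - s.1) (k2 - t.1) (k3 - u.1))

/-- The action of `y = y_j` on a monomial. It is defined before the action of the other basis
elements, whose computation on `y_J v` uses it; only `y_j` and `f₁` arise from it. -/
def actY (y : Gen) (i : Ix) : Comb Ix := passAll (fun g => ins g i.J) i.k1 i.k2 i.k3 y

/-- The normal form of `b y_J v`. The variables `X₁, X₂, X₃` stand for the highest weight. -/
def actJ : List Gen → Gen → Comb Ix
  | J, f1 => [⟨1, [], 1, 0, 0, J⟩]
  | J, f2 => [⟨1, [], 0, 1, 0, J⟩]
  | J, f3 => [⟨1, [], 0, 0, 1, J⟩]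
  | J, y1 => ins y1 J
  | J, y2 => ins y2 J
  | J, y3 => ins y3 J
  | J, y4 => ins y4 J
  | [], h1 => [⟨1, [1], 0, 0, 0, []⟩]
  | [], h2 => [⟨1, [2], 0, 0, 0, []⟩]
  | [], h3 => [⟨1, [3], 0, 0, 0, []⟩]
  | [], _ => []
  | j :: J, b => subst (brL b j) (fun g => actJ J g) ++
      scale (sgn b j) [] (subst (actJ J b) (actY j))

/-- The action of a basis element on a monomial. -/
def act (a : Gen) (i : Ix) : Comb Ix := passAll (actJ i.J) i.k1 i.k2 i.k3 a

/-- The sixteen products of odd negative basis elements. -/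
def Js : List (List Gen) := [[], [y4], [y3], [y3, y4], [y2], [y2, y4], [y2, y3], [y2, y3, y4],
  [y1], [y1, y4], [y1, y3], [y1, y3, y4], [y1, y2], [y1, y2, y4], [y1, y2, y3], [y1, y2, y3, y4]]

/-- Parity of a product of odd elements. -/
def oddLen : List Gen → Bool
  | [] => false
  | _ :: J => !oddLen J

/-- The supercommutation relation of `a` and `b`, applied to `y_J v`. -/
def defect (a b : Gen) (J : List Gen) : Comb Ix :=
  subst (actJ J b) (act a) ++ scale (-sgn a b) [] (subst (actJ J a) (act b)) ++
    scale (-1) [] (subst (brL a b) (actJ J))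

set_option maxRecDepth 100000 in
/-- The expressions `actJ J b` involve no powers with negative exponent, and have the parity
of `b y_J`. -/
theorem actJ_check : (Js.all fun J => gens.all fun b => (actJ J b).all fun t =>
    decide (0 ≤ t.key.k1) && decide (0 ≤ t.key.k2) && decide (0 ≤ t.key.k3) &&
      Js.contains t.key.J && (oddLen t.key.J == (oddLen J ^^ odd b))) = true := by
  decide +kernel

set_option maxRecDepth 100000 in
/-- The Jacobi identity of `D(2,1;α)`, over `ℤ[α]`. -/
theorem jacobi_check : (gens.all fun a => gens.all fun b => gens.all fun c =>
    isZero (subst (brL b c) (brL a) ++ scale (-1) [] (subst (brL a b) fun g => brL g c) ++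
      scale (-sgn a b) [] (subst (brL a c) (brL b)))) = true := by
  decide +kernel

set_option maxRecDepth 100000 in
/-- The relations of the `y_j` with all basis elements hold on all `y_J v`. -/
theorem defect_check : ([y1, y2, y3, y4].all fun a => gens.all fun b => Js.all fun J =>
    isZero (defect a b J)) = true := by
  decide +kernel

set_option maxRecDepth 100000 in
/-- All relations hold on `v`. -/
theorem defect_nil_check : (gens.all fun a => gens.all fun b => isZero (defect a b [])) = true := by
  decide +kernel

/-- For a root vector `f` of one of the copies of `sl(2)`, with opposite root vector `e`, one has
`[[e, f], f] = -2 f`, and `[[a, f], f] = 0` for all other basis elements `a`. -/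
theorem brL_brL_check : (([(e1, f1), (e2, f2), (e3, f3), (f1, e1), (f2, e2), (f3, e3)] :
    List (Gen × Gen)).all fun ef => gens.all fun a =>
      isZero (subst (brL a ef.2) (fun g => brL g ef.2) ++
        if a = ef.1 then [⟨2, [], ef.2⟩] else [])) = true := by
  decide +kernel

/-! ### Correctness of the computation -/

/-- The exponent that the integer `k` stands for: `k` itself, or `p + k` for negative `k`. A fixed
integer label such as `-1` thus denotes the exponent `p - 1` for all `p` at once. -/
def rep (p : ℕ) (k : ℤ) : ℕ := if 0 ≤ k then k.toNat else (p + k).toNat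

/-- `f = f₁, f₂, f₃`. -/
def IsF (f : Gen) : Prop := f = f1 ∨ f = f2 ∨ f = f3

variable {F M : Type*} [Field F] [AddCommGroup M] [Module F M]

/-- The vector with label `i`, for operators `r` and vectors `u J` in the role of `y_J v`. -/
def mono (p : ℕ) (r : Gen → Module.End F M) (u : List Gen → M) (i : Ix) : M :=
  (r f1 ^ rep p i.k1) ((r f2 ^ rep p i.k2) ((r f3 ^ rep p i.k3) (u i.J)))

/-- Operators `r a` that satisfy the commutation relations with `f₁, f₂, f₃`, act on the vectors
`u J` as on `y_J v`, and for which the `f_i ^ p` kill the `u J`. This is what the computation of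
the action on all monomials needs. -/
structure HasMonomials (p : ℕ) (v : ℕ → F) (r : Gen → Module.End F M) (u : List Gen → M) :
    Prop where
  comm : ∀ a f, IsF f → r a * r f = r f * r a + ev v r (brL a f)
  pow : ∀ f, IsF f → ∀ J, (r f ^ p) (u J) = 0
  act_u : ∀ J ∈ Js, ∀ b, r b (u J) = ev v (mono p r u) (actJ J b)

theorem mul_pow_expand {X f Y Q : Module.End F M} (h1 : X * f = f * X + Y)
    (h2 : Y * f = f * Y + (2 : F) • Q) (h3 : Q * f = f * Q) (n : ℕ) :
    X * f ^ n = f ^ n * X + (n : F) • (f ^ (n - 1) * Y) +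
      ((n : F) * ((n : F) - 1)) • (f ^ (n - 2) * Q) := by
  induction n with
  | zero => simp
  | succ n ih =>
    have e1 : (n : F) • (f ^ (n - 1) * f) = (n : F) • f ^ n := by
      cases n with
      | zero => simp
      | succ n => rw [Nat.add_sub_cancel, ← pow_succ]
    have e2 : ((n : F) * ((n : F) - 1)) • (f ^ (n - 2) * f) =
        ((n : F) * ((n : F) - 1)) • f ^ (n - 1) := by
      match n with
      | 0 => simp
      | 1 => simp
      | n + 2 => rw [← pow_succ]; rfl
    calc X * f ^ (n + 1) = (X * f ^ n) * f := by rw [pow_succ, mul_assoc]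
      _ = f ^ n * (f * X + Y) + (n : F) • (f ^ (n - 1) * (f * Y + (2 : F) • Q)) +
          ((n : F) * ((n : F) - 1)) • (f ^ (n - 2) * (f * Q)) := by
        rw [ih, ← h1, ← h2, ← h3]
        simp only [add_mul, smul_mul_assoc, mul_assoc]
      _ = f ^ n * f * X + f ^ n * Y + ((n : F) • (f ^ (n - 1) * f)) * Y +
          (2 * n : F) • (f ^ (n - 1) * Q) +
          (((n : F) * ((n : F) - 1)) • (f ^ (n - 2) * f)) * Q := by
        simp only [mul_add, smul_add, mul_smul_comm, smul_smul, smul_mul_assoc, mul_assoc]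
        rw [mul_comm (n : F) 2]
        abel
      _ = _ := by
        rw [e1, e2, Nat.add_sub_cancel, pow_succ, show n + 1 - 2 = n - 1 by omega]
        push_cast
        simp only [smul_mul_assoc]
        module

theorem brL_f_f {f f' : Gen} (hf : IsF f) (hf' : IsF f') : brL f f' = [] := by
  rcases hf with rfl | rfl | rfl <;> rcases hf' with rfl | rfl | rfl <;> rfl

section

variable {p : ℕ} {v : ℕ → F} {r : Gen → Module.End F M} {u : List Gen → M}

theorem bracket_bracket_f {e f : Gen} (hef : (e, f) ∈ ([(e1, f1), (e2, f2), (e3, f3),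
    (f1, e1), (f2, e2), (f3, e3)] : List (Gen × Gen)))
    (hc : ∀ a, r a * r f = r f * r a + ev v r (brL a f)) (a : Gen) :
    ev v r (brL a f) * r f = r f * ev v r (brL a f) +
      (2 : F) • if a = e then -r f else 0 := by
  have hQ := ev_eq_zero v r (List.all_eq_true.1 (List.all_eq_true.1 brL_brL_check _ hef) a
    (mem_gens a))
  rw [ev_append, ev_subst] at hQ
  rw [ev_mul, mul_ev]
  have h1 : ev v (fun g => r g * r f) (brL a f) =
      ev v (fun g => (1 : F) • (r f * r g) + ev v r (brL g f)) (brL a f) := by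
    simp only [hc, one_smul]
  rw [h1, ev_add_smul, eq_neg_of_add_eq_zero_left hQ]
  split_ifs <;> simp [ev]

theorem comm_f_f (hc : ∀ a f, IsF f → r a * r f = r f * r a + ev v r (brL a f)) {f f' : Gen}
    (hf : IsF f) (hf' : IsF f') : Commute (r f) (r f') := by
  have := hc f f' hf'
  rwa [brL_f_f hf hf', ev_nil, add_zero] at this

theorem rep_natCast [CharP F p] {k : ℤ} (hk : -(p : ℤ) ≤ k) : ((rep p k : ℕ) : F) = (k : F) := by
  unfold rep
  split_ifs with h
  · have : ((k.toNat : ℤ) : F) = (k : F) := by rw [Int.toNat_of_nonneg h]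
    exact_mod_cast this
  · have : (((p + k).toNat : ℤ) : F) = ((p + k : ℤ) : F) := by
      rw [Int.toNat_of_nonneg (by omega)]
    rw [Int.cast_natCast] at this
    rw [this]
    simp

/-- The expansion `pass` is correct for exponents close to `0` and close to `p`. -/
theorem pass_sound [CharP F p] (hp : 3 ≤ p)
    (hc : ∀ a f, IsF f → r a * r f = r f * r a + ev v r (brL a f)) {e f : Gen}
    (hef : (e, f) ∈ ([(e1, f1), (e2, f2), (e3, f3)] : List (Gen × Gen))) {k : ℤ} (hk : -3 ≤ k)
    (a : Gen) :
    r a * r f ^ rep p k = ev v (fun s => r f ^ rep p (k - s.1) * r s.2) (pass e f k a) := by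
  have hf : IsF f := by
    simp only [List.mem_cons, Prod.mk.injEq, List.not_mem_nil, or_false] at hef
    rcases hef with ⟨_, h⟩ | ⟨_, h⟩ | ⟨_, h⟩ <;> simp [IsF, h]
  have hexp := mul_pow_expand (hc a f hf) (bracket_bracket_f (e := e)
    (List.mem_append_left [(f1, e1), (f2, e2), (f3, e3)] hef) (fun a => hc a f hf) a)
    (by split_ifs <;> simp) (rep p k)
  rw [hexp, rep_natCast (by omega)]
  unfold pass
  by_cases h0 : k = 0
  · subst h0
    simp [ev, rep]
  -- when the exponent is too small for the lower powers to make sense, their coefficient vanishes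
  have h1 : (k : F) • r f ^ (rep p k - 1) = (k : F) • r f ^ rep p (k - 1) := by
    by_cases hkp : k = -p
    · simp [hkp]
    · congr 2
      unfold rep
      split_ifs <;> omega
  have h2 : ((k : F) * ((k : F) - 1)) • r f ^ (rep p k - 2) =
      ((k : F) * ((k : F) - 1)) • r f ^ rep p (k - 2) := by
    by_cases hkp : k = -p
    · simp [hkp]
    by_cases hkp : k - 1 = -p
    · have : (k : F) - 1 = 0 := by
        have : ((k - 1 : ℤ) : F) = 0 := by simp [hkp]
        simpa using this
      simp [this]
    by_cases h1 : k = 1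
    · simp [h1]
    · congr 2
      unfold rep
      split_ifs <;> omega
  rw [if_neg h0, ev_cons, ev_append, add_assoc]
  congr 1
  · simp
  congr 1
  · rw [← smul_mul_assoc, h1, smul_mul_assoc, mul_ev, ev_map_mul]
  · rw [← smul_mul_assoc, h2]
    split_ifs
    · rw [ev_cons, ev_nil]
      simp only [List.map_nil, List.prod_nil, mul_neg, smul_mul_assoc]
      push_cast
      module
    · simp [ev_nil]

theorem pow_apply_mono_eq_zero
    (hc : ∀ a f, IsF f → r a * r f = r f * r a + ev v r (brL a f))
    (hpow : ∀ f, IsF f → ∀ J, (r f ^ p) (u J) = 0) (n1 n2 n3 : ℕ) (J : List Gen)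
    (h : p ≤ n1 ∨ p ≤ n2 ∨ p ≤ n3) :
    (r f1 ^ n1) ((r f2 ^ n2) ((r f3 ^ n3) (u J))) = 0 := by
  have h12 : Commute (r f1) (r f2) := comm_f_f hc (by simp [IsF]) (by simp [IsF])
  have h13 : Commute (r f1) (r f3) := comm_f_f hc (by simp [IsF]) (by simp [IsF])
  have h23 : Commute (r f2) (r f3) := comm_f_f hc (by simp [IsF]) (by simp [IsF])
  have key (f : Gen) (hf : IsF f) (n : ℕ) (hn : p ≤ n) : (r f ^ n) (u J) = 0 := by
    rw [← Nat.sub_add_cancel hn, pow_add, Module.End.mul_apply, hpow f hf, map_zero]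
  simp only [← Module.End.mul_apply]
  rcases h with h | h | h
  · rw [((h12.pow_pow n1 n2).mul_right (h13.pow_pow n1 n3)).eq, Module.End.mul_apply,
      key f1 (by simp [IsF]) _ h, map_zero]
  · rw [(h23.pow_pow n2 n3).eq, ← mul_assoc, Module.End.mul_apply, key f2 (by simp [IsF]) _ h,
      map_zero]
  · rw [← mul_assoc, Module.End.mul_apply, key f3 (by simp [IsF]) _ h, map_zero]

/-- The bounds on the exponents ensure that `carries` detects overflow: with `5 ≤ p` no negative
label stands for a negative exponent. -/
theorem shift_sound (hp : 5 ≤ p)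
    (hc : ∀ a f, IsF f → r a * r f = r f * r a + ev v r (brL a f))
    (hpow : ∀ f, IsF f → ∀ J, (r f ^ p) (u J) = 0) {k1 k2 k3 : ℤ} (h1 : -5 ≤ k1) (h2 : -5 ≤ k2)
    (h3 : -5 ≤ k3) {i : Ix} (i1 : 0 ≤ i.k1) (i2 : 0 ≤ i.k2) (i3 : 0 ≤ i.k3) :
    (r f1 ^ rep p k1) ((r f2 ^ rep p k2) ((r f3 ^ rep p k3) (mono p r u i))) =
      ev v (mono p r u) (shift k1 k2 k3 i) := by
  have h12 : Commute (r f1) (r f2) := comm_f_f hc (by simp [IsF]) (by simp [IsF])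
  have h13 : Commute (r f1) (r f3) := comm_f_f hc (by simp [IsF]) (by simp [IsF])
  have h23 : Commute (r f2) (r f3) := comm_f_f hc (by simp [IsF]) (by simp [IsF])
  have step : (r f1 ^ rep p k1) ((r f2 ^ rep p k2) ((r f3 ^ rep p k3) (mono p r u i))) =
      (r f1 ^ (rep p k1 + rep p i.k1)) ((r f2 ^ (rep p k2 + rep p i.k2))
        ((r f3 ^ (rep p k3 + rep p i.k3)) (u i.J))) := by
    simp only [mono, ← Module.End.mul_apply, pow_add]
    congr 1
    have a := h13.pow_pow (rep p i.k1) (rep p k3)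
    have b := h12.pow_pow (rep p i.k1) (rep p k2)
    have c := h23.pow_pow (rep p i.k2) (rep p k3)
    calc _ = r f1 ^ rep p k1 * r f2 ^ rep p k2 * (r f3 ^ rep p k3 * r f1 ^ rep p i.k1) *
          r f2 ^ rep p i.k2 * r f3 ^ rep p i.k3 := by simp only [mul_assoc]
      _ = r f1 ^ rep p k1 * (r f2 ^ rep p k2 * r f1 ^ rep p i.k1) *
          (r f3 ^ rep p k3 * r f2 ^ rep p i.k2) * r f3 ^ rep p i.k3 := by
        rw [← a.eq]; simp only [mul_assoc]
      _ = _ := by rw [← b.eq, ← c.eq]; simp only [mul_assoc]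
  rw [step]
  unfold shift
  have hr {k m : ℤ} (hk : -5 ≤ k) (hm : 0 ≤ m) (h : carries k m = true) :
      p ≤ rep p k + rep p m := by
    simp only [carries, Bool.and_eq_true, decide_eq_true_eq] at h
    unfold rep
    split_ifs <;> omega
  have hr' {k m : ℤ} (hk : -5 ≤ k) (hm : 0 ≤ m) (h : carries k m = false) :
      rep p k + rep p m = rep p (k + m) := by
    simp only [carries, Bool.and_eq_false_iff, decide_eq_false_iff_not] at h
    unfold rep
    split_ifs <;> omega
  split_ifs with h
  · rw [ev_nil]
    simp only [Bool.or_eq_true] at h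
    refine pow_apply_mono_eq_zero hc hpow _ _ _ _ ?_
    rcases h with (h | h) | h
    · exact Or.inl (hr h1 i1 h)
    · exact Or.inr (Or.inl (hr h2 i2 h))
    · exact Or.inr (Or.inr (hr h3 i3 h))
  · simp only [Bool.or_eq_true, not_or, Bool.not_eq_true] at h
    rw [ev_cons, ev_nil, hr' h1 i1 h.1.1, hr' h2 i2 h.1.2, hr' h3 i3 h.2]
    simp [mono]

/-- In `pass e f k a` the power of `f` drops by at most two, and closure properties of `a` that are
stable under brackets with `f` are kept. -/
theorem pass_spec {P : Gen → Prop} {e f : Gen} (hP : ∀ a, P a → ∀ t ∈ brL a f, P t.key)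
    (he : P e → P f) {k : ℤ} {a : Gen} (ha : P a) :
    ∀ s ∈ pass e f k a, s.key.1 ≤ 2 ∧ P s.key.2 := by
  intro s hs
  unfold pass at hs
  simp only [List.mem_cons] at hs
  rcases hs with rfl | hs
  · exact ⟨by norm_num, ha⟩
  split_ifs at hs with h0 h1
  · simp at hs
  · simp only [List.mem_append, List.mem_map, List.mem_singleton] at hs
    rcases hs with ⟨t, ht, rfl⟩ | rfl
    · exact ⟨by norm_num, hP a ha t ht⟩
    · exact ⟨le_rfl, he (h1 ▸ ha)⟩
  · simp only [List.append_nil, List.mem_map] at hs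
    obtain ⟨t, ht, rfl⟩ := hs
    exact ⟨by norm_num, hP a ha t ht⟩

/-- Correctness of `passAll`, for a class `P` of basis elements that is stable under brackets with
the `f_i` and on which the normal forms `R` are known to be correct. -/
theorem passAll_sound [CharP F p] (hp : 5 ≤ p)
    (hc : ∀ a f, IsF f → r a * r f = r f * r a + ev v r (brL a f))
    (hpow : ∀ f, IsF f → ∀ J, (r f ^ p) (u J) = 0) {P : Gen → Prop}
    (hP : ∀ a f, IsF f → P a → ∀ t ∈ brL a f, P t.key)
    (he : (P e1 → P f1) ∧ (P e2 → P f2) ∧ (P e3 → P f3)) {i : Ix} {R : Gen → Comb Ix}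
    (hR : ∀ g, P g → r g (u i.J) = ev v (mono p r u) (R g) ∧
      ∀ t ∈ R g, 0 ≤ t.key.k1 ∧ 0 ≤ t.key.k2 ∧ 0 ≤ t.key.k3)
    (h1 : -3 ≤ i.k1) (h2 : -3 ≤ i.k2) (h3 : -3 ≤ i.k3) {a : Gen} (ha : P a) :
    r a (mono p r u i) = ev v (mono p r u) (passAll R i.k1 i.k2 i.k3 a) := by
  have hF1 : IsF f1 := by simp [IsF]
  have hF2 : IsF f2 := by simp [IsF]
  have hF3 : IsF f3 := by simp [IsF]
  unfold passAll mono
  rw [← Module.End.mul_apply, pass_sound (by omega) hc (by simp : (e1, f1) ∈ _) h1, ev_apply,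
    ev_subst]
  refine ev_congr v fun s hs => ?_
  obtain ⟨s1, sP⟩ := pass_spec (fun a ha => hP a f1 hF1 ha) he.1 ha s hs
  rw [Module.End.mul_apply, ← Module.End.mul_apply (r s.key.2),
    pass_sound (by omega) hc (by simp : (e2, f2) ∈ _) h2, ev_apply, map_ev, ev_subst]
  refine ev_congr v fun t ht => ?_
  obtain ⟨t1, tP⟩ := pass_spec (fun a ha => hP a f2 hF2 ha) he.2.1 sP t ht
  rw [Module.End.mul_apply, ← Module.End.mul_apply (r t.key.2),
    pass_sound (by omega) hc (by simp : (e3, f3) ∈ _) h3, ev_apply, map_ev, map_ev, ev_subst]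
  refine ev_congr v fun w hw => ?_
  obtain ⟨w1, wP⟩ := pass_spec (fun a ha => hP a f3 hF3 ha) he.2.2 tP w hw
  rw [Module.End.mul_apply, (hR _ wP).1, map_ev, map_ev, map_ev, ev_subst]
  refine ev_congr v fun x hx => ?_
  obtain ⟨x1, x2, x3⟩ := (hR _ wP).2 x hx
  exact shift_sound hp hc hpow (by omega) (by omega) (by omega) x1 x2 x3

theorem actJ_spec {J : List Gen} (hJ : J ∈ Js) (b : Gen) : ∀ t ∈ actJ J b,
    (0 ≤ t.key.k1 ∧ 0 ≤ t.key.k2 ∧ 0 ≤ t.key.k3) ∧ t.key.J ∈ Js ∧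
      oddLen t.key.J = (oddLen J ^^ odd b) := by
  intro t ht
  have := List.all_eq_true.1 (List.all_eq_true.1 (List.all_eq_true.1 actJ_check J hJ) b
    (mem_gens b)) t ht
  simpa [and_assoc] using this

theorem HasMonomials.act_mono [CharP F p] (h : HasMonomials p v r u) (hp : 5 ≤ p) {i : Ix}
    (hJ : i.J ∈ Js) (h1 : -3 ≤ i.k1) (h2 : -3 ≤ i.k2) (h3 : -3 ≤ i.k3) (a : Gen) :
    r a (mono p r u i) = ev v (mono p r u) (act a i) :=
  passAll_sound hp h.comm h.pow (P := fun _ => True) (fun _ _ _ _ _ _ => trivial)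
    ⟨id, id, id⟩ (fun g _ => ⟨h.act_u _ hJ g, fun t ht => (actJ_spec hJ g t ht).1⟩) h1 h2 h3
    trivial

theorem HasMonomials.act_ev [CharP F p] (h : HasMonomials p v r u) (hp : 5 ≤ p) {l : Comb Ix}
    (hl : ∀ t ∈ l, t.key.J ∈ Js ∧ -3 ≤ t.key.k1 ∧ -3 ≤ t.key.k2 ∧ -3 ≤ t.key.k3) (a : Gen) :
    r a (ev v (mono p r u) l) = ev v (mono p r u) (subst l (act a)) := by
  rw [map_ev, ev_subst]
  exact ev_congr v fun t ht => h.act_mono hp (hl t ht).1 (hl t ht).2.1 (hl t ht).2.2.1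
    (hl t ht).2.2.2 a

theorem mono_zero (J : List Gen) : mono p r u ⟨0, 0, 0, J⟩ = u J := by
  simp [mono, rep]

/-- Both sides of the supercommutation relation of `a` and `b`, applied to `y_J v`. -/
theorem HasMonomials.defect_apply [CharP F p] (h : HasMonomials p v r u) (hp : 5 ≤ p)
    {J : List Gen} (hJ : J ∈ Js) {a b : Gen} (h0 : isZero (defect a b J) = true) :
    r a (r b (u J)) = (sgn a b : F) • r b (r a (u J)) + ev v r (brL a b) (u J) := by
  have hz := ev_eq_zero v (mono p r u) h0
  have hs (b : Gen) : ∀ t ∈ actJ J b,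
      t.key.J ∈ Js ∧ -3 ≤ t.key.k1 ∧ -3 ≤ t.key.k2 ∧ -3 ≤ t.key.k3 := fun t ht => by
    obtain ⟨⟨_, _, _⟩, hJ', _⟩ := actJ_spec hJ b t ht
    exact ⟨hJ', by omega, by omega, by omega⟩
  rw [defect, ev_append, ev_append, ev_scale, ev_scale, ← h.act_ev hp (hs b), ← h.act_ev hp (hs a),
    ← h.act_u J hJ, ← h.act_u J hJ, ev_subst] at hz
  rw [ev_apply]
  simp only [h.act_u J hJ] at hz ⊢
  rw [← sub_eq_zero]
  rw [← hz]
  push_cast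
  simp only [List.map_nil, List.prod_nil]
  module

end

/-! ### Representations of `D(2,1;α)` -/

section

variable {F M : Type*} [Field F] [AddCommGroup M] [Module F M]
variable {p : ℕ} {v : ℕ → F} {r : Gen → Module.End F M}

/-- The operators `r a` satisfy the supercommutation relations of `D(2,1;α)`, where `α = v 0`. -/
def IsRep (v : ℕ → F) (r : Gen → Module.End F M) : Prop :=
  ∀ a b, r a * r b = (sgn a b : F) • (r b * r a) + ev v r (brL a b)

theorem sgn_comm (a b : Gen) : sgn a b = sgn b a := by
  simp [sgn, Bool.and_comm]

theorem sgn_eq (a b : Gen) : ((sgn a b : ℤ) : F) = 1 ∨ ((sgn a b : ℤ) : F) = -1 := by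
  unfold sgn
  split_ifs <;> simp

theorem odd_brL_check : (gens.all fun a => gens.all fun b => (brL a b).all fun t =>
    odd t.key == (odd a ^^ odd b)) = true := by
  decide +kernel

theorem odd_brL {a b : Gen} : ∀ t ∈ brL a b, odd t.key = (odd a ^^ odd b) := by
  intro t ht
  simpa using List.all_eq_true.1 (List.all_eq_true.1 (List.all_eq_true.1 odd_brL_check a
    (mem_gens a)) b (mem_gens b)) t ht

theorem sgn_brL {a b c : Gen} : ∀ t ∈ brL a b, sgn c t.key = sgn c a * sgn c b := by
  intro t ht
  simp only [sgn, odd_brL t ht]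
  cases odd a <;> cases odd b <;> cases odd c <;> rfl

/-- The Jacobi identity. -/
theorem ev_jacobi {N : Type*} [AddCommGroup N] [Module F N] (w : Gen → N) (a b c : Gen) :
    ev v w (subst (brL b c) (brL a)) = ev v w (subst (brL a b) fun g => brL g c) +
      (sgn a b : F) • ev v w (subst (brL a c) (brL b)) := by
  have := ev_eq_zero v w (List.all_eq_true.1 (List.all_eq_true.1 (List.all_eq_true.1
    jacobi_check a (mem_gens a)) b (mem_gens b)) c (mem_gens c))
  rw [ev_append, ev_append, ev_scale, ev_scale] at this
  rw [← sub_eq_zero, ← this]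
  push_cast
  simp only [List.map_nil, List.prod_nil]
  module

/-- The supercommutation relations of all pairs `a, b` with `P a` hold at the vector `m`. -/
def RelAt (v : ℕ → F) (r : Gen → Module.End F M) (P : Gen → Prop) (m : M) : Prop :=
  ∀ a, P a → ∀ b, r a (r b m) = (sgn a b : F) • r b (r a m) + ev v r (brL a b) m

/-- If an element `n` of the basis satisfies its relations with all of `g` everywhere, it carries
vectors at which the relations hold to such vectors. This is the Jacobi identity. -/
theorem RelAt.apply {P : Gen → Prop} {m : M} (h : RelAt v r P m) {n : Gen}
    (hn : ∀ a, r n * r a = (sgn n a : F) • (r a * r n) + ev v r (brL n a))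
    (hP : ∀ a, P a → ∀ t ∈ brL n a, P t.key) : RelAt v r P (r n m) := by
  intro a ha b
  have B1 : ev v r (brL n a) (r b m) =
      ((sgn b n : F) * sgn b a) • r b (ev v r (brL n a) m) +
        ev v r (subst (brL n a) fun g => brL g b) m := by
    rw [ev_apply, ev_apply, map_ev, ev_apply, ev_subst, ← ev_add_smul]
    refine ev_congr v fun t ht => ?_
    rw [h _ (hP a ha t ht), sgn_comm, sgn_brL t ht, ev_apply]
    push_cast
    rfl
  have B2 : r a (ev v r (brL n b) m) =
      ((sgn a n : F) * sgn a b) • ev v r (brL n b) (r a m) +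
        ev v r (subst (brL n b) (brL a)) m := by
    rw [ev_apply, ev_apply, map_ev, ev_apply, ev_subst, ← ev_add_smul]
    refine ev_congr v fun t ht => ?_
    rw [h a ha, sgn_brL t ht, ev_apply]
    push_cast
    rfl
  have hn' (a : Gen) (m : M) : r n (r a m) = (sgn n a : F) • r a (r n m) + ev v r (brL n a) m := by
    simpa using LinearMap.congr_fun (hn a) m
  have hnl (c d : Gen) : r n (ev v r (brL c d) m) =
      ((sgn n c : F) * sgn n d) • ev v r (brL c d) (r n m) +
        ev v r (subst (brL c d) (brL n)) m := by
    rw [ev_apply, ev_apply, map_ev, ev_apply, ev_subst, ← ev_add_smul]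
    refine ev_congr v fun t ht => ?_
    rw [hn', sgn_brL t ht, ev_apply]
    push_cast
    rfl
  have j := LinearMap.congr_fun (ev_jacobi (v := v) r n a b) m
  simp only [LinearMap.add_apply, LinearMap.smul_apply] at j
  have A1 := hn' b m
  have A2 := hn' a m
  have A3 := hn' a (r b m)
  have A4 := hn' b (r a m)
  have A5 := hnl a b
  have A6 := congrArg (r a) A1
  have A7 := congrArg (r b) A2
  have A8 := congrArg (r n) (h a ha b)
  rw [map_add, map_smul] at A6 A7 A8
  rw [sgn_comm b n, sgn_comm b a] at B1
  rw [sgn_comm a n] at B2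
  have s1 := sgn_eq (F := F) n a
  have s2 := sgn_eq (F := F) n b
  have s3 := sgn_eq (F := F) a b
  generalize ((sgn n a : ℤ) : F) = ε at *
  generalize ((sgn n b : ℤ) : F) = ζ at *
  generalize ((sgn a b : ℤ) : F) = η at *
  rcases s1 with s1 | s1 <;> rcases s2 with s2 | s2 <;> rcases s3 with s3 | s3 <;>
    linear_combination (norm := (simp only [s1, s2, s3]; module))
      (-ζ) • A6 + (-(ε * ζ)) • A3 + (ε * η) • A7 + (ε * ζ * η) • A4 + (ε * ζ) • A5 +
        (ε * ζ) • A8 - (ε * ζ) • B1 - ζ • B2 + (ε * ζ) • j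

/-- The operator `b^p - b^{[p]}`, for an even basis element `b`. -/
def pCenter (p : ℕ) (r : Gen → Module.End F M) (b : Gen) : Module.End F M :=
  r b ^ p - if b = h1 ∨ b = h2 ∨ b = h3 then r b else 0

theorem sgn_even {a b : Gen} (h : odd b = false) : sgn a b = 1 := by
  simp [sgn, h]

/-- The elements `b^p - b^{[p]}` are central. -/
theorem IsRep.pCenter_comm [CharP F p] [Fact p.Prime] (h : IsRep v r) {b : Gen}
    (hb : odd b = false) (a : Gen) : Commute (r a) (pCenter p r b) := by
  have hc (a : Gen) : r a * r b = r b * r a + ev v r (brL a b) := by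
    have := h a b
    rwa [sgn_even hb, Int.cast_one, one_smul] at this
  have nil {e : Gen} (hef : (e, b) ∈ ([(e1, f1), (e2, f2), (e3, f3), (f1, e1), (f2, e2),
      (f3, e3)] : List (Gen × Gen))) : r a * r b ^ p = r b ^ p * r a := by
    have := mul_pow_expand (hc a) (bracket_bracket_f hef hc a) (by split_ifs <;> simp) p
    simpa using this
  have car {w : ℤ} (hw : ev v r (brL a b) = -((w : F) • r a)) :
      r a * (r b ^ p - r b) = (r b ^ p - r b) * r a := by
    have h1 : r a * r b = (r b - algebraMap F _ (w : F)) * r a := by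
      rw [hc, hw, sub_mul, ← Algebra.smul_def, sub_eq_add_neg]
    have h2 (n : ℕ) : r a * r b ^ n = (r b - algebraMap F _ (w : F)) ^ n * r a := by
      induction n with
      | zero => simp
      | succ n ih => rw [pow_succ, ← mul_assoc, ih, mul_assoc, h1, pow_succ, mul_assoc]
    by_cases hM : Subsingleton M
    · exact Subsingleton.elim _ _
    rw [not_subsingleton_iff_nontrivial] at hM
    have : CharP (Module.End F M) p := charP_of_injective_algebraMap
      (FaithfulSMul.algebraMap_injective F (Module.End F M)) p
    have hwp : (w : F) ^ p = w := by
      have := map_intCast (frobenius F p) w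
      rwa [frobenius_def] at this
    rw [mul_sub, h2, sub_pow_char_of_commute _ (Algebra.commute_algebraMap_right _ _), ← map_pow,
      hwp, h1]
    simp only [sub_mul]
    abel
  have hW (i : Fin 3) (hbi : b = hG i) : ev v r (brL a b) = -((wt a i : F) • r a) := by
    subst hbi
    fin_cases i <;> cases a <;> simp [hG, brL, halfL, scale, sgn, odd, wt, ev, mulMon]
  unfold Commute SemiconjBy pCenter
  cases b
  case h1 => simpa using car (hW 0 rfl)
  case h2 => simpa using car (hW 1 rfl)
  case h3 => simpa using car (hW 2 rfl)
  case e1 => simpa using nil (e := f1) (by simp)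
  case e2 => simpa using nil (e := f2) (by simp)
  case e3 => simpa using nil (e := f3) (by simp)
  case f1 => simpa using nil (e := e1) (by simp)
  case f2 => simpa using nil (e := e2) (by simp)
  case f3 => simpa using nil (e := e3) (by simp)
  all_goals exact absurd hb (by decide)

/-- A highest weight vector of weight `(v 1, v 2, v 3)` that is killed by the `f_i ^ p`. -/
structure IsHighest (p : ℕ) (v : ℕ → F) (r : Gen → Module.End F M) (m : M) : Prop where
  pos : ∀ a ∈ [e1, e2, e3, x1, x2, x3, x4], r a m = 0
  h1 : r h1 m = v 1 • m
  h2 : r h2 m = v 2 • m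
  h3 : r h3 m = v 3 • m
  pow : ∀ f, IsF f → (r f ^ p) m = 0

/-- The vector `y_J m`. -/
def word (r : Gen → Module.End F M) (m : M) (J : List Gen) : M := (J.map r).prod m

theorem word_cons (m : M) (y : Gen) (J : List Gen) : word r m (y :: J) = r y (word r m J) := by
  simp [word]

theorem isY_check : (gens.all fun y => gens.all fun a => !(isY y) ||
    ((!(isY a) || (brL y a).all fun t => t.key == f1) &&
      (!([f1, f2, f3].contains a) || (brL y a).all fun t => isY t.key))) = true := by
  decide +kernel

theorem brL_y_y {y j : Gen} (hy : isY y = true) (hj : isY j = true) :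
    ∀ t ∈ brL y j, t.key = f1 := by
  have := List.all_eq_true.1 (List.all_eq_true.1 isY_check y (mem_gens y)) j (mem_gens j)
  simp only [hy, hj, Bool.not_true, Bool.false_or, Bool.and_eq_true, List.all_eq_true,
    beq_iff_eq] at this
  exact this.1

theorem brL_y_f {y f : Gen} (hy : isY y = true) (hf : IsF f) :
    ∀ t ∈ brL y f, isY t.key = true := by
  have := List.all_eq_true.1 (List.all_eq_true.1 isY_check y (mem_gens y)) f (mem_gens f)
  have hf' : ([f1, f2, f3].contains f) = true := by rcases hf with rfl | rfl | rfl <;> rfl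
  simp only [hy, hf', Bool.not_true, Bool.false_or, Bool.and_eq_true, List.all_eq_true] at this
  exact this.2

theorem brL_y_f1 {y : Gen} (hy : isY y = true) : brL y f1 = [] := by
  cases y <;> first | rfl | exact absurd hy (by decide)

/-- In the normal form of `y y_J v` only powers of `f₁` occur. -/
theorem ins_spec {y : Gen} (hy : isY y = true) :
    ∀ J : List Gen, (∀ j ∈ J, isY j = true) →
      ∀ t ∈ ins y J, 0 ≤ t.key.k1 ∧ t.key.k2 = 0 ∧ t.key.k3 = 0
  | [], _, t, ht => by
    simp only [ins, List.mem_singleton] at ht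
    simp [ht]
  | j :: J, hJ, t, ht => by
    unfold ins at ht
    split_ifs at ht with h1 h2
    · simp only [List.mem_singleton] at ht
      simp [ht]
    · simp at ht
    · rcases List.mem_append.1 ht with ht | ht <;> obtain ⟨s, hs, rfl⟩ := List.mem_map.1 ht
      · exact ins_spec hy J (fun j hj => hJ j (List.mem_cons_of_mem _ hj)) s hs
      · simp

variable [CharP F p]

theorem IsRep.comm_f (h : IsRep v r) (a f : Gen) (hf : IsF f) :
    r a * r f = r f * r a + ev v r (brL a f) := by
  have := h a f
  rwa [sgn_even (by rcases hf with rfl | rfl | rfl <;> rfl), Int.cast_one, one_smul] at this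

theorem IsRep.pow_word [Fact p.Prime] (h : IsRep v r) {m : M} (hm : IsHighest p v r m)
    (f : Gen) (hf : IsF f) (J : List Gen) : (r f ^ p) (word r m J) = 0 := by
  induction J with
  | nil => simpa [word] using hm.pow f hf
  | cons y J ih =>
    have := h.pCenter_comm (p := p) (b := f) (by rcases hf with rfl | rfl | rfl <;> rfl) y
    have e : pCenter p r f = r f ^ p := by rcases hf with rfl | rfl | rfl <;> simp [pCenter]
    rw [e] at this
    rw [word_cons, ← Module.End.mul_apply, ← this.eq, Module.End.mul_apply, ih, map_zero]

/-- Correctness of the normal form of `y y_J m`. -/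
theorem IsRep.ins_sound (h : IsRep v r) (hp : 5 ≤ p) (m : M) {y : Gen} (hy : isY y = true) :
    ∀ J : List Gen, (∀ j ∈ J, isY j = true) →
      r y (word r m J) = ev v (mono p r (word r m)) (ins y J)
  | [], _ => by simp [ins, ev_cons, ev_nil, mono_zero, word]
  | j :: J, hJ => by
    unfold ins
    have hj := hJ j (by simp)
    have hJ' := fun j hj => hJ j (List.mem_cons_of_mem _ hj)
    have oddY (y : Gen) (hy : isY y = true) : odd y = true := by
      cases y <;> first | rfl | exact absurd hy (by decide)
    have hs : sgn y j = -1 := by simp [sgn, oddY y hy, oddY j hj]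
    have hrel := h y j
    rw [hs] at hrel
    split_ifs with h1 h2
    · simp [ev_cons, ev_nil, mono_zero, word_cons]
    · subst h2
      rw [ev_nil, word_cons]
      have e : brL y y = [] := by
        cases y <;> rfl
      rw [e, ev_nil, add_zero] at hrel
      have h2F : (2 : F) ≠ 0 := by
        intro h0
        have : ((2 : ℕ) : F) = 0 := by exact_mod_cast h0
        rw [CharP.cast_eq_zero_iff F p] at this
        have := Nat.le_of_dvd (by norm_num) this
        omega
      have h3 : (2 : F) • (r y * r y) = 0 := by
        rw [two_smul]
        nth_rewrite 1 [hrel]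
        simp
      rw [← Module.End.mul_apply, (smul_eq_zero.1 h3).resolve_left h2F, LinearMap.zero_apply]
    · have h3 : r y (word r m (j :: J)) = -r j (r y (word r m J)) +
          ev v r (brL y j) (word r m J) := by
        have := LinearMap.congr_fun hrel (word r m J)
        simpa [word_cons] using this
      have e1 := ev_map_mul v (mono p r (word r m)) (-1)
        (fun i : Ix => (⟨i.k1, i.k2, i.k3, j :: i.J⟩ : Ix)) (ins y J)
      simp only [neg_mul, one_mul, Int.cast_neg, Int.cast_one, neg_smul, one_smul] at e1
      have e2 := ev_map_mul v (mono p r (word r m)) 1 (fun _ : Gen => (⟨1, 0, 0, J⟩ : Ix)) (brL y j)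
      simp only [one_mul, Int.cast_one, one_smul] at e2
      rw [h3, h.ins_sound hp m hy J hJ', ev_append, e1, e2, map_ev, ev_apply]
      congr 1
      · congr 1
        refine ev_congr v fun t ht => ?_
        obtain ⟨_, t2, t3⟩ := ins_spec hy J hJ' t ht
        have hcomm : Commute (r j) (r f1) := by
          have := h.comm_f j f1 (by simp [IsF])
          rwa [brL_y_f1 hj, ev_nil, add_zero] at this
        simp only [mono, t2, t3, word_cons]
        simp only [rep, le_refl, if_true, Int.toNat_zero, pow_zero, Module.End.one_apply]
        rw [← Module.End.mul_apply, (hcomm.pow_right _).eq, Module.End.mul_apply]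
      · refine ev_congr v fun t ht => ?_
        rw [brL_y_y hy hj t ht]
        simp [mono, rep]

theorem isY_of_mem_Js {J : List Gen} (hJ : J ∈ Js) : ∀ j ∈ J, isY j = true := by
  have : (Js.all fun J => J.all isY) = true := by decide
  exact fun j hj => List.all_eq_true.1 (List.all_eq_true.1 this J hJ) j hj

theorem Js_tail {j : Gen} {J : List Gen} (hJ : j :: J ∈ Js) : J ∈ Js := by
  have : ∀ J ∈ Js, J.tail ∈ Js := by decide
  exact this _ hJ

/-- A highest weight vector of a representation gives rise to vectors `y_J m` on which the
computation of the action is correct. -/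
theorem IsRep.hasMonomials [Fact p.Prime] (h : IsRep v r) (hp : 5 ≤ p) {m : M}
    (hm : IsHighest p v r m) :
    HasMonomials p v r (word r m) where
  comm := h.comm_f
  pow := h.pow_word hm
  act_u := by
    intro J
    induction J with
    | nil =>
      intro _ b
      cases b <;> simp [actJ, ev, mono, rep, ins, word, hm.pos, hm.h1, hm.h2, hm.h3]
    | cons j J ih =>
      intro hJ b
      have hJ' := Js_tail hJ
      have hY := isY_of_mem_Js hJ
      have hj := hY j (by simp)
      have gen : r b (word r m (j :: J)) = ev v (mono p r (word r m))
          (subst (brL b j) (fun g => actJ J g) ++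
            scale (sgn b j) [] (subst (actJ J b) (actY j))) := by
        have h1 : r b (word r m (j :: J)) = (sgn b j : F) • r j (r b (word r m J)) +
            ev v r (brL b j) (word r m J) := by
          have := LinearMap.congr_fun (h b j) (word r m J)
          simpa [word_cons] using this
        rw [h1, ev_append, ev_scale, ev_subst, ev_subst, ev_apply, ih hJ' b, map_ev, add_comm]
        congr 1
        · exact ev_congr v fun t _ => ih hJ' t.key
        · simp only [List.map_nil, List.prod_nil, mul_one]
          congr 1
          refine ev_congr v fun t ht => ?_
          obtain ⟨⟨t1, t2, t3⟩, tJ, _⟩ := actJ_spec hJ' b t ht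
          refine passAll_sound hp h.comm_f (h.pow_word hm) (P := fun g => isY g = true)
            (fun a f hf ha => brL_y_f ha hf) ⟨by decide, by decide, by decide⟩
            (fun g hg => ⟨h.ins_sound hp m hg _ (isY_of_mem_Js tJ), fun s hs => ?_⟩)
            (by omega) (by omega) (by omega) hj
          obtain ⟨s1, s2, s3⟩ := ins_spec hg _ (isY_of_mem_Js tJ) s hs
          exact ⟨s1, s2.ge, s3.ge⟩
      have hins (y : Gen) (hy : isY y = true) := h.ins_sound hp m hy (j :: J) hY
      cases b <;> first
        | exact gen
        | exact hins _ rfl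
        | simp [actJ, ev, mono, rep]

end

/-! ### A model of the baby Verma module -/

theorem brL_f_check : (([(e1, f1), (e2, f2), (e3, f3)] : List (Gen × Gen)).all fun s =>
    gens.all fun a => ((brL a s.2).all fun t => t.key != e1 && t.key != e2 && t.key != e3) &&
      ([f1, f2, f3].all fun f' => isZero (subst (brL a s.2) (fun g => brL g f') ++
        scale (-1) [] (subst (brL a f') (fun g => brL g s.2))))) = true := by
  decide +kernel

section

variable {F M : Type*} [Field F] [AddCommGroup M] [Module F M]
variable {v : ℕ → F} {σ : Gen → Module.End F M} {t d t' : Module.End F M} {e f f' : Gen}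

/-- The list of pairs `(e_i, f_i)`. -/
def efs : List (Gen × Gen) := [(e1, f1), (e2, f2), (e3, f3)]

theorem isF_of_mem_efs (h : (e, f) ∈ efs) : IsF f := by
  simp only [efs, List.mem_cons, Prod.mk.injEq, List.not_mem_nil, or_false] at h
  rcases h with ⟨_, h⟩ | ⟨_, h⟩ | ⟨_, h⟩ <;> simp [IsF, h]

theorem brL_f_ne (hf : IsF f) {i : Gen} (hi : (i, i) ∈ ([(e1, e1), (e2, e2), (e3, e3)] :
    List (Gen × Gen))) (a : Gen) : ∀ s ∈ brL a f, s.key ≠ i := by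
  intro s hs
  obtain ⟨x, hx⟩ : ∃ x, (x, f) ∈ ([(e1, f1), (e2, f2), (e3, f3)] : List (Gen × Gen)) := by
    rcases hf with rfl | rfl | rfl
    exacts [⟨e1, by simp⟩, ⟨e2, by simp⟩, ⟨e3, by simp⟩]
  have := List.all_eq_true.1 (List.all_eq_true.1 brL_f_check _ hx) a (mem_gens a)
  simp only [Bool.and_eq_true, List.all_eq_true, bne_iff_ne] at this
  have h := this.1 s hs
  simp only [List.mem_cons, Prod.mk.injEq, List.not_mem_nil, or_false, and_self] at hi
  rcases hi with rfl | rfl | rfl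
  exacts [h.1.1, h.1.2, h.2]

theorem brL_f_comm (hf : IsF f) (hf' : IsF f') (a : Gen) :
    ev v σ (subst (brL a f) fun g => brL g f') = ev v σ (subst (brL a f') fun g => brL g f) := by
  obtain ⟨x, hx⟩ : ∃ x, (x, f) ∈ ([(e1, f1), (e2, f2), (e3, f3)] : List (Gen × Gen)) := by
    rcases hf with rfl | rfl | rfl
    exacts [⟨e1, by simp⟩, ⟨e2, by simp⟩, ⟨e3, by simp⟩]
  have := List.all_eq_true.1 (List.all_eq_true.1 brL_f_check _ hx) a (mem_gens a)
  rw [Bool.and_eq_true] at this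
  have := ev_eq_zero v σ (List.all_eq_true.1 this.2 f' (by
    rcases hf' with rfl | rfl | rfl <;> simp))
  rw [ev_append, ev_scale] at this
  rw [← sub_eq_zero, ← this]
  simp [sub_eq_add_neg]

/-- If `t` stands for `f` and `d` for `∂/∂f`, and the `σ a` commute with `f`, the operators
`σ a + σ [a, f] ∂ + σ [[a, f], f] ∂² / 2` have the commutators with `f` that they should have. -/
def lift (v : ℕ → F) (e f : Gen) (d : Module.End F M) (σ : Gen → Module.End F M) (a : Gen) :
    Module.End F M :=
  σ a + ev v σ (brL a f) * d + (if a = e then -σ f else 0) * d ^ 2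

theorem ev_lift (l : Comb Gen) (hl : ∀ s ∈ l, s.key ≠ e) :
    ev v (lift v e f d σ) l = ev v σ l + ev v σ (subst l fun g => brL g f) * d := by
  induction l with
  | nil => simp [ev, subst]
  | cons s l ih =>
    have h : subst (s :: l) (fun g => brL g f) =
      scale s.coef s.mon (brL s.key f) ++ subst l (fun g => brL g f) := rfl
    rw [ev_cons, ih fun x hx => hl x (List.mem_cons_of_mem _ hx), ev_cons, h, ev_append, ev_scale,
      lift, if_neg (hl s (by simp)), zero_mul, add_zero, add_mul, smul_add, smul_mul_assoc]
    abel

theorem mem_diag (hef : (e, f) ∈ efs) :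
    (e, e) ∈ ([(e1, e1), (e2, e2), (e3, e3)] : List (Gen × Gen)) := by
  simp only [efs, List.mem_cons, Prod.mk.injEq, List.not_mem_nil, or_false] at hef
  rcases hef with ⟨h, _⟩ | ⟨h, _⟩ | ⟨h, _⟩ <;> simp [h]

theorem lift_comm_self (hef : (e, f) ∈ efs) (ht : ∀ a, σ a * t = t * σ a)
    (hd : d * t = t * d + 1) (a : Gen) :
    lift v e f d σ a * t = t * lift v e f d σ a + ev v (lift v e f d σ) (brL a f) := by
  have hf := isF_of_mem_efs hef
  have hQ := ev_eq_zero v σ (List.all_eq_true.1 (List.all_eq_true.1 brL_brL_check _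
    (List.mem_append_left [(f1, e1), (f2, e2), (f3, e3)] hef)) a (mem_gens a))
  rw [ev_append] at hQ
  have hq : ev v σ (subst (brL a f) fun g => brL g f) =
      (2 : F) • if a = e then -σ f else 0 := by
    rw [eq_neg_of_add_eq_zero_left hQ]
    split_ifs <;> simp [ev]
  have hs : ev v σ (brL a f) * t = t * ev v σ (brL a f) := by
    rw [ev_mul, mul_ev]
    exact ev_congr v fun s _ => ht _
  have hq' : (if a = e then -σ f else 0) * t = t * (if a = e then -σ f else 0) := by
    split_ifs <;> simp [ht]
  have hd2 : d ^ 2 * t = t * d ^ 2 + (2 : F) • d := by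
    rw [pow_two, mul_assoc, hd, mul_add, ← mul_assoc, hd, two_smul]
    simp only [add_mul, mul_assoc, one_mul, mul_one, add_assoc]
  rw [ev_lift _ (brL_f_ne hf (mem_diag hef) a), hq]
  unfold lift
  generalize (if a = e then -σ f else 0) = Q at *
  generalize ev v σ (brL a f) = S at *
  calc _ = σ a * t + S * (d * t) + Q * (d ^ 2 * t) := by simp only [add_mul, mul_assoc]
    _ = σ a * t + (S * t) * d + S + (Q * t) * d ^ 2 + (2 : F) • (Q * d) := by
      rw [hd, hd2]
      simp only [mul_add, mul_assoc, mul_one, mul_smul_comm]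
      abel
    _ = _ := by
      rw [ht, hs, hq']
      simp only [mul_add, mul_assoc, smul_mul_assoc]
      abel

theorem lift_comm_other (hef : (e, f) ∈ efs) (hf' : IsF f')
    (ht : ∀ a, σ a * t' = t' * σ a + ev v σ (brL a f')) (hd : Commute d t') (a : Gen) :
    lift v e f d σ a * t' = t' * lift v e f d σ a + ev v (lift v e f d σ) (brL a f') := by
  have hf := isF_of_mem_efs hef
  have hs : ev v σ (brL a f) * t' = t' * ev v σ (brL a f) +
      ev v σ (subst (brL a f') fun g => brL g f) := by
    rw [ev_mul, mul_ev, ← brL_f_comm hf hf', ev_subst]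
    have h1 := ev_add_smul v (1 : F) (fun g => t' * σ g) (fun g => ev v σ (brL g f')) (brL a f)
    simp only [one_smul] at h1
    rw [← h1]
    exact ev_congr v fun s _ => ht _
  have hq' : (if a = e then -σ f else 0) * t' = t' * (if a = e then -σ f else 0) := by
    have := ht f
    rw [brL_f_f hf hf', ev_nil, add_zero] at this
    split_ifs <;> simp [this]
  rw [ev_lift _ (brL_f_ne hf' (mem_diag hef) a)]
  unfold lift
  generalize (if a = e then -σ f else 0) = Q at *
  generalize ev v σ (brL a f) = S at *
  calc _ = σ a * t' + S * (d * t') + Q * (d ^ 2 * t') := by simp only [add_mul, mul_assoc]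
    _ = σ a * t' + (S * t') * d + (Q * t') * d ^ 2 := by
      rw [hd.eq, (hd.pow_left 2).eq]
      simp only [mul_assoc]
    _ = _ := by
      rw [ht, hs, hq']
      simp only [mul_add, add_mul, mul_assoc]
      abel

theorem lift_comm_of_comm (ht : ∀ a, σ a * t' = t' * σ a) (hd : Commute d t') (a : Gen) :
    lift v e f d σ a * t' = t' * lift v e f d σ a := by
  have hs : Commute (ev v σ (brL a f)) t' := by
    unfold Commute SemiconjBy
    rw [ev_mul, mul_ev]
    exact ev_congr v fun s _ => ht _
  have hq : Commute (if a = e then -σ f else 0) t' := by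
    have h : Commute (σ f) t' := ht f
    split_ifs
    · exact h.neg_left
    · exact Commute.zero_left _
  exact ((Commute.add_left (ht a) (hs.mul_left hd)).add_left (hq.mul_left (hd.pow_left 2))).eq

theorem lift_f (hef : (e, f) ∈ efs) (hf' : IsF f') : lift v e f d σ f' = σ f' := by
  have h : f' ≠ e := by
    simp only [efs, List.mem_cons, Prod.mk.injEq, List.not_mem_nil, or_false] at hef
    rcases hf' with rfl | rfl | rfl <;> rcases hef with ⟨rfl, _⟩ | ⟨rfl, _⟩ | ⟨rfl, _⟩ <;> decide
  simp [lift, brL_f_f hf' (isF_of_mem_efs hef), ev_nil, h]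

theorem lift_apply {m : M} (hm : d m = 0) (a : Gen) : lift v e f d σ a m = σ a m := by
  simp only [lift, pow_two, LinearMap.add_apply, Module.End.mul_apply, hm, map_zero, add_zero]

end

section

variable (F : Type*) [Field F] (p : ℕ) [Fact p.Prime] [CharP F p]

/-- Labels `(k, J)` of the monomials `f₁^{k₁} f₂^{k₂} f₃^{k₃} y_J`. -/
abbrev Lab (p : ℕ) : Type := (Fin 3 → ZMod p) × {J : List Gen // J ∈ Js}

/-- The underlying space of the model of the baby Verma module: it has the monomials
`f₁^{k₁} f₂^{k₂} f₃^{k₃} y_J` as a basis. -/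
abbrev Model (F : Type*) [Field F] (p : ℕ) : Type _ := Lab p →₀ F

/-- Multiplication by `f_{i+1}` on the model, where `f_{i+1}^p = 0`. -/
noncomputable def mulF (i : Fin 3) : Module.End F (Model F p) :=
  Finsupp.linearCombination F fun x : Lab p =>
    if x.1 i = -1 then 0 else Finsupp.single (Function.update x.1 i (x.1 i + 1), x.2) 1

/-- The partial derivative `∂/∂f_{i+1}` on the model. -/
noncomputable def derF (i : Fin 3) : Module.End F (Model F p) :=
  Finsupp.linearCombination F fun x : Lab p =>
    ZMod.castHom dvd_rfl F (x.1 i) • Finsupp.single (Function.update x.1 i (x.1 i - 1), x.2) 1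

variable {F p}

omit [CharP F p] in
theorem mulF_single (i : Fin 3) (k : Fin 3 → ZMod p) (J) :
    mulF F p i (Finsupp.single (k, J) 1) =
      if k i = -1 then 0 else Finsupp.single (Function.update k i (k i + 1), J) 1 := by
  simp [mulF]

theorem derF_single (i : Fin 3) (k : Fin 3 → ZMod p) (J) :
    derF F p i (Finsupp.single (k, J) 1) =
      ZMod.castHom dvd_rfl F (k i) • Finsupp.single (Function.update k i (k i - 1), J) 1 := by
  simp [derF]

omit [Fact (Nat.Prime p)] [CharP F p] in
theorem model_ext {N : Type*} [AddCommGroup N] [Module F N] {f g : Model F p →ₗ[F] N}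
    (h : ∀ k J, f (Finsupp.single (k, J) 1) = g (Finsupp.single (k, J) 1)) : f = g :=
  Finsupp.lhom_ext' fun x => LinearMap.ext_ring (h x.1 x.2)

omit [CharP F p] in
theorem mulF_comm (i j : Fin 3) : Commute (mulF F p i) (mulF F p j) := by
  by_cases hij : i = j
  · rw [hij]
  refine model_ext fun k J => ?_
  simp only [Module.End.mul_apply, mulF_single]
  split_ifs with h1 h2 h2 <;>
    simp [mulF_single, h1, h2, Function.update_of_ne hij, Function.update_of_ne (Ne.symm hij),
      Function.update_comm hij]

theorem derF_mulF_comm {i j : Fin 3} (hij : i ≠ j) : Commute (derF F p i) (mulF F p j) := by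
  refine model_ext fun k J => ?_
  have e1 (c : ZMod p) : Function.update k i c j = k j := Function.update_of_ne hij.symm _ _
  have e2 (c : ZMod p) : Function.update k j c i = k i := Function.update_of_ne hij _ _
  simp only [Module.End.mul_apply, mulF_single, derF_single, map_smul, e1]
  by_cases h : k j = -1
  · rw [if_pos h, if_pos h, map_zero, smul_zero]
  · rw [if_neg h, if_neg h, derF_single, e2, Function.update_comm hij]

theorem derF_mulF (i : Fin 3) : derF F p i * mulF F p i = mulF F p i * derF F p i + 1 := by
  refine model_ext fun k J => ?_
  have h10 : (1 : ZMod p) ≠ 0 := one_ne_zero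
  simp only [Module.End.mul_apply, mulF_single, derF_single, map_smul, LinearMap.add_apply,
    Module.End.one_apply, Function.update_self, Function.update_idem]
  by_cases h1 : k i = -1
  · have h2 : ¬(-1 - 1 : ZMod p) = -1 := fun h => h10 (by linear_combination -h)
    rw [h1, if_pos rfl, if_neg h2, map_zero, map_neg, map_one, sub_add_cancel, ← h1,
      Function.update_eq_self]
    simp
  rw [if_neg h1, derF_single, Function.update_self, Function.update_idem, add_sub_cancel_right,
    Function.update_eq_self, map_add, map_one, add_smul, one_smul]
  congr 1
  by_cases h0 : k i = 0
  · simp [h0]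
  · rw [if_neg fun h => h0 (by linear_combination h), sub_add_cancel, Function.update_eq_self]

/-- The basis vector `f₁^{k₁} f₂^{k₂} f₃^{k₃} y_J` of the model; zero if `J` is not one of the
sixteen lists `Js`. -/
noncomputable def modelY (k : Fin 3 → ZMod p) (J : List Gen) : Model F p :=
  if h : J ∈ Js then Finsupp.single (k, ⟨J, h⟩) 1 else 0

omit [CharP F p] in
theorem mulF_modelY (i : Fin 3) (k : Fin 3 → ZMod p) (J : List Gen) :
    mulF F p i (modelY k J) = if k i = -1 then 0 else modelY (Function.update k i (k i + 1)) J := by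
  unfold modelY
  split_ifs <;> simp_all [mulF_single]

omit [CharP F p] in
theorem mulF_pow_modelY (i : Fin 3) (k : Fin 3 → ZMod p) (J : List Gen) (n : ℕ) (hn : n < p) :
    (mulF F p i ^ n) (modelY (Function.update k i 0) J) =
      modelY (Function.update k i (n : ZMod p)) J := by
  induction n with
  | zero => simp
  | succ n ih =>
    rw [pow_succ', Module.End.mul_apply, ih (by omega), mulF_modelY]
    rw [if_neg]
    · simp
    · rw [Function.update_self]
      intro h
      have : ((n + 1 : ℕ) : ZMod p) = 0 := by push_cast; rw [h]; ring
      rw [ZMod.natCast_eq_zero_iff] at this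
      exact absurd (Nat.le_of_dvd (by omega) this) (by omega)

omit [CharP F p] in
theorem modelY_eq_pow (i : Fin 3) (k : Fin 3 → ZMod p) (J : List Gen) :
    modelY (F := F) k J = (mulF F p i ^ (k i).val) (modelY (Function.update k i 0) J) := by
  rw [mulF_pow_modelY i k J _ (ZMod.val_lt _)]
  simp

theorem mulF_pow_p (i : Fin 3) (k : Fin 3 → ZMod p) (J : List Gen) :
    (mulF F p i ^ p) (modelY k J) = 0 := by
  rw [modelY_eq_pow i, ← Module.End.mul_apply, ← pow_add, add_comm, pow_add, Module.End.mul_apply]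
  have hp := (Fact.out : p.Prime).pos
  have : (mulF F p i ^ p) (modelY (Function.update k i 0) J) = 0 := by
    have e : mulF F p i ^ p = mulF F p i * mulF F p i ^ (p - 1) := by
      rw [← pow_succ', Nat.sub_add_cancel hp]
    rw [e, Module.End.mul_apply, mulF_pow_modelY i k J _ (by omega), mulF_modelY, if_pos]
    simp [Nat.cast_sub (Nat.one_le_of_lt hp)]
  rw [this, map_zero]

/-- Every monomial is obtained from `y_J`. -/
theorem modelY_eq (k : Fin 3 → ZMod p) (J : List Gen) : modelY (F := F) k J =
    (mulF F p 0 ^ (k 0).val) ((mulF F p 1 ^ (k 1).val) ((mulF F p 2 ^ (k 2).val)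
      (modelY 0 J))) := by
  rw [modelY_eq_pow 0, modelY_eq_pow 1, modelY_eq_pow 2]
  have : Function.update (Function.update (Function.update k 0 0) 1 0) 2 0 = 0 := by
    ext i; fin_cases i <;> rfl
  rw [this]
  rfl

omit [Fact (Nat.Prime p)] [CharP F p] in
theorem modelY_mem (x : Lab p) : Finsupp.single x (1 : F) = modelY x.1 x.2 := by
  simp [modelY, x.2.2]

/-- The operators of multiplication by `f₁, f₂, f₃`. -/
noncomputable def genF (F : Type*) [Field F] (p : ℕ) [Fact p.Prime] [CharP F p] :
    Gen → Module.End F (Model F p)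
  | f1 => mulF F p 0
  | f2 => mulF F p 1
  | f3 => mulF F p 2
  | _ => 0

/-- The action of `b` on the `y_J`, extended to the model so as to commute with `f₁, f₂, f₃`. -/
noncomputable def modelT (F : Type*) [Field F] (p : ℕ) [Fact p.Prime] [CharP F p] (v : ℕ → F)
    (b : Gen) : Module.End F (Model F p) :=
  Finsupp.linearCombination F fun x : Lab p => ev v (mono p (genF F p) (modelY x.1)) (actJ x.2 b)

theorem modelT_modelY (v : ℕ → F) (b : Gen) (k : Fin 3 → ZMod p) {J : List Gen} (hJ : J ∈ Js) :
    modelT F p v b (modelY k J) = ev v (mono p (genF F p) (modelY k)) (actJ J b) := by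
  simp [modelT, modelY, hJ]

theorem modelT_comm (v : ℕ → F) (i : Fin 3) (b : Gen) :
    modelT F p v b * mulF F p i = mulF F p i * modelT F p v b := by
  have hmono (k : Fin 3 → ZMod p) (x : Ix) : mulF F p i (mono p (genF F p) (modelY k) x) =
      mono p (genF F p) (fun J => mulF F p i (modelY k J)) x := by
    have h0 := (mulF_comm (F := F) (p := p) i 0).pow_right (rep p x.k1)
    have h1 := (mulF_comm (F := F) (p := p) i 1).pow_right (rep p x.k2)
    have h2 := (mulF_comm (F := F) (p := p) i 2).pow_right (rep p x.k3)
    simp only [mono, genF, ← Module.End.mul_apply]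
    congr 1
    rw [h0.left_comm, h1.left_comm, h2.eq]
  refine model_ext fun k J => ?_
  have hJ := modelY_mem (F := F) (k, J)
  simp only at hJ
  simp only [Module.End.mul_apply]
  rw [hJ, modelT_modelY v b k J.2, map_ev, mulF_modelY]
  split_ifs with h
  · rw [map_zero]
    symm
    have : (fun x => mulF F p i (mono p (genF F p) (modelY k) x)) = fun _ => 0 := by
      funext x
      rw [hmono]
      simp [mono, mulF_modelY, h]
    rw [this]
    simp [ev]
  · rw [modelT_modelY v b _ J.2]
    refine ev_congr v fun t _ => ?_
    rw [hmono]
    simp [mono, mulF_modelY, h]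

/-- The action of `D(2,1;α)` on the model: the operators `modelT`, which commute with the `f_i`,
are corrected for one `f_i` after the other. -/
noncomputable def modelRep (F : Type*) [Field F] (p : ℕ) [Fact p.Prime] [CharP F p] (v : ℕ → F) :
    Gen → Module.End F (Model F p) :=
  lift v e3 f3 (derF F p 2) (lift v e2 f2 (derF F p 1) (lift v e1 f1 (derF F p 0) (modelT F p v)))

theorem modelT_f (v : ℕ → F) {f : Gen} (hf : IsF f) : modelT F p v f = genF F p f := by
  refine model_ext fun k J => ?_
  rw [modelY_mem, modelT_modelY v f k J.2]
  obtain ⟨J, hJ⟩ := J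
  rcases hf with rfl | rfl | rfl <;> cases J <;> simp [actJ, ev, mono, rep, genF]

theorem modelRep_f (v : ℕ → F) {f : Gen} (hf : IsF f) : modelRep F p v f = genF F p f := by
  unfold modelRep
  rw [lift_f (by simp [efs]) hf, lift_f (by simp [efs]) hf, lift_f (by simp [efs]) hf,
    modelT_f v hf]

theorem modelRep_comm (v : ℕ → F) (a f : Gen) (hf : IsF f) :
    modelRep F p v a * modelRep F p v f =
      modelRep F p v f * modelRep F p v a + ev v (modelRep F p v) (brL a f) := by
  rw [modelRep_f v hf]
  have d (i j : Fin 3) (h : i ≠ j) := derF_mulF_comm (F := F) (p := p) h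
  rcases hf with rfl | rfl | rfl
  · exact lift_comm_other (by simp [efs]) (by simp [IsF])
      (lift_comm_other (by simp [efs]) (by simp [IsF])
        (lift_comm_self (by simp [efs]) (modelT_comm v 0) (derF_mulF 0)) (d 1 0 (by decide)))
      (d 2 0 (by decide)) a
  · exact lift_comm_other (by simp [efs]) (by simp [IsF])
      (lift_comm_self (by simp [efs])
        (lift_comm_of_comm (modelT_comm v 1) (d 0 1 (by decide))) (derF_mulF 1))
      (d 2 1 (by decide)) a
  · exact lift_comm_self (by simp [efs])
      (lift_comm_of_comm (lift_comm_of_comm (modelT_comm v 2) (d 0 2 (by decide)))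
        (d 1 2 (by decide))) (derF_mulF 2) a

theorem derF_modelY (i : Fin 3) (J : List Gen) : derF F p i (modelY 0 J) = 0 := by
  unfold modelY
  split_ifs <;> simp [derF_single]

omit [Fact (Nat.Prime p)] [CharP F p] in
theorem mono_congr {M : Type*} [AddCommGroup M] [Module F M] {r r' : Gen → Module.End F M}
    (h : ∀ f, IsF f → r f = r' f) (u : List Gen → M) : mono p r u = mono p r' u := by
  funext i
  simp [mono, h f1 (by simp [IsF]), h f2 (by simp [IsF]), h f3 (by simp [IsF])]

theorem modelRep_hasMonomials (v : ℕ → F) : HasMonomials p v (modelRep F p v) (modelY 0) where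
  comm := modelRep_comm v
  pow f hf J := by
    rw [modelRep_f v hf]
    rcases hf with rfl | rfl | rfl <;> exact mulF_pow_p _ _ _
  act_u J hJ b := by
    rw [mono_congr fun f hf => modelRep_f v hf, ← modelT_modelY v b 0 hJ]
    unfold modelRep
    rw [lift_apply (derF_modelY _ _), lift_apply (derF_modelY _ _), lift_apply (derF_modelY _ _)]

theorem ev_brL_swap {M : Type*} [AddCommGroup M] [Module F M] {v : ℕ → F} (w : Gen → M)
    (a b : Gen) : ev v w (brL a b) = -((sgn a b : F) • ev v w (brL b a)) := by
  rw [brL, brL, ev_append, ev_append, ev_scale, ev_scale, sgn_comm b a]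
  rcases sgn_eq (F := F) a b with h | h <;> simp [h]

theorem isY_brL_f_check : (([f1, f2, f3] : List Gen).all fun f => gens.all fun y =>
    !(isY y) || (brL f y).all fun t => isY t.key) = true := by
  decide +kernel

theorem cons_check : (Js.all fun J => match J with
    | [] => true
    | j :: J' => (ins j J').map (fun t => (t.coef, t.mon, t.key)) ==
        [((1 : ℤ), ([] : List ℕ), (⟨0, 0, 0, j :: J'⟩ : Ix))]) = true := by
  decide +kernel

theorem ins_eq_cons {j : Gen} {J : List Gen} (hJ : j :: J ∈ Js) :
    ins j J = [⟨1, [], 0, 0, 0, j :: J⟩] := by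
  have hc := List.all_eq_true.1 cons_check _ hJ
  simp only [beq_iff_eq, List.map_eq_singleton_iff, Prod.mk.injEq] at hc
  obtain ⟨⟨c, m, k⟩, h1, h2, h3, h4⟩ := hc
  simp only at h2 h3 h4
  rw [h1, h2, h3, h4]

theorem modelRep_modelY_cons (v : ℕ → F) {j : Gen} {J : List Gen} (hJ : j :: J ∈ Js) :
    modelRep F p v j (modelY 0 J) = modelY 0 (j :: J) := by
  have ha : actJ J j = ins j J := by
    have hj := isY_of_mem_Js hJ j (by simp)
    cases j <;> first | exact absurd hj (by decide) | rw [actJ]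
  rw [(modelRep_hasMonomials v).act_u J (Js_tail hJ), ha, ins_eq_cons hJ, ev_cons, ev_nil,
    mono_zero]
  simp

/-- The model is a representation: the relations of the `f_i` hold by construction, those of the
`y_j` because they hold on the vectors `y_J`, and the remaining ones because they hold on the
highest weight vector and are carried along by the `y_j` and `f_i`. -/
theorem modelRep_isRep (hp : 5 ≤ p) (v : ℕ → F) : IsRep v (modelRep F p v) := by
  have hM := modelRep_hasMonomials (p := p) v
  have hf (f : Gen) (hf : IsF f) (a : Gen) : modelRep F p v f * modelRep F p v a =
      (sgn f a : F) • (modelRep F p v a * modelRep F p v f) + ev v (modelRep F p v) (brL f a) := by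
    rw [modelRep_comm v a f hf, ev_brL_swap _ f a, sgn_comm f a,
      sgn_even (a := a) (b := f) (by rcases hf with rfl | rfl | rfl <;> rfl)]
    simp only [Int.cast_one, one_smul]
    abel
  -- relations that hold on the `y_J` and are stable under brackets with the `f_i` hold everywhere
  have spread {P : Gen → Prop} (hP : ∀ f, IsF f → ∀ a, P a → ∀ t ∈ brL f a, P t.key)
      (h : ∀ J ∈ Js, RelAt v (modelRep F p v) P (modelY 0 J)) (a : Gen) (ha : P a) (b : Gen) :
      modelRep F p v a * modelRep F p v b =
        (sgn a b : F) • (modelRep F p v b * modelRep F p v a) +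
          ev v (modelRep F p v) (brL a b) := by
    refine model_ext fun k J => ?_
    have pow (f : Gen) (hf' : IsF f) (n : ℕ) (m) (hm : RelAt v (modelRep F p v) P m) :
        RelAt v (modelRep F p v) P ((modelRep F p v f ^ n) m) := by
      induction n with
      | zero => simpa using hm
      | succ n ih =>
        rw [pow_succ', Module.End.mul_apply]
        exact ih.apply (hf f hf') (hP f hf')
    have hk : modelY k J.1 = (modelRep F p v f1 ^ (k 0).val) ((modelRep F p v f2 ^ (k 1).val)
        ((modelRep F p v f3 ^ (k 2).val) (modelY 0 J.1))) := by
      rw [modelRep_f v (by simp [IsF]), modelRep_f v (by simp [IsF]), modelRep_f v (by simp [IsF])]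
      exact modelY_eq k J.1
    have := pow f1 (by simp [IsF]) (k 0).val _ (pow f2 (by simp [IsF]) (k 1).val _
      (pow f3 (by simp [IsF]) (k 2).val _ (h J.1 J.2)))
    rw [← hk] at this
    rw [modelY_mem]
    simpa using this a ha b
  have hy (y : Gen) (hy : isY y = true) := spread (P := fun y => isY y = true)
    (fun f hf y hy t ht => by
      have := List.all_eq_true.1 (List.all_eq_true.1 isY_brL_f_check f
        (by rcases hf with rfl | rfl | rfl <;> simp)) y (mem_gens y)
      simp only [hy, Bool.not_true, Bool.false_or, List.all_eq_true] at this
      exact this t ht)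
    (fun J hJ a ha b => by
      refine hM.defect_apply hp hJ ?_
      refine List.all_eq_true.1 (List.all_eq_true.1 (List.all_eq_true.1 defect_check a ?_) b
        (mem_gens b)) J hJ
      cases a <;> first | exact absurd ha (by decide) | decide) y hy
  refine fun a b => spread (P := fun _ => True) (fun _ _ _ _ _ _ => trivial) ?_ a trivial b
  intro J
  induction J with
  | nil =>
    intro hJ a _ b
    exact hM.defect_apply hp hJ (List.all_eq_true.1 (List.all_eq_true.1 defect_nil_check a
      (mem_gens a)) b (mem_gens b))
  | cons j J ih =>
    intro hJ
    have hj := isY_of_mem_Js hJ j (by simp)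
    have h1 := ih (Js_tail hJ)
    rw [← modelRep_modelY_cons v hJ]
    exact h1.apply (hy j hj) fun _ _ _ _ => trivial

end

/-! ### The span of the monomials -/

section

variable {F M : Type*} [Field F] [AddCommGroup M] [Module F M]
variable {p : ℕ} {v : ℕ → F} {r : Gen → Module.End F M} {u : List Gen → M}

/-- The span of the vectors `f₁^{n₁} f₂^{n₂} f₃^{n₃} y_J` for which the length of `J` has
the parity `s`. -/
def monoSpan (r : Gen → Module.End F M) (u : List Gen → M) (s : Bool) : Submodule F M :=
  Submodule.span F {x | ∃ n1 n2 n3 : ℕ, ∃ J ∈ Js, oddLen J = s ∧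
    x = (r f1 ^ n1) ((r f2 ^ n2) ((r f3 ^ n3) (u J)))}

theorem mono_mem_monoSpan {i : Ix} (hJ : i.J ∈ Js) : mono p r u i ∈ monoSpan r u (oddLen i.J) :=
  Submodule.subset_span ⟨_, _, _, i.J, hJ, rfl, rfl⟩

theorem HasMonomials.apply_mem_monoSpan (h : HasMonomials p v r u) (a : Gen) {s : Bool} {x : M}
    (hx : x ∈ monoSpan r u s) : r a x ∈ monoSpan r u (s ^^ odd a) := by
  have odd_f {f : Gen} (hf : IsF f) : odd f = false := by rcases hf with rfl | rfl | rfl <;> rfl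
  have hfm {f : Gen} (hf : IsF f) {s : Bool} {x : M} (hx : x ∈ monoSpan r u s) :
      r f x ∈ monoSpan r u s := by
    induction hx using Submodule.span_induction with
    | zero => simp
    | add x y _ _ hx hy => rw [map_add]; exact add_mem hx hy
    | smul c x _ hx => rw [map_smul]; exact Submodule.smul_mem _ c hx
    | mem x hx =>
      obtain ⟨n1, n2, n3, J, hJ, hs, rfl⟩ := hx
      have h21 := comm_f_f h.comm (f := f2) (f' := f1) (by simp [IsF]) (by simp [IsF])
      have h31 := comm_f_f h.comm (f := f3) (f' := f1) (by simp [IsF]) (by simp [IsF])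
      have h32 := comm_f_f h.comm (f := f3) (f' := f2) (by simp [IsF]) (by simp [IsF])
      refine Submodule.subset_span ?_
      rcases hf with rfl | rfl | rfl
      · exact ⟨n1 + 1, n2, n3, J, hJ, hs, by rw [pow_succ', Module.End.mul_apply]⟩
      · refine ⟨n1, n2 + 1, n3, J, hJ, hs, ?_⟩
        rw [pow_succ', ← Module.End.mul_apply, (h21.pow_right n1).eq]
        rfl
      · refine ⟨n1, n2, n3 + 1, J, hJ, hs, ?_⟩
        rw [pow_succ', ← Module.End.mul_apply, (h31.pow_right n1).eq, Module.End.mul_apply,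
          ← Module.End.mul_apply (r f3), (h32.pow_right n2).eq]
        rfl
  have step {f : Gen} (hf : IsF f) {s : Bool} {x : M}
      (hx : ∀ a, r a x ∈ monoSpan r u (s ^^ odd a)) (a : Gen) :
      r a (r f x) ∈ monoSpan r u (s ^^ odd a) := by
    have := LinearMap.congr_fun (h.comm a f hf) x
    simp only [Module.End.mul_apply, LinearMap.add_apply, ev_apply] at this
    rw [this]
    refine add_mem (hfm hf (hx a)) (ev_mem v _ fun t ht => ?_)
    have := hx t.key
    rwa [odd_brL t ht, odd_f hf, Bool.xor_false] at this
  have pow {f : Gen} (hf : IsF f) {s : Bool} {x : M}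
      (hx : ∀ a, r a x ∈ monoSpan r u (s ^^ odd a)) (n : ℕ) :
      ∀ a, r a ((r f ^ n) x) ∈ monoSpan r u (s ^^ odd a) := by
    induction n with
    | zero => simpa using hx
    | succ n ih => rw [pow_succ', Module.End.mul_apply]; exact step hf ih
  induction hx using Submodule.span_induction with
  | zero => simp
  | add x y _ _ hx hy => rw [map_add]; exact add_mem hx hy
  | smul c x _ hx => rw [map_smul]; exact Submodule.smul_mem _ c hx
  | mem x hx =>
    obtain ⟨n1, n2, n3, J, hJ, hs, rfl⟩ := hx
    refine pow (by simp [IsF]) (pow (by simp [IsF]) (pow (by simp [IsF]) (fun b => ?_) n3) n2) n1 a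
    rw [h.act_u J hJ b]
    refine ev_mem v _ fun t ht => ?_
    obtain ⟨_, tJ, tp⟩ := actJ_spec hJ b t ht
    rw [← hs, ← tp]
    exact mono_mem_monoSpan tJ

theorem HasMonomials.apply_mem_sup (h : HasMonomials p v r u) (a : Gen) {x : M}
    (hx : x ∈ monoSpan r u false ⊔ monoSpan r u true) :
    r a x ∈ monoSpan r u false ⊔ monoSpan r u true := by
  have key (s : Bool) : monoSpan r u s ≤ monoSpan r u false ⊔ monoSpan r u true := by
    cases s
    · exact le_sup_left
    · exact le_sup_right
  obtain ⟨y, hy, z, hz, rfl⟩ := Submodule.mem_sup.1 hx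
  rw [map_add]
  exact add_mem (key _ (h.apply_mem_monoSpan a hy)) (key _ (h.apply_mem_monoSpan a hz))

/-- The monomial vectors, indexed by exponents modulo `p`. -/
def monoVec (p : ℕ) (r : Gen → Module.End F M) (u : List Gen → M) (x : Lab p) : M :=
  (r f1 ^ (x.1 0).val) ((r f2 ^ (x.1 1).val) ((r f3 ^ (x.1 2).val) (u x.2)))

theorem HasMonomials.monoSpan_le [NeZero p] (h : HasMonomials p v r u) (s : Bool) :
    monoSpan r u s ≤ Submodule.span F (Set.range (monoVec p r u)) := by
  refine Submodule.span_le.2 ?_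
  rintro _ ⟨n1, n2, n3, J, hJ, -, rfl⟩
  by_cases hn : p ≤ n1 ∨ p ≤ n2 ∨ p ≤ n3
  · rw [pow_apply_mono_eq_zero h.comm h.pow _ _ _ _ hn]
    exact Submodule.zero_mem _
  · push Not at hn
    refine Submodule.subset_span ⟨(![(n1 : ZMod p), n2, n3], ⟨J, hJ⟩), ?_⟩
    simp [monoVec, ZMod.val_natCast_of_lt hn.1, ZMod.val_natCast_of_lt hn.2.1,
      ZMod.val_natCast_of_lt hn.2.2]

theorem HasMonomials.finite_sup [NeZero p] (h : HasMonomials p v r u) :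
    FiniteDimensional F (monoSpan r u false ⊔ monoSpan r u true : Submodule F M) ∧
      Module.finrank F (monoSpan r u false ⊔ monoSpan r u true : Submodule F M) ≤
        Fintype.card (Lab p) := by
  have hle := sup_le (h.monoSpan_le false) (h.monoSpan_le true)
  have : FiniteDimensional F (Submodule.span F (Set.range (monoVec p r u))) :=
    FiniteDimensional.span_of_finite F (Set.finite_range _)
  exact ⟨Submodule.finiteDimensional_of_le hle,
    (Submodule.finrank_mono hle).trans (finrank_range_le_card _)⟩

end

/-! ### The coefficient of the lowest monomial -/

/-- The label of the vector `f₁^{p-1} f₂^{p-1} f₃^{p-1} y₁ y₂ y₃ y₄`. -/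
def topIx : Ix := ⟨-1, -1, -1, [y1, y2, y3, y4]⟩

/-- The sum of the weights of the elements of `J`. -/
def wtJ (J : List Gen) (i : Fin 3) : ℤ := (J.map fun j => wt j i).sum

theorem actJ_h_check : (([(h1, 0), (h2, 1), (h3, 2)] : List (Gen × Fin 3)).all fun s =>
    Js.all fun J => isZero (actJ J s.1 ++ [⟨-1, [s.2.1 + 1], ⟨0, 0, 0, J⟩⟩,
      ⟨-wtJ J s.2, [], ⟨0, 0, 0, J⟩⟩])) = true := by
  decide +kernel

theorem actJ_top_check : (Js.all fun J =>
    ([e2, e3, x4].all fun b => (actJ J b).all fun t => t.key.J != [y1, y2, y3, y4]) &&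
    ([h2, h3, y4].all fun b => (actJ J b).all fun t => t.key.J != [y1, y2, y3, y4] ||
      (t.key.k1 == 0 && t.key.k2 == 0 && t.key.k3 == 0))) = true := by
  decide +kernel

/-- The action of a product of basis elements on a combination of monomials. -/
def actAll (l : Comb Ix) : List Gen → Comb Ix
  | [] => l
  | y :: ys => collect (subst (actAll l ys) (act y))

/-- All exponents occurring in the computation of `actAll` are at least `-3`. -/
def actAllGood (l : Comb Ix) : List Gen → Bool
  | [] => true
  | _ :: ys => actAllGood l ys && (actAll l ys).all fun t => Js.contains t.key.J &&
      decide (-3 ≤ t.key.k1) && decide (-3 ≤ t.key.k2) && decide (-3 ≤ t.key.k3)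

/-- The coefficient of the lowest monomial in a combination. -/
def topPart (l : Comb Ix) : Comb Unit :=
  (l.filter fun t => t.key = topIx).map fun t => ⟨t.coef, t.mon, ()⟩

/-- The complement of `J` in `[y₄, y₃, y₂, y₁]`. -/
def compl (J : List Gen) : List Gen := [y4, y3, y2, y1].filter fun y => !J.contains y

/-- The products of the `y_j` are dual to each other with respect to the coefficient of the lowest
monomial. -/
theorem dual_check : (Js.all fun J₀ => Js.all fun J =>
    let l := actAll [⟨1, [], ⟨-1, -1, -1, J⟩⟩] (compl J₀)
    actAllGood [⟨1, [], ⟨-1, -1, -1, J⟩⟩] (compl J₀) &&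
    (l.all fun t => Js.contains t.key.J &&
      decide (-5 ≤ t.key.k1) && decide (-5 ≤ t.key.k2) && decide (-5 ≤ t.key.k3) &&
      decide (t.key.k1 ≤ 3) && decide (t.key.k2 ≤ 3) && decide (t.key.k3 ≤ 3)) &&
    if J₀ = J then isZero (topPart l ++ [⟨-1, [], ()⟩]) || isZero (topPart l ++ [⟨1, [], ()⟩])
    else isZero (topPart l)) = true := by
  decide +kernel

section

variable {F M : Type*} [Field F] [AddCommGroup M] [Module F M]
variable {p : ℕ} {v : ℕ → F} {r : Gen → Module.End F M} {u : List Gen → M}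

theorem HasMonomials.actAll [CharP F p] (h : HasMonomials p v r u) (hp : 5 ≤ p) (l : Comb Ix)
    (ys : List Gen) (hg : actAllGood l ys = true) :
    (ys.map r).prod (ev v (mono p r u) l) = ev v (mono p r u) (actAll l ys) := by
  induction ys with
  | nil => simp [D21.actAll]
  | cons y ys ih =>
    rw [actAllGood, Bool.and_eq_true] at hg
    rw [List.map_cons, List.prod_cons, Module.End.mul_apply, ih hg.1, D21.actAll, ev_collect]
    refine h.act_ev hp (fun t ht => ?_) y
    simpa [and_assoc] using List.all_eq_true.1 hg.2 t ht

theorem ev_topPart (l : Comb Ix) (g : Ix → F)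
    (hg : ∀ t ∈ l, g t.key = if t.key = topIx then 1 else 0) :
    ev v g l = ev v (fun _ => 1) (topPart l) := by
  induction l with
  | nil => rfl
  | cons t l ih =>
    rw [ev_cons, ih fun t ht => hg t (List.mem_cons_of_mem _ ht), hg t (by simp)]
    unfold topPart
    by_cases h : t.key = topIx <;> simp [h, ev_cons]

end

section

variable {F : Type*} [Field F] {p : ℕ} [Fact p.Prime] [CharP F p]

/-- The coefficient of `f₁^{p-1} f₂^{p-1} f₃^{p-1} y₁ y₂ y₃ y₄`. -/
noncomputable def topCoef (F : Type*) [Field F] (p : ℕ) : Model F p →ₗ[F] F :=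
  Finsupp.lapply (fun _ => -1, ⟨[y1, y2, y3, y4], by decide⟩)

omit [CharP F p] in
theorem topCoef_modelY (k : Fin 3 → ZMod p) (J : List Gen) :
    topCoef F p (modelY k J) = if (∀ i, k i = -1) ∧ J = [y1, y2, y3, y4] then 1 else 0 := by
  have hk : (k = fun _ => -1) ↔ ∀ i, k i = -1 := funext_iff
  unfold topCoef modelY
  by_cases hJ : J ∈ Js
  · simp [hJ, Finsupp.single_apply, hk]
  · rw [dif_neg hJ, if_neg, map_zero]
    rintro ⟨_, rfl⟩
    exact hJ (by decide)

theorem topCoef_derF (i : Fin 3) : topCoef F p ∘ₗ derF F p i = 0 := by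
  refine model_ext fun k J => ?_
  rw [LinearMap.comp_apply, derF_single, map_smul, modelY_mem, topCoef_modelY]
  by_cases h : k i = 0
  · simp [h]
  · rw [if_neg]
    · simp
    · rintro ⟨h1, _⟩
      have := h1 i
      simp only [Function.update_self] at this
      exact h (by linear_combination this)

theorem topCoef_mulF_derF (i : Fin 3) :
    topCoef F p ∘ₗ (mulF F p i * derF F p i) = -topCoef F p := by
  refine model_ext fun k J => ?_
  have h0 := LinearMap.congr_fun (topCoef_derF (F := F) (p := p) i) (mulF F p i (modelY k J))
  rw [modelY_mem, ← sub_eq_zero]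
  have h1 := LinearMap.congr_fun (derF_mulF (F := F) (p := p) i) (modelY k J)
  rw [LinearMap.comp_apply, ← Module.End.mul_apply, h1] at h0
  simpa using h0

omit [CharP F p] in
theorem mulF_pow_modelY_eq (i : Fin 3) (n : ℕ) (k : Fin 3 → ZMod p) (J : List Gen) :
    ∃ c : F, ∃ k', (mulF F p i ^ n) (modelY k J) = c • modelY k' J := by
  induction n with
  | zero => exact ⟨1, k, by simp⟩
  | succ n ih =>
    obtain ⟨c, k', h⟩ := ih
    rw [pow_succ', Module.End.mul_apply, h, map_smul, mulF_modelY]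
    split_ifs
    · exact ⟨0, k, by simp⟩
    · exact ⟨c, _, rfl⟩

theorem topCoef_mono_eq_zero (k : Fin 3 → ZMod p) {i : Ix} (h : i.J ≠ [y1, y2, y3, y4]) :
    topCoef F p (mono p (genF F p) (modelY k) i) = 0 := by
  obtain ⟨c1, k1, e1⟩ := mulF_pow_modelY_eq (F := F) 2 (rep p i.k3) k i.J
  obtain ⟨c2, k2, e2⟩ := mulF_pow_modelY_eq (F := F) 1 (rep p i.k2) k1 i.J
  obtain ⟨c3, k3, e3⟩ := mulF_pow_modelY_eq (F := F) 0 (rep p i.k1) k2 i.J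
  simp only [mono, genF, e1, map_smul, e2, e3, topCoef_modelY]
  simp [h]

theorem topCoef_modelT (v : ℕ → F) {b : Gen} (hb : b ∈ [e2, e3, x4]) :
    topCoef F p ∘ₗ modelT F p v b = 0 := by
  refine model_ext fun k J => ?_
  rw [LinearMap.comp_apply, modelY_mem, modelT_modelY v b k J.2, map_ev, LinearMap.zero_apply]
  have := List.all_eq_true.1 actJ_top_check J.1 J.2
  rw [Bool.and_eq_true] at this
  have := List.all_eq_true.1 (List.all_eq_true.1 this.1 b hb)
  rw [ev_congr (f' := fun _ => 0) v fun t ht => topCoef_mono_eq_zero k (by simpa using this t ht)]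
  simp [ev]

theorem topCoef_modelT_derF (v : ℕ → F) {b : Gen} (hb : b ∈ [h2, h3, y4]) (i : Fin 3) :
    topCoef F p ∘ₗ (modelT F p v b * derF F p i) = 0 := by
  refine model_ext fun k J => ?_
  rw [LinearMap.comp_apply, Module.End.mul_apply, derF_single, map_smul, map_smul, modelY_mem]
  by_cases h0 : k i = 0
  · simp [h0]
  rw [modelT_modelY v b _ J.2, map_ev, LinearMap.zero_apply]
  have := List.all_eq_true.1 actJ_top_check J.1 J.2
  rw [Bool.and_eq_true] at this
  have := List.all_eq_true.1 (List.all_eq_true.1 this.2 b hb)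
  rw [ev_congr (f' := fun _ => 0) v fun t ht => ?_]
  · simp [ev]
  have ht := this t ht
  simp only [Bool.or_eq_true, bne_iff_ne, Bool.and_eq_true, beq_iff_eq] at ht
  rcases ht with ht | ⟨⟨t1, t2⟩, t3⟩
  · exact topCoef_mono_eq_zero _ ht
  · simp only [mono, t1, t2, t3, rep, le_refl, if_true, Int.toNat_zero, pow_zero,
      Module.End.one_apply, topCoef_modelY]
    rw [if_neg]
    rintro ⟨h1, _⟩
    have := h1 i
    rw [Function.update_self] at this
    exact h0 (by linear_combination this)

theorem topCoef_mulF_derF_sq (i : Fin 3) :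
    topCoef F p ∘ₗ (mulF F p i * derF F p i ^ 2) = 0 := by
  have h : mulF F p i * derF F p i ^ 2 = derF F p i * (mulF F p i * derF F p i) - derF F p i := by
    rw [← mul_assoc, derF_mulF, add_mul, one_mul, mul_assoc, sq]
    abel
  rw [h, LinearMap.comp_sub, topCoef_derF, Module.End.mul_eq_comp, ← LinearMap.comp_assoc,
    topCoef_derF]
  simp

theorem topCoef_e2 (v : ℕ → F) : topCoef F p ∘ₗ modelRep F p v e2 = 0 := by
  have h : modelRep F p v e2 = modelT F p v e2 + modelT F p v h2 * derF F p 1 -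
      mulF F p 1 * derF F p 1 ^ 2 := by
    simp [modelRep, lift, brL, halfL, sgn, odd, scale, mulMon, wt, ev,
      modelT_f (F := F) (p := p) v (f := f2) (by simp [IsF]), genF]
    exact LinearMap.ext fun z => by simp [sub_eq_add_neg]
  rw [h, LinearMap.comp_sub, LinearMap.comp_add, topCoef_modelT v (by simp),
    topCoef_modelT_derF v (by simp), topCoef_mulF_derF_sq]
  simp

theorem topCoef_e3 (v : ℕ → F) : topCoef F p ∘ₗ modelRep F p v e3 = 0 := by
  have h : modelRep F p v e3 = modelT F p v e3 + modelT F p v h3 * derF F p 2 -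
      mulF F p 2 * derF F p 2 ^ 2 := by
    simp [modelRep, lift, brL, halfL, sgn, odd, scale, mulMon, wt, ev,
      modelT_f (F := F) (p := p) v (f := f3) (by simp [IsF]), genF]
    exact LinearMap.ext fun z => by simp [sub_eq_add_neg]
  rw [h, LinearMap.comp_sub, LinearMap.comp_add, topCoef_modelT v (by simp),
    topCoef_modelT_derF v (by simp), topCoef_mulF_derF_sq]
  simp

theorem topCoef_x4 (v : ℕ → F) : topCoef F p ∘ₗ modelRep F p v x4 = 0 := by
  have h : modelRep F p v x4 = modelT F p v x4 - modelT F p v y4 * derF F p 0 := by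
    simp [modelRep, lift, brL, halfL, sgn, odd, scale, mulMon, wt, ev]
    exact LinearMap.ext fun z => by simp [sub_eq_add_neg]
  rw [h, LinearMap.comp_sub, topCoef_modelT v (by simp), topCoef_modelT_derF v (by simp)]
  simp

theorem topCoef_modelT_h (v : ℕ → F) (i : Fin 3) :
    topCoef F p ∘ₗ modelT F p v (hG i) = (v (i.1 + 1) + wtJ [y1, y2, y3, y4] i) • topCoef F p := by
  refine model_ext fun k J => ?_
  have hJ := modelY_mem (F := F) (k, J)
  simp only at hJ
  have := ev_eq_zero v (mono p (genF F p) (modelY k)) (List.all_eq_true.1 (List.all_eq_true.1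
    actJ_h_check (hG i, i) (by fin_cases i <;> simp [hG])) J.1 J.2)
  rw [ev_append, ← modelT_modelY v _ k J.2] at this
  simp only [ev_cons, ev_nil, mono, rep, le_refl, if_true, Int.toNat_zero, pow_zero,
      Module.End.one_apply] at this
  have h2 : modelT F p v (hG i) (modelY k J.1) = (v (i.1 + 1) + wtJ J.1 i) • modelY k J.1 := by
    rw [← sub_eq_zero, ← this]
    simp
    module
  rw [hJ, LinearMap.comp_apply, h2, map_smul, LinearMap.smul_apply, topCoef_modelY]
  split_ifs with h
  · rw [h.2]
  · simp

/-- The linear form `topCoef` has the weight of the lowest monomial, which is lower than the highest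
weight by `(2, -2, -2)` modulo `p`. -/
theorem topCoef_h (v : ℕ → F) (i : Fin 3) : topCoef F p ∘ₗ modelRep F p v (hG i) =
    (v (i.1 + 1) - (![2, -2, -2] : Fin 3 → F) i) • topCoef F p := by
  have h : modelRep F p v (hG i) =
      modelT F p v (hG i) - (2 : F) • (mulF F p i * derF F p i) := by
    fin_cases i <;>
    simp [modelRep, lift, brL, halfL, sgn, odd, scale, mulMon, wt, ev, hG,
      modelT_f (F := F) (p := p) v (f := f1) (by simp [IsF]),
      modelT_f (F := F) (p := p) v (f := f2) (by simp [IsF]),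
      modelT_f (F := F) (p := p) v (f := f3) (by simp [IsF]), genF]
    all_goals exact LinearMap.ext fun z => by simp [sub_eq_add_neg]
  rw [h, LinearMap.comp_sub, topCoef_modelT_h, LinearMap.comp_smul, topCoef_mulF_derF]
  fin_cases i <;> simp [wtJ, wt] <;> module

theorem mono_modelRep (v : ℕ → F) {i : Ix} (h1 : -(p : ℤ) ≤ i.k1 ∧ i.k1 < p)
    (h2 : -(p : ℤ) ≤ i.k2 ∧ i.k2 < p) (h3 : -(p : ℤ) ≤ i.k3 ∧ i.k3 < p) :
    mono p (modelRep F p v) (modelY 0) i =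
      modelY ![(i.k1 : ZMod p), (i.k2 : ZMod p), (i.k3 : ZMod p)] i.J := by
  have hp := (Fact.out : p.Prime).pos
  have hr {k : ℤ} (hk : -(p : ℤ) ≤ k ∧ k < p) : rep p k = ((k : ZMod p)).val := by
    rw [← rep_natCast (F := ZMod p) (p := p) hk.1, ZMod.val_natCast_of_lt]
    unfold rep
    split_ifs <;> omega
  rw [modelY_eq, mono, modelRep_f v (by simp [IsF]), modelRep_f v (by simp [IsF]),
    modelRep_f v (by simp [IsF]), hr h1, hr h2, hr h3]
  rfl

theorem topCoef_mono (hp : 5 ≤ p) (v : ℕ → F) {i : Ix} (h1 : -5 ≤ i.k1 ∧ i.k1 ≤ 3)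
    (h2 : -5 ≤ i.k2 ∧ i.k2 ≤ 3) (h3 : -5 ≤ i.k3 ∧ i.k3 ≤ 3) :
    topCoef F p (mono p (modelRep F p v) (modelY 0) i) = if i = topIx then 1 else 0 := by
  have hk {k : ℤ} (hk : -5 ≤ k ∧ k ≤ 3) : (k : ZMod p) = -1 ↔ k = -1 := by
    constructor
    · intro h
      have h0 : ((k + 1 : ℤ) : ZMod p) = 0 := by push_cast; rw [h]; ring
      rw [ZMod.intCast_zmod_eq_zero_iff_dvd] at h0
      have := Int.eq_zero_of_abs_lt_dvd h0 (by rw [abs_lt]; omega)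
      omega
    · rintro rfl
      simp
  rw [mono_modelRep v (by omega) (by omega) (by omega), topCoef_modelY]
  refine if_congr ?_ rfl rfl
  obtain ⟨k1, k2, k3, J⟩ := i
  simp only [Fin.forall_fin_succ, topIx, Ix.mk.injEq]
  simp [hk h1, hk h2, hk h3, and_assoc]

theorem topCoef_monoSpan (v : ℕ → F) {z : Model F p}
    (hz : z ∈ monoSpan (modelRep F p v) (modelY 0) true) : topCoef F p z = 0 := by
  induction hz using Submodule.span_induction with
  | zero => simp
  | add x y _ _ hx hy => rw [map_add, hx, hy, add_zero]
  | smul c x _ hx => rw [map_smul, hx, smul_zero]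
  | mem x hx =>
    obtain ⟨n1, n2, n3, J, hJ, hs, rfl⟩ := hx
    have hJ' : J ≠ [y1, y2, y3, y4] := by
      rintro rfl
      exact absurd hs (by decide)
    have := topCoef_mono_eq_zero (F := F) (p := p) 0 (i := ⟨n1, n2, n3, J⟩) hJ'
    rw [modelRep_f v (by simp [IsF]), modelRep_f v (by simp [IsF]), modelRep_f v (by simp [IsF])]
    simpa [mono, rep] using this

theorem mulF_pow_p_eq (i : Fin 3) : mulF F p i ^ p = 0 :=
  model_ext fun k J => by rw [modelY_mem, mulF_pow_p, LinearMap.zero_apply]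

omit [CharP F p] in
theorem coef_eq_zero_of_mulF {i : Fin 3} {z : Model F p} (hz : mulF F p i z = 0)
    {k : Fin 3 → ZMod p} (hk : k i ≠ -1) (J) : z (k, J) = 0 := by
  have h : Finsupp.lapply (Function.update k i (k i + 1), J) ∘ₗ mulF F p i =
      Finsupp.lapply (R := F) (k, J) := by
    refine model_ext fun k' J' => ?_
    rw [LinearMap.comp_apply, mulF_single]
    by_cases hk' : k' i = -1
    · have : k' ≠ k := by rintro rfl; exact hk hk'
      simp [hk', this]
    · rw [if_neg hk']
      simp only [Finsupp.lapply_apply, Finsupp.single_apply, Prod.mk.injEq]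
      refine if_congr (and_congr_left fun _ => ⟨fun h => ?_, fun h => by rw [h]⟩) rfl rfl
      funext j
      by_cases hj : j = i
      · subst hj
        simpa using congrFun h j
      · simpa [hj] using congrFun h j
  have := LinearMap.congr_fun h z
  rw [LinearMap.comp_apply, hz, map_zero] at this
  exact this.symm

theorem exists_ne_zero_of_pow {M : Type*} [AddCommGroup M] [Module F M] {f : Module.End F M}
    {n : ℕ} (hf : f ^ n = 0) {z : M} (hz : z ≠ 0) : ∃ k, (f ^ k) z ≠ 0 ∧ f ((f ^ k) z) = 0 := by
  by_contra! h
  have : ∀ k, (f ^ k) z ≠ 0 := by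
    intro k
    induction k with
    | zero => simpa using hz
    | succ k ih => rw [pow_succ', Module.End.mul_apply]; exact h k ih
  exact this n (by simp [hf])

theorem topCoef_dual (hp : 5 ≤ p) (v : ℕ → F) {J₀ J : List Gen} (hJ₀ : J₀ ∈ Js) (hJ : J ∈ Js) :
    topCoef F p (((compl J₀).map (modelRep F p v)).prod (modelY (fun _ => -1) J)) = 0 ↔
      J₀ ≠ J := by
  have hc := List.all_eq_true.1 (List.all_eq_true.1 dual_check J₀ hJ₀) J hJ
  simp only [Bool.and_eq_true] at hc
  obtain ⟨⟨hc1, hc2⟩, hc3⟩ := hc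
  have h0 : ev v (mono p (modelRep F p v) (modelY 0)) [⟨1, [], ⟨-1, -1, -1, J⟩⟩] =
      modelY (fun _ => -1) J := by
    rw [ev_cons, ev_nil, mono_modelRep v (by simp; omega) (by simp; omega) (by simp; omega)]
    simp only [Int.cast_one, List.map_nil, List.prod_nil, mul_one, one_smul, add_zero]
    congr 1
    funext i
    fin_cases i <;> simp
  rw [← h0, (modelRep_hasMonomials v).actAll hp _ _ hc1, map_ev, ev_topPart]
  · split_ifs at hc3 with h
    · simp only [h, ne_eq, not_true_eq_false, iff_false]
      intro hz
      rw [Bool.or_eq_true] at hc3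
      subst h
      rcases hc3 with hc3 | hc3 <;> have := ev_eq_zero v (fun _ => (1 : F)) hc3 <;>
        rw [ev_append, hz] at this <;> simp [ev] at this
    · simp only [ne_eq, h, not_false_eq_true, iff_true]
      exact ev_eq_zero v _ hc3
  · intro t ht
    have := List.all_eq_true.1 hc2 t ht
    simp only [Bool.and_eq_true, decide_eq_true_eq] at this
    obtain ⟨⟨⟨⟨⟨⟨_, a1⟩, a2⟩, a3⟩, b1⟩, b2⟩, b3⟩ := this
    exact topCoef_mono hp v ⟨a1, b1⟩ ⟨a2, b2⟩ ⟨a3, b3⟩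

/-- Every nonzero invariant subspace contains a vector in which the lowest monomial occurs:
multiplication by the `f_i` moves a nonzero vector to a nonzero combination of the
`f₁^{p-1} f₂^{p-1} f₃^{p-1} y_J`, and the complementary products of the `y_j` pick a coefficient. -/
theorem exists_topCoef_ne_zero (hp : 5 ≤ p) (v : ℕ → F) {K : Submodule F (Model F p)}
    (hK : ∀ a, ∀ z ∈ K, modelRep F p v a z ∈ K) (h0 : K ≠ ⊥) : ∃ z ∈ K, topCoef F p z ≠ 0 := by
  have hKf (i : Fin 3) (k : ℕ) {z} (hz : z ∈ K) : (mulF F p i ^ k) z ∈ K := by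
    have hf : mulF F p i = modelRep F p v (fG i) := by
      rw [modelRep_f v (by fin_cases i <;> simp [fG, IsF])]
      fin_cases i <;> rfl
    rw [hf]
    induction k with
    | zero => simpa using hz
    | succ k ih => rw [pow_succ', Module.End.mul_apply]; exact hK _ _ ih
  have hcomm (i j : Fin 3) (k : ℕ) (z : Model F p) :
      mulF F p i ((mulF F p j ^ k) z) = (mulF F p j ^ k) (mulF F p i z) :=
    LinearMap.congr_fun ((mulF_comm i j).pow_right k).eq z
  -- a nonzero vector of `K` that is killed by `f₁`, `f₂` and `f₃`
  obtain ⟨z₀, hz₀, hne⟩ := Submodule.exists_mem_ne_zero_of_ne_bot h0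
  obtain ⟨k0, n0, m0⟩ := exists_ne_zero_of_pow (mulF_pow_p_eq (F := F) (p := p) 0) hne
  obtain ⟨k1, n1, m1⟩ := exists_ne_zero_of_pow (mulF_pow_p_eq (F := F) (p := p) 1) n0
  obtain ⟨k2, n2, m2⟩ := exists_ne_zero_of_pow (mulF_pow_p_eq (F := F) (p := p) 2) n1
  have hzK := hKf 2 k2 (hKf 1 k1 (hKf 0 k0 hz₀))
  have a1 : mulF F p 1 ((mulF F p 2 ^ k2) ((mulF F p 1 ^ k1) ((mulF F p 0 ^ k0) z₀))) = 0 := by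
    rw [hcomm, m1, map_zero]
  have a0 : mulF F p 0 ((mulF F p 2 ^ k2) ((mulF F p 1 ^ k1) ((mulF F p 0 ^ k0) z₀))) = 0 := by
    rw [hcomm, hcomm, m0, map_zero, map_zero]
  generalize (mulF F p 2 ^ k2) ((mulF F p 1 ^ k1) ((mulF F p 0 ^ k0) z₀)) = z at *
  have hsupp (k : Fin 3 → ZMod p) (J) (h : z (k, J) ≠ 0) : k = fun _ => -1 := by
    funext i
    by_contra hi
    refine h (coef_eq_zero_of_mulF (i := i) ?_ hi J)
    fin_cases i
    exacts [a0, a1, m2]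
  obtain ⟨⟨k, J₀⟩, hx⟩ := Finsupp.ne_iff.1 n2
  obtain rfl := hsupp k J₀ hx
  refine ⟨((compl J₀).map (modelRep F p v)).prod z, ?_, ?_⟩
  · generalize compl J₀ = ys
    induction ys with
    | nil => simpa using hzK
    | cons y ys ih => rw [List.map_cons, List.prod_cons, Module.End.mul_apply]; exact hK _ _ ih
  · have hsum : z = ∑ J : {J // J ∈ Js}, z (fun _ => -1, J) • modelY (fun _ => -1) J.1 := by
      simp only [← fun J : {J // J ∈ Js} => modelY_mem (F := F) (p := p) (fun _ => -1, J)]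
      ext ⟨k, J⟩
      by_cases hk : k = fun _ => -1
      · subst hk
        simp [Finsupp.finsetSum_apply, Finsupp.single_apply]
      · have : z (k, J) = 0 := by
          by_contra h
          exact hk (hsupp k J h)
        rw [this]
        symm
        simp [Finsupp.finsetSum_apply, Ne.symm hk]
    rw [hsum, map_sum, map_sum, Finset.sum_eq_single J₀]
    · rw [map_smul, map_smul]
      exact mul_ne_zero hx fun h => (topCoef_dual hp v J₀.2 J₀.2).1 h rfl
    · intro J _ hJ
      rw [map_smul, map_smul, (topCoef_dual hp v J₀.2 J.2).2 fun h => hJ (Subtype.ext h.symm),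
        smul_zero]
    · simp


end

/-! ### The baby Verma module -/

section

variable {F : Type*} [Field F]

/-- The operators of the basis elements on the baby Verma module. -/
noncomputable def zRep (p : ℕ) (α : F) (χ : Module.Dual F (gr F 0)) (lam : Fin 3 → F) (a : Gen) :
    Module.End F (BabyVerma p α χ lam) :=
  action p α χ lam (bas F a)

variable {p : ℕ} {α : F} {χ : Module.Dual F (gr F 0)} {lam : Fin 3 → F} {v : ℕ → F}

theorem action_apply (x : Alg F) (z : BabyVerma p α χ lam) :
    action p α χ lam x z = toEnv p α χ x • z := rfl

theorem zRep_apply (a : Gen) (z : BabyVerma p α χ lam) :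
    zRep p α χ lam a z = toEnv p α χ (bas F a) • z := rfl

theorem toEnv_comm (a b : Gen) : toEnv p α χ (bas F a) * toEnv p α χ (bas F b) =
    superSign F (par a) (par b) • (toEnv p α χ (bas F b) * toEnv p α χ (bas F a)) +
      toEnv p α χ (bracket α (bas F a) (bas F b)) := by
  have := RingQuot.mkAlgHom_rel F (Rel.comm (p := p) (α := α) (χ := χ) a b)
  simp only [map_mul, map_add, map_smul] at this
  exact this

theorem toEnv_pow (b : Gen) (hb : par b = 0) : toEnv p α χ (bas F b) ^ p =
    toEnv p α χ (pMap F b) + algebraMap F _ (χ (evenBas F b hb) ^ p) := by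
  have := RingQuot.mkAlgHom_rel F (Rel.pow (p := p) (α := α) (χ := χ) b hb)
  rw [map_pow, map_add, AlgHom.commutes] at this
  exact this

theorem zRep_isRep (hv : v 0 = α) : IsRep v (zRep p α χ lam) := by
  intro a b
  refine LinearMap.ext fun z => ?_
  have h1 : ev v (zRep p α χ lam) (brL a b) = action p α χ lam (bracket α (bas F a) (bas F b)) := by
    rw [← hv, ← ev_brL, map_ev]
    rfl
  rw [h1]
  simp only [Module.End.mul_apply, LinearMap.add_apply, LinearMap.smul_apply, zRep_apply,
    action_apply, ← mul_smul, toEnv_comm a b, superSign_par, add_smul, smul_assoc]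

theorem zRep_pow_apply (a : Gen) (n : ℕ) (z : BabyVerma p α χ lam) :
    (zRep p α χ lam a ^ n) z = toEnv p α χ (bas F a) ^ n • z := by
  induction n with
  | zero => simp
  | succ n ih => rw [pow_succ', Module.End.mul_apply, ih, zRep_apply, ← mul_smul, pow_succ']

theorem zRep_pCenter (b : Gen) (hb : par b = 0) :
    pCenter p (zRep p α χ lam) b = (χ (evenBas F b hb) ^ p) • 1 := by
  refine LinearMap.ext fun z => ?_
  have h : (if b = h1 ∨ b = h2 ∨ b = h3 then zRep p α χ lam b else 0) z =
      toEnv p α χ (pMap F b) • z := by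
    cases b <;> simp [pMap, zRep_apply]
  rw [pCenter, LinearMap.sub_apply, zRep_pow_apply, toEnv_pow b hb, h, add_smul,
    add_sub_cancel_left, algebraMap_smul]
  rfl

theorem zRep_pos {a : Gen} (ha : IsPos a) : zRep p α χ lam a (hwv p α χ lam) = 0 := by
  rw [zRep_apply, hwv, ← map_smul, smul_eq_mul, mul_one, Submodule.mkQ_apply,
    Submodule.Quotient.mk_eq_zero]
  exact Submodule.subset_span (Or.inl ⟨a, ha, rfl⟩)

theorem zRep_h (i : Fin 3) :
    zRep p α χ lam (hG i) (hwv p α χ lam) = lam i • hwv p α χ lam := by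
  have h : toEnv p α χ (bas F (hG i)) - algebraMap F (RedEnv p α χ) (lam i) ∈
      vermaIdeal p α χ lam := Submodule.subset_span (Or.inr ⟨i, rfl⟩)
  have e : lam i • hwv p α χ lam = (vermaIdeal p α χ lam).mkQ (lam i • 1) := rfl
  rw [e, ← Algebra.algebraMap_eq_smul_one, zRep_apply, hwv, ← map_smul, smul_eq_mul, mul_one]
  exact (Submodule.Quotient.eq _).2 h

theorem eq_sum_bas (x : Alg F) : x = ∑ b, x b • bas F b := by
  have := (Pi.basisFun F Gen).sum_repr x
  simpa [bas] using this.symm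

/-- The vector `1 ⊗ v` generates the baby Verma module. -/
theorem eq_top_of_hwv_mem {K : Submodule F (BabyVerma p α χ lam)}
    (hK : ∀ a, ∀ z ∈ K, zRep p α χ lam a z ∈ K) (h0 : hwv p α χ lam ∈ K) : K = ⊤ := by
  have key (t : TensorAlgebra F (Alg F)) :
      ∀ z ∈ K, RingQuot.mkAlgHom F (Rel p α χ) t • z ∈ K := by
    induction t using TensorAlgebra.induction with
    | algebraMap c =>
      intro z hz
      rw [AlgHom.commutes, algebraMap_smul]
      exact K.smul_mem c hz
    | ι x =>
      intro z hz
      have : RingQuot.mkAlgHom F (Rel p α χ) (TensorAlgebra.ι F x) • z =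
          ∑ b, x b • zRep p α χ lam b z := by
        change action p α χ lam x z = _
        conv_lhs => rw [eq_sum_bas x]
        rw [map_sum, LinearMap.sum_apply]
        simp only [map_smul, LinearMap.smul_apply]
        rfl
      rw [this]
      exact sum_mem fun b _ => K.smul_mem _ (hK b z hz)
    | mul s t hs ht =>
      intro z hz
      rw [map_mul, mul_smul]
      exact hs _ (ht z hz)
    | add s t hs ht =>
      intro z hz
      rw [map_add, add_smul]
      exact add_mem (hs z hz) (ht z hz)
  rw [eq_top_iff]
  intro z _
  obtain ⟨y, rfl⟩ := Submodule.mkQ_surjective _ z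
  obtain ⟨t, rfl⟩ := RingQuot.mkAlgHom_surjective F (Rel p α χ) y
  have := key t _ h0
  rwa [hwv, ← map_smul, smul_eq_mul, mul_one] at this

theorem zRep_vermaGr (a : Gen) {i : ZMod 2} {z : BabyVerma p α χ lam}
    (hz : z ∈ vermaGr p α χ lam i) : zRep p α χ lam a z ∈ vermaGr p α χ lam (par a + i) := by
  induction hz using Submodule.span_induction with
  | zero => simp
  | add x y _ _ hx hy => rw [map_add]; exact add_mem hx hy
  | smul c x _ hx => rw [map_smul]; exact Submodule.smul_mem _ c hx
  | mem x hx =>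
    obtain ⟨l, hl, rfl⟩ := hx
    refine Submodule.subset_span ⟨a :: l, by rw [List.map_cons, List.sum_cons, hl], ?_⟩
    rw [zRep_apply, ← mul_smul, List.map_cons, List.prod_cons]

theorem hwv_mem : hwv p α χ lam ∈ vermaGr p α χ lam 0 :=
  Submodule.subset_span ⟨[], by simp, by simp⟩

theorem vermaGr_sup : vermaGr p α χ lam 0 ⊔ vermaGr p α χ lam 1 = ⊤ := by
  refine eq_top_of_hwv_mem (fun a z hz => ?_) (Submodule.mem_sup_left hwv_mem)
  obtain ⟨x, hx, y, hy, rfl⟩ := Submodule.mem_sup.1 hz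
  rw [map_add]
  have hx' := zRep_vermaGr a hx
  have hy' := zRep_vermaGr a hy
  rw [par_eq] at hx' hy'
  cases h : odd a <;> simp only [h] at hx' hy'
  · exact add_mem (Submodule.mem_sup_left (by simpa using hx'))
      (Submodule.mem_sup_right (by simpa using hy'))
  · exact add_mem (Submodule.mem_sup_right (by simpa using hx'))
      (Submodule.mem_sup_left hy')

section Restricted

variable [Fact p.Prime] [CharP F p]

omit [CharP F p] in
theorem lam_pow (hlam : lam ∈ weightSet p χ) (i : Fin 3) :
    lam i ^ p - lam i = χ (hE F i) ^ p := by
  have hp := (Fact.out : p.Prime).ne_zero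
  have := hlam (Pi.single i 1)
  simpa [Pi.single_apply, hp, ite_pow] using this

omit [Fact (Nat.Prime p)] [CharP F p] in
theorem zRep_isHighest (hv : ∀ i : Fin 3, v (i + 1) = lam i)
    (hf : ∀ i, χ (fE F i) ^ p = 0) : IsHighest p v (zRep p α χ lam) (hwv p α χ lam) where
  pos a ha := by
    refine zRep_pos ?_
    simp only [List.mem_cons, List.not_mem_nil, or_false] at ha
    rcases ha with rfl | rfl | rfl | rfl | rfl | rfl | rfl <;> trivial
  h1 := by simpa [hG, ← hv] using zRep_h (p := p) (α := α) (χ := χ) (lam := lam) 0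
  h2 := by simpa [hG, ← hv] using zRep_h (p := p) (α := α) (χ := χ) (lam := lam) 1
  h3 := by simpa [hG, ← hv] using zRep_h (p := p) (α := α) (χ := χ) (lam := lam) 2
  pow f hf' := by
    obtain ⟨i, rfl⟩ : ∃ i, f = fG i := by
      rcases hf' with rfl | rfl | rfl
      exacts [⟨0, rfl⟩, ⟨1, rfl⟩, ⟨2, rfl⟩]
    have := zRep_pCenter (p := p) (α := α) (χ := χ) (lam := lam) (fG i) (par_fG i)
    have e := hf i
    rw [fE] at e
    rw [e] at this
    have := this.trans (zero_smul F (1 : Module.End F (BabyVerma p α χ lam)))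
    rw [pCenter, if_neg (by fin_cases i <;> decide), sub_zero] at this
    rw [this, LinearMap.zero_apply]

theorem modelRep_isHighest (v : ℕ → F) :
    IsHighest p v (modelRep F p v) (modelY 0 []) := by
  have hM := modelRep_hasMonomials (F := F) (p := p) v
  refine ⟨fun a ha => ?_, ?_, ?_, ?_, fun f hf => hM.pow f hf []⟩
  · rw [hM.act_u [] (by decide)]
    simp only [List.mem_cons, List.not_mem_nil, or_false] at ha
    rcases ha with rfl | rfl | rfl | rfl | rfl | rfl | rfl <;> simp [actJ, ev]
  all_goals
    rw [hM.act_u [] (by decide)]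
    simp [actJ, ev, mono, rep]

theorem word_modelY (v : ℕ → F) {J : List Gen} (hJ : J ∈ Js) :
    word (modelRep F p v) (modelY 0 []) J = modelY 0 J := by
  induction J with
  | nil => rfl
  | cons j J ih => rw [word_cons, ih (Js_tail hJ), modelRep_modelY_cons v hJ]

/-- The vector `modelY 0 []` generates the model. -/
theorem model_eq_top_of_mem (v : ℕ → F) {K : Submodule F (Model F p)}
    (hK : ∀ a, ∀ z ∈ K, modelRep F p v a z ∈ K) (h0 : modelY 0 [] ∈ K) : K = ⊤ := by
  have hpow (f : Gen) (hf : IsF f) (n : ℕ) (z) (hz : z ∈ K) : (genF F p f ^ n) z ∈ K := by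
    rw [← modelRep_f v hf]
    induction n with
    | zero => simpa using hz
    | succ n ih => rw [pow_succ', Module.End.mul_apply]; exact hK _ _ ih
  have hw (J : List Gen) : word (modelRep F p v) (modelY 0 []) J ∈ K := by
    induction J with
    | nil => exact h0
    | cons j J ih => rw [word_cons]; exact hK _ _ ih
  rw [eq_top_iff]
  intro z _
  induction z using Finsupp.induction_linear with
  | zero => simp
  | add x y hx hy => exact add_mem (hx trivial) (hy trivial)
  | single x c =>
    rw [← mul_one c, ← smul_eq_mul, ← Finsupp.smul_single, modelY_mem, modelY_eq,
      ← word_modelY v x.2.2]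
    exact K.smul_mem _ (hpow f1 (by simp [IsF]) _ _ (hpow f2 (by simp [IsF]) _ _
      (hpow f3 (by simp [IsF]) _ _ (hw _))))

theorem modelRep_pCenter (hp : 5 ≤ p) (hv : ∀ i : Fin 3, v (i + 1) ^ p = v (i + 1)) {b : Gen}
    (hb : odd b = false) : pCenter p (modelRep F p v) b = 0 := by
  have hM := modelRep_isHighest (p := p) v
  have hR := modelRep_isRep (F := F) hp v
  have hp0 := (Fact.out : p.Prime).ne_zero
  have : LinearMap.ker (pCenter p (modelRep F p v) b) = ⊤ := by
    refine model_eq_top_of_mem v (fun a z hz => ?_) ?_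
    · rw [LinearMap.mem_ker] at hz ⊢
      rw [← Module.End.mul_apply, ← (hR.pCenter_comm hb a).eq, Module.End.mul_apply, hz, map_zero]
    · have pos {a : Gen} (ha : a ∈ [e1, e2, e3, x1, x2, x3, x4]) :
          (modelRep F p v a ^ p) (modelY 0 []) = 0 := by
        have e : modelRep F p v a ^ p = modelRep F p v a ^ (p - 1) * modelRep F p v a := by
          rw [← pow_succ, Nat.sub_add_cancel (Nat.one_le_iff_ne_zero.2 hp0)]
        rw [e, Module.End.mul_apply, hM.pos a ha, map_zero]
      have car {h : Gen} {c : F} (hh : modelRep F p v h (modelY 0 []) = c • modelY 0 [])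
          (hc : c ^ p = c) : (modelRep F p v h ^ p - modelRep F p v h) (modelY 0 []) = 0 := by
        have : ∀ n : ℕ, (modelRep F p v h ^ n) (modelY 0 []) = c ^ n • modelY 0 [] := by
          intro n
          induction n with
          | zero => simp
          | succ n ih => rw [pow_succ', Module.End.mul_apply, ih, map_smul, hh, smul_smul, pow_succ]
        rw [LinearMap.sub_apply, this, hh, hc, sub_self]
      rw [LinearMap.mem_ker]
      cases b
      case h1 => simpa [pCenter] using car hM.h1 (hv 0)
      case h2 => simpa [pCenter] using car hM.h2 (hv 1)
      case h3 => simpa [pCenter] using car hM.h3 (hv 2)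
      case e1 => simpa [pCenter] using pos (a := e1) (by simp)
      case e2 => simpa [pCenter] using pos (a := e2) (by simp)
      case e3 => simpa [pCenter] using pos (a := e3) (by simp)
      case f1 => simpa [pCenter] using hM.pow f1 (by simp [IsF])
      case f2 => simpa [pCenter] using hM.pow f2 (by simp [IsF])
      case f3 => simpa [pCenter] using hM.pow f3 (by simp [IsF])
      all_goals exact absurd hb (by decide)
  exact LinearMap.ker_eq_top.1 this

theorem odd_eq_false {b : Gen} (hb : par b = 0) : odd b = false := by
  cases b <;> first | rfl | exact absurd hb (by decide)

/-- The action of the reduced enveloping algebra on the model. -/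
theorem exists_envHom (hp : 5 ≤ p) (hv0 : v 0 = α) (hv : ∀ i : Fin 3, v (i + 1) ^ p = v (i + 1))
    (hχ : ∀ b hb, χ (evenBas F b hb) ^ p = 0) :
    ∃ Φ : RedEnv p α χ →ₐ[F] Module.End F (Model F p),
      ∀ a, Φ (toEnv p α χ (bas F a)) = modelRep F p v a := by
  have hR := modelRep_isRep (F := F) hp v
  let L : Alg F →ₗ[F] Module.End F (Model F p) := (Pi.basisFun F Gen).constr F (modelRep F p v)
  have hL (a : Gen) : L (bas F a) = modelRep F p v a := by
    have : bas F a = Pi.basisFun F Gen a := by simp [bas]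
    rw [this, Module.Basis.constr_basis]
  have hrel : ∀ ⦃x y⦄, Rel p α χ x y → TensorAlgebra.lift F L x = TensorAlgebra.lift F L y := by
    intro x y h
    induction h with
    | comm a b =>
      have hb : L (bracket α (bas F a) (bas F b)) = ev v (modelRep F p v) (brL a b) := by
        rw [← hv0, ← ev_brL]
        refine (map_ev (M := Alg F) (N := Module.End F (Model F p)) L v _ _).trans ?_
        simp only [hL]
      simp only [map_mul, map_add, map_smul, TensorAlgebra.lift_ι_apply, hL, hb, superSign_par]
      exact hR a b
    | pow b hb =>
      have h0 := modelRep_pCenter hp hv (odd_eq_false hb)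
      have hm : L (pMap F b) = if b = h1 ∨ b = h2 ∨ b = h3 then modelRep F p v b else 0 := by
        cases b <;> simp [pMap, hL]
      simp only [map_pow, TensorAlgebra.lift_ι_apply, hL, hm, hχ b hb, map_zero, add_zero]
      exact sub_eq_zero.1 h0
  refine ⟨RingQuot.liftAlgHom F ⟨TensorAlgebra.lift F L, hrel⟩, fun a => ?_⟩
  rw [← hL, toEnv, LinearMap.comp_apply, AlgHom.toLinearMap_apply,
    RingQuot.liftAlgHom_mkAlgHom_apply, TensorAlgebra.lift_ι_apply]

/-- The baby Verma module is isomorphic to the model: it maps onto the model, and it is spanned by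
as many monomials as the model has basis vectors. -/
theorem exists_equiv_model (hp : 5 ≤ p) (hv0 : v 0 = α) (hv : ∀ i : Fin 3, v (i + 1) = lam i)
    (hlam : lam ∈ weightSet p χ) (hχ : ∀ b hb, χ (evenBas F b hb) ^ p = 0) :
    ∃ P : BabyVerma p α χ lam ≃ₗ[F] Model F p,
      (∀ a z, P (zRep p α χ lam a z) = modelRep F p v a (P z)) ∧
        P (hwv p α χ lam) = modelY 0 [] := by
  have hv' (i : Fin 3) : v (i + 1) ^ p = v (i + 1) := by
    rw [hv, ← sub_eq_zero, lam_pow hlam]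
    exact hχ _ (par_hG i)
  have hM := modelRep_isHighest (p := p) v
  obtain ⟨Φ, hΦ⟩ := exists_envHom hp hv0 hv' hχ
  let L : RedEnv p α χ →ₗ[F] Model F p := LinearMap.applyₗ (modelY 0 []) ∘ₗ Φ.toLinearMap
  have hL (y) : L y = Φ y (modelY 0 []) := rfl
  have hker : (vermaIdeal p α χ lam).restrictScalars F ≤ LinearMap.ker L := by
    intro y hy
    rw [Submodule.restrictScalars_mem] at hy
    rw [LinearMap.mem_ker, hL]
    induction hy using Submodule.span_induction with
    | zero => simp
    | add x y _ _ hx hy => rw [map_add, LinearMap.add_apply, hx, hy, add_zero]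
    | smul c x _ hx => rw [smul_eq_mul, map_mul, Module.End.mul_apply, hx, map_zero]
    | mem x hx =>
      rcases hx with ⟨b, hb, rfl⟩ | ⟨i, rfl⟩
      · rw [hΦ]
        refine hM.pos b ?_
        cases b <;> first | exact hb.elim | simp
      · rw [map_sub, LinearMap.sub_apply, hΦ, AlgHom.commutes, sub_eq_zero,
          Module.algebraMap_end_apply, ← hv i]
        fin_cases i
        exacts [hM.h1, hM.h2, hM.h3]
  let P : BabyVerma p α χ lam →ₗ[F] Model F p :=
    (((vermaIdeal p α χ lam).restrictScalars F).liftQ L hker) ∘ₗ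
      (Submodule.Quotient.restrictScalarsEquiv F (vermaIdeal p α χ lam)).symm.toLinearMap
  have hP (y) : P ((vermaIdeal p α χ lam).mkQ y) = Φ y (modelY 0 []) := rfl
  have hPa (a z) : P (zRep p α χ lam a z) = modelRep F p v a (P z) := by
    obtain ⟨y, rfl⟩ := Submodule.mkQ_surjective _ z
    rw [zRep_apply, ← map_smul, hP, smul_eq_mul, map_mul, hΦ, hP, Module.End.mul_apply]
  have hP0 : P (hwv p α χ lam) = modelY 0 [] := by
    rw [hwv, hP, map_one, Module.End.one_apply]
  have hsurj : Function.Surjective P := by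
    rw [← LinearMap.range_eq_top]
    refine model_eq_top_of_mem v ?_ ⟨_, hP0⟩
    rintro a _ ⟨z, rfl⟩
    exact ⟨_, hPa a z⟩
  have hmon := (zRep_isRep (p := p) (χ := χ) (lam := lam) hv0).hasMonomials hp
    (zRep_isHighest hv fun i => hχ _ (par_fG i))
  have htop := eq_top_of_hwv_mem (fun a z hz => hmon.apply_mem_sup a hz) (Submodule.mem_sup_left
    (Submodule.subset_span ⟨0, 0, 0, [], by decide, rfl, by simp [word]⟩))
  obtain ⟨hfin, hle⟩ := hmon.finite_sup
  rw [htop] at hfin hle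
  have : FiniteDimensional F (BabyVerma p α χ lam) :=
    Module.Finite.equiv (Submodule.topEquiv (R := F) (M := BabyVerma p α χ lam))
  rw [finrank_top] at hle
  have hge := LinearMap.finrank_le_finrank_of_surjective hsurj
  have heq : Module.finrank F (BabyVerma p α χ lam) = Module.finrank F (Model F p) := by
    refine le_antisymm ?_ hge
    rwa [Module.finrank_finsupp_self]
  exact ⟨LinearEquiv.ofBijective P
    ⟨(LinearMap.injective_iff_surjective_of_finrank_eq_finrank heq).2 hsurj, hsurj⟩, hPa, hP0⟩

end Restricted

end

/-! ### Cocycles and extensions -/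

section

variable {F M : Type*} [Field F] [AddCommGroup M] [Module F M]
variable {p : ℕ} {v : ℕ → F} {r : Gen → Module.End F M} {φ : Gen → M}

/-- A `1`-cocycle with values in `M`, given on the basis and without regard to parities: for a
derivation `D` of parity `i` the values `(-1)^{i|a|} D a` form such a cocycle. -/
def Cocycle (v : ℕ → F) (r : Gen → Module.End F M) (φ : Gen → M) : Prop :=
  ∀ a b, ev v φ (brL a b) = r a (φ b) - (sgn a b : F) • r b (φ a)

theorem mon_brL_check : (gens.all fun a => gens.all fun b => (brL a b).all fun t =>
    t.mon.all fun n => n == 0) = true := by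
  decide +kernel

/-- The structure constants involve the variable `X₀` only. -/
theorem ev_brL_congr {N : Type*} [AddCommGroup N] [Module F N] {v v' : ℕ → F} (h : v 0 = v' 0)
    (g : Gen → N) (a b : Gen) : ev v g (brL a b) = ev v' g (brL a b) := by
  have hc := List.all_eq_true.1 (List.all_eq_true.1 (List.all_eq_true.1 mon_brL_check a
    (mem_gens a)) b (mem_gens b))
  unfold ev
  congr 1
  refine List.map_congr_left fun t ht => ?_
  have : t.mon.map v = t.mon.map v' := List.map_congr_left fun n hn => by
    rw [beq_iff_eq.1 (List.all_eq_true.1 (hc t ht) n hn), h]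
  rw [this]

/-- The extension of the trivial module by `M` that belongs to a cocycle. -/
noncomputable def extRep (r : Gen → Module.End F M) (φ : Gen → M) (a : Gen) :
    Module.End F (M × F) :=
  (r a ∘ₗ LinearMap.fst F M F + (LinearMap.toSpanSingleton F M (φ a)) ∘ₗ
    LinearMap.snd F M F).prod 0

theorem extRep_apply (a : Gen) (z : M) (s : F) :
    extRep r φ a (z, s) = (r a z + s • φ a, 0) := by
  simp [extRep]

theorem ev_extRep (l : Comb Gen) (z : M) (s : F) :
    ev v (extRep r φ) l (z, s) = (ev v r l z + s • ev v φ l, 0) := by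
  rw [ev_apply, ev_apply]
  induction l with
  | nil => simp [ev]; rfl
  | cons t l ih =>
    rw [ev_cons, ev_cons, ev_cons, ih, extRep_apply]
    refine Prod.ext ?_ (by simp)
    simp only [Prod.fst_add, Prod.smul_fst]
    module

theorem extRep_rel (h : IsRep v r) {a b : Gen}
    (hφ : ev v φ (brL a b) = r a (φ b) - (sgn a b : F) • r b (φ a)) :
    extRep r φ a * extRep r φ b =
      (sgn a b : F) • (extRep r φ b * extRep r φ a) + ev v (extRep r φ) (brL a b) := by
  refine LinearMap.ext fun x => ?_
  obtain ⟨z, s⟩ := x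
  have h1 := LinearMap.congr_fun (h a b) z
  simp only [Module.End.mul_apply, LinearMap.add_apply, LinearMap.smul_apply] at h1 ⊢
  rw [ev_extRep, hφ]
  simp only [extRep_apply, map_add, map_smul, h1]
  refine Prod.ext ?_ (by simp)
  simp only [Prod.fst_add, Prod.smul_fst]
  module

theorem extRep_isRep (h : IsRep v r) (hφ : Cocycle v r φ) : IsRep v (extRep r φ) :=
  fun a b => extRep_rel h (hφ a b)

theorem cocycle_of_isRep (h : IsRep v (extRep r φ)) : Cocycle v r φ := by
  intro a b
  have h1 := congrArg Prod.fst (LinearMap.congr_fun (h a b) ((0 : M), (1 : F)))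
  simp only [Module.End.mul_apply, LinearMap.add_apply, LinearMap.smul_apply, extRep_apply,
    ev_extRep, map_zero, zero_add, one_smul, zero_smul, add_zero, Prod.fst_add,
    Prod.smul_fst] at h1
  rw [h1]
  abel

theorem extRep_pow_succ (a : Gen) (n : ℕ) (z : M) (s : F) :
    (extRep r φ a ^ (n + 1)) (z, s) = ((r a ^ (n + 1)) z + s • (r a ^ n) (φ a), 0) := by
  induction n with
  | zero => simp [extRep_apply]
  | succ n ih =>
    rw [pow_succ', Module.End.mul_apply, ih, extRep_apply, pow_succ' (r a) (n + 1),
      Module.End.mul_apply, map_add, map_smul, pow_succ' (r a) n, Module.End.mul_apply]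
    simp

/-- The value of `b^p - b^{[p]}` on the vector `(0, 1)` of the extension. -/
def centerVec (p : ℕ) (r : Gen → Module.End F M) (φ : Gen → M) (b : Gen) : M :=
  (r b ^ (p - 1)) (φ b) - if b = h1 ∨ b = h2 ∨ b = h3 then φ b else 0

theorem pCenter_extRep (hp : p ≠ 0) (b : Gen) (z : M) (s : F) :
    pCenter p (extRep r φ) b (z, s) = (pCenter p r b z + s • centerVec p r φ b, 0) := by
  obtain ⟨n, rfl⟩ := Nat.exists_eq_succ_of_ne_zero hp
  rw [pCenter, pCenter, centerVec, LinearMap.sub_apply, extRep_pow_succ]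
  refine Prod.ext ?_ ?_
  · split_ifs
    · simp [extRep_apply]
      module
    · simp
  · split_ifs <;> simp [extRep_apply]

/-- As `b^p - b^{[p]}` is central, it commutes with the action of `a` on the vector `(0, 1)`. -/
theorem Cocycle.apply_centerVec [CharP F p] [Fact p.Prime] (hφ : Cocycle v r φ) (h : IsRep v r)
    {b : Gen} (hb : odd b = false) (a : Gen) : r a (centerVec p r φ b) = pCenter p r b (φ a) := by
  have hp := (Fact.out : p.Prime).ne_zero
  have := LinearMap.congr_fun ((extRep_isRep h hφ).pCenter_comm hb a).eq ((0 : M), (1 : F))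
  rw [Module.End.mul_apply, Module.End.mul_apply, pCenter_extRep hp, extRep_apply, extRep_apply,
    pCenter_extRep hp] at this
  simpa using congrArg Prod.fst this

theorem Cocycle.sub_inner (hφ : Cocycle v r φ) (h : IsRep v r) (m : M) :
    Cocycle v r fun a => φ a - r a m := by
  intro a b
  have h1 := LinearMap.congr_fun (h a b) m
  simp only [Module.End.mul_apply, LinearMap.add_apply, LinearMap.smul_apply, ev_apply] at h1
  have h2 := ev_add_smul v (-1) (fun a => r a m) φ (brL a b)
  have h3 : (fun a => φ a - r a m) = fun a => (-1 : F) • r a m + φ a := by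
    funext a
    module
  rw [h3, h2, hφ a b]
  simp only [map_add, map_smul, h1]
  module

/-- The coefficient in the dual representation: `-1` on the even part and a square root of `-1`
on the odd part, so that no signs depending on the parity of functionals are needed. -/
def dualSign (c : F) (a : Gen) : F := if odd a then c else -1

/-- The dual representation. -/
noncomputable def dualRep (c : F) (r : Gen → Module.End F M) (a : Gen) :
    Module.End F (Module.Dual F M) :=
  dualSign c a • Module.Dual.transpose (r a)

theorem dualRep_apply (c : F) (a : Gen) (f : Module.Dual F M) (z : M) :
    dualRep c r a f z = dualSign c a * f (r a z) := by
  rfl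

theorem dualRep_isRep {c : F} (hc : c * c = -1) (h : IsRep v r) : IsRep v (dualRep c r) := by
  intro a b
  refine LinearMap.ext fun f => LinearMap.ext fun z => ?_
  have h1 := congrArg f (LinearMap.congr_fun (h b a) z)
  have h2 : ev v (dualRep c r) (brL a b) f z =
      (if odd a ^^ odd b then c else -1) * f (ev v r (brL a b) z) := by
    rw [ev_apply, ev_apply, map_ev, ← smul_eq_mul]
    have := map_ev (LinearMap.applyₗ z) v (fun k => dualRep c r k f) (brL a b)
    simp only [LinearMap.applyₗ_apply_apply] at this
    rw [this, ← LinearMap.lsmul_apply, map_ev]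
    refine ev_congr v fun t ht => ?_
    rw [dualRep_apply, dualSign, odd_brL t ht]
    rfl
  simp only [Module.End.mul_apply, LinearMap.add_apply, LinearMap.smul_apply, h2, dualRep_apply]
  rw [Module.End.mul_apply, ev_brL_swap _ b a] at h1
  simp only [LinearMap.add_apply, LinearMap.smul_apply, Module.End.mul_apply, map_add, map_smul,
    LinearMap.neg_apply, map_neg, smul_eq_mul] at h1
  rw [h1, sgn]
  unfold dualSign sgn
  cases odd a <;> cases odd b <;> simp
  · ring
  · ring
  · linear_combination hc * f (ev v r (brL a b) z)

/-- The elements `e₂`, `e₃` and `x₄` generate `n⁺`. -/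
theorem eq_zero_of_pos {c : Gen → M} (h2 : (2 : F) ≠ 0) (hα : v 0 ≠ -1)
    (hc : ∀ a b, a ∈ [e1, e2, e3, x1, x2, x3, x4] → b ∈ [e1, e2, e3, x1, x2, x3, x4] →
      c a = 0 → c b = 0 → ev v c (brL a b) = 0)
    (h0 : ∀ a ∈ [e2, e3, x4], c a = 0) : ∀ a ∈ [e1, e2, e3, x1, x2, x3, x4], c a = 0 := by
  simp only [List.mem_cons, List.not_mem_nil, or_false, forall_eq_or_imp, forall_eq] at h0 ⊢
  obtain ⟨k1, k2, k3⟩ := h0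
  have k4 := hc e2 x4 (by simp) (by simp) k1 k3
  have k5 := hc e3 x4 (by simp) (by simp) k2 k3
  simp [brL, halfL, sgn, odd, scale, mulMon, ev] at k4 k5
  have k6 := hc e2 x3 (by simp) (by simp) k1 k5
  simp [brL, halfL, sgn, odd, scale, mulMon, ev] at k6
  have k7 := hc x1 x4 (by simp) (by simp) k6 k3
  simp [brL, halfL, sgn, odd, scale, mulMon, ev] at k7
  have k8 : (2 * (1 + v 0)) • c e1 = 0 := by
    rw [← k7]
    module
  have hne : 2 * (1 + v 0) ≠ 0 := mul_ne_zero h2 fun h => hα (by linear_combination h)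
  exact ⟨(smul_eq_zero.1 k8).resolve_left hne, k1, k2, k6, k4, k5, k3⟩

/-! ### Modules with a functional like the coefficient of the lowest monomial -/

/-- A representation of the dimension of a baby Verma module with trivial `p`-character, together
with a linear form `δ` of weight `μ` that vanishes on `n⁺ M` and on no nonzero submodule. -/
structure IsTopForm (p : ℕ) [Fact p.Prime] (v : ℕ → F) (μ : Fin 3 → F) (r : Gen → Module.End F M)
    (δ : M →ₗ[F] F) : Prop where
  isRep : IsRep v r
  pos : ∀ a ∈ [e1, e2, e3, x1, x2, x3, x4], ∀ z, δ (r a z) = 0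
  wt : ∀ i z, δ (r (hG i) z) = μ i * δ z
  center : ∀ b, odd b = false → pCenter p r b = 0
  socle : ∀ K : Submodule F M, (∀ a, ∀ z ∈ K, r a z ∈ K) → (∀ z ∈ K, δ z = 0) → K = ⊥
  finite : FiniteDimensional F M
  finrank : Module.finrank F M = Fintype.card (Lab p)
  surj : ∃ z, δ z = 1

variable [Fact p.Prime] {μ : Fin 3 → F} {δ : M →ₗ[F] F}

/-- If `δ`, extended by zero, is still a highest weight vector in the dual of the extension, then
the submodule of the dual that it generates is not larger than the dual of `M`; so it is killed by
a vector outside `M`, and this vector splits the extension. -/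
theorem IsTopForm.exists_inner_of_highest [CharP F p] [IsAlgClosed F]
    (h : IsTopForm p v μ r δ) (hp : 5 ≤ p) (hφ : Cocycle v r φ)
    (hpos : ∀ a ∈ [e1, e2, e3, x1, x2, x3, x4], δ (φ a) = 0) (hh : ∀ i, δ (φ (hG i)) = 0)
    (hf : ∀ f, IsF f → δ ((r f ^ (p - 1)) (φ f)) = 0) : ∃ m, ∀ a, φ a = r a m := by
  -- the square root of `-1` for the signs in the dual representation
  obtain ⟨c, hc⟩ := IsAlgClosed.exists_pow_nat_eq (-1 : F) (n := 2) (by norm_num)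
  rw [sq] at hc
  have hc0 : c ≠ 0 := by
    rintro rfl
    simp at hc
  have := h.finite
  have hE := extRep_isRep h.isRep hφ
  let v' : ℕ → F := fun n => if n = 0 then v 0 else if n = 1 then -μ 0 else if n = 2 then -μ 1
    else -μ 2
  have hA : IsRep v' (dualRep c (extRep r φ)) := fun a b => by
    rw [dualRep_isRep hc hE a b, ev_brL_congr (v := v) (v' := v') rfl]
  -- `δ`, extended by zero, is a highest weight vector of weight `-μ`
  let d : Module.Dual F (M × F) := δ ∘ₗ LinearMap.fst F M F
  have hd (z s) : d (z, s) = δ z := rfl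
  have hdual (a z s) : dualRep c (extRep r φ) a d (z, s) =
      dualSign c a * (δ (r a z) + s * δ (φ a)) := by
    rw [dualRep_apply, extRep_apply, hd, map_add, map_smul, smul_eq_mul]
  have hdh (i : Fin 3) : dualRep c (extRep r φ) (hG i) d = (-μ i) • d := by
    refine LinearMap.ext fun x => ?_
    obtain ⟨z, s⟩ := x
    rw [hdual, h.wt, hh, mul_zero, add_zero, LinearMap.smul_apply, hd, dualSign,
      if_neg (by fin_cases i <;> simp [hG, odd])]
    simp
  have hhigh : IsHighest p v' (dualRep c (extRep r φ)) d := by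
    refine ⟨fun a ha => LinearMap.ext fun x => ?_, hdh 0, hdh 1, hdh 2, fun f hf' => ?_⟩
    · obtain ⟨z, s⟩ := x
      rw [hdual, h.pos a ha, hpos a ha]
      simp
    · have hpow (n : ℕ) (g : Module.Dual F (M × F)) (x : M × F) :
          (dualRep c (extRep r φ) f ^ n) g x = dualSign c f ^ n * g ((extRep r φ f ^ n) x) := by
        induction n generalizing x with
        | zero => simp
        | succ n ih =>
          rw [pow_succ', Module.End.mul_apply, dualRep_apply, ih, pow_succ (extRep r φ f),
            Module.End.mul_apply]
          ring
      refine LinearMap.ext fun x => ?_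
      obtain ⟨z, s⟩ := x
      have h0 := h.center f (by rcases hf' with rfl | rfl | rfl <;> rfl)
      have e : pCenter p r f = r f ^ p := by
        rcases hf' with rfl | rfl | rfl <;> simp [pCenter]
      obtain ⟨n, rfl⟩ : ∃ n, p = n + 1 := ⟨p - 1, by omega⟩
      rw [hpow, extRep_pow_succ, ← e, h0, hd]
      have := hf f hf'
      rw [Nat.add_sub_cancel] at this
      simp [this]
  have hmon := hA.hasMonomials hp hhigh
  obtain ⟨hfin, hle⟩ := hmon.finite_sup
  have hinv := fun a (x : Module.Dual F (M × F)) => hmon.apply_mem_sup a (x := x)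
  have hdU : d ∈ monoSpan (dualRep c (extRep r φ)) (word (dualRep c (extRep r φ)) d) false ⊔
      monoSpan (dualRep c (extRep r φ)) (word (dualRep c (extRep r φ)) d) true :=
    Submodule.mem_sup_left (Submodule.subset_span ⟨0, 0, 0, [], by decide, rfl, by simp [word]⟩)
  -- `U` is the submodule generated by `δ`, and the vectors that it kills form a submodule
  generalize monoSpan (dualRep c (extRep r φ)) (word (dualRep c (extRep r φ)) d) false ⊔
    monoSpan (dualRep c (extRep r φ)) (word (dualRep c (extRep r φ)) d) true = U at *
  have hK : ∀ a, ∀ x ∈ U.dualCoannihilator, extRep r φ a x ∈ U.dualCoannihilator := by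
    intro a x hx
    rw [Submodule.mem_dualCoannihilator] at hx ⊢
    intro g hg
    have := hx _ (hinv a g hg)
    rw [dualRep_apply] at this
    refine (mul_eq_zero.1 this).resolve_left ?_
    unfold dualSign
    split_ifs
    · exact hc0
    · simp
  -- the common kernel meets `M` trivially, as `δ` vanishes on the intersection
  have hK1 : U.dualCoannihilator.comap (LinearMap.inl F M F) = ⊥ := by
    refine h.socle _ (fun a z hz => ?_) fun z hz => ?_
    · have := hK a _ hz
      rw [LinearMap.inl_apply, extRep_apply] at this
      simpa using this
    · have := (Submodule.mem_dualCoannihilator _).1 hz _ hdU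
      exact this
  -- `U` has at most the dimension of `M`, which is less than that of the extension
  have hne : U.dualCoannihilator ≠ ⊥ := by
    intro h0
    have := Subspace.finrank_add_finrank_dualCoannihilator_eq U
    rw [h0, finrank_bot, Module.finrank_prod, Module.finrank_self, h.finrank] at this
    omega
  obtain ⟨⟨z, s⟩, hx, hx0⟩ := Submodule.exists_mem_ne_zero_of_ne_bot hne
  have hs : s ≠ 0 := by
    rintro rfl
    have : z ∈ U.dualCoannihilator.comap (LinearMap.inl F M F) := hx
    rw [hK1, Submodule.mem_bot] at this
    exact hx0 (by rw [this]; rfl)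
  refine ⟨-(s⁻¹ • z), fun a => ?_⟩
  have h1 := hK a _ hx
  rw [extRep_apply] at h1
  have h2 : r a z + s • φ a ∈ U.dualCoannihilator.comap (LinearMap.inl F M F) := h1
  rw [hK1, Submodule.mem_bot] at h2
  rw [map_neg, map_smul, eq_neg_iff_add_eq_zero, ← smul_right_injective M hs |>.eq_iff, smul_zero,
    smul_add, smul_smul, mul_inv_cancel₀ hs, one_smul, add_comm, h2]

/-- As `e₂`, `e₃` and `x₄` generate `n⁺`, they control `δ ∘ φ` on `n⁺`. -/
theorem IsTopForm.pos_eq_zero (h : IsTopForm p v μ r δ) (hφ : Cocycle v r φ)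
    (h2 : (2 : F) ≠ 0) (hα : v 0 ≠ -1)
    (h0 : ∀ a ∈ [e2, e3, x4], δ (φ a) = 0) :
    ∀ a ∈ [e1, e2, e3, x1, x2, x3, x4], δ (φ a) = 0 :=
  eq_zero_of_pos (v := v) (c := fun g => δ (φ g)) h2 hα (fun a b ha hb _ _ => by
    rw [← map_ev, hφ a b, map_sub, map_smul, h.pos a ha, h.pos b hb]
    simp) h0

/-- The weight of a nonzero value of `δ ∘ φ` on a positive root vector. -/
theorem IsTopForm.wt_eq (h : IsTopForm p v μ r δ) (hφ : Cocycle v r φ) {a : Gen}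
    (ha : a ∈ [e2, e3, x4]) (h0 : δ (φ a) ≠ 0) (i : Fin 3) : μ i = (D21.wt a i : F) := by
  have hp : a ∈ [e1, e2, e3, x1, x2, x3, x4] := by
    simp only [List.mem_cons, List.not_mem_nil, or_false] at ha ⊢
    tauto
  have h1 := congrArg δ (hφ (hG i) a)
  rw [map_sub, map_smul, h.wt, h.pos a hp, smul_zero, sub_zero, map_ev] at h1
  have h2 : ev v (fun g => δ (φ g)) (brL (hG i) a) = (D21.wt a i : F) * δ (φ a) := by
    simp only [List.mem_cons, List.not_mem_nil, or_false] at ha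
    rcases ha with rfl | rfl | rfl <;> fin_cases i <;>
      simp [brL, halfL, sgn, odd, scale, mulMon, ev, D21.wt, hG]
  rw [h2] at h1
  exact (mul_right_cancel₀ h0 h1).symm

/-- The vectors `f^{p-1} φ(f)` are invariants, so that `δ` vanishes on them unless it has weight
zero. -/
theorem IsTopForm.form_f [CharP F p] (h : IsTopForm p v μ r δ) (hφ : Cocycle v r φ)
    {f : Gen} (hf : IsF f) (hμ : μ ≠ 0) : δ ((r f ^ (p - 1)) (φ f)) = 0 := by
  obtain ⟨i, hi⟩ := Function.ne_iff.1 hμ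
  have hb : odd f = false := by rcases hf with rfl | rfl | rfl <;> rfl
  have h1 := hφ.apply_centerVec h.isRep hb (hG i)
  have e : centerVec p r φ f = (r f ^ (p - 1)) (φ f) := by
    rcases hf with rfl | rfl | rfl <;> simp [centerVec]
  rw [e, h.center f hb, LinearMap.zero_apply] at h1
  have h2 := congrArg δ h1
  rw [h.wt, map_zero] at h2
  exact (mul_eq_zero.1 h2).resolve_left hi

omit [Fact p.Prime] in
theorem two_ne_zero_of_le [CharP F p] (hp : 5 ≤ p) : (2 : F) ≠ 0 := by
  intro h0
  have : ((2 : ℕ) : F) = 0 := by exact_mod_cast h0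
  rw [CharP.cast_eq_zero_iff F p] at this
  have := Nat.le_of_dvd (by norm_num) this
  omega

/-- The criterion for a cocycle to be inner when `δ` has a nonzero weight. -/
theorem IsTopForm.exists_inner_of_ne [CharP F p] [IsAlgClosed F]
    (h : IsTopForm p v μ r δ) (hp : 5 ≤ p) (hφ : Cocycle v r φ) (hα : v 0 ≠ -1) (hμ : μ ≠ 0)
    (h0 : ∀ a ∈ [e2, e3, x4], δ (φ a) = 0) : ∃ m, ∀ a, φ a = r a m := by
  have h2 : (2 : F) ≠ 0 := two_ne_zero_of_le hp
  obtain ⟨j, hj⟩ := Function.ne_iff.1 hμ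
  obtain ⟨z, hz⟩ := h.surj
  -- an inner cocycle is subtracted to make `δ (φ h_j)`, and with it all `δ (φ h_i)`, vanish
  have hm : δ ((δ (φ (hG j)) / μ j) • z) = δ (φ (hG j)) / μ j := by simp [hz]
  generalize (δ (φ (hG j)) / μ j) • z = m at hm
  have hφ' := hφ.sub_inner h.isRep m
  have hij (i : Fin 3) : μ j * δ (φ (hG i)) = μ i * δ (φ (hG j)) := by
    have h1 := congrArg δ (hφ (hG j) (hG i))
    have hs : sgn (hG j) (hG i) = 1 := by fin_cases i <;> fin_cases j <;> rfl
    have hn : ev v φ (brL (hG j) (hG i)) = 0 := by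
      fin_cases i <;> fin_cases j <;> simp [brL, halfL, sgn, odd, scale, mulMon, ev, D21.wt, hG]
    rw [hn, map_zero, map_sub, map_smul, h.wt, h.wt, hs, Int.cast_one, one_smul] at h1
    linear_combination -h1
  obtain ⟨m', hm'⟩ := h.exists_inner_of_highest hp hφ'
    (h.pos_eq_zero hφ' h2 hα fun a ha => by
      have hpa : a ∈ [e1, e2, e3, x1, x2, x3, x4] := by
        simp only [List.mem_cons, List.not_mem_nil, or_false] at ha ⊢
        tauto
      rw [map_sub, h0 a ha, h.pos a hpa, sub_zero])
    (fun i => by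
      have hj' : μ j ≠ 0 := hj
      rw [map_sub, h.wt, hm]
      field_simp
      linear_combination hij i)
    fun f hf => h.form_f hφ' hf hμ
  exact ⟨m + m', fun a => by rw [map_add, ← hm' a]; abel⟩

/-- The criterion for a cocycle to be inner when `δ` has weight zero. -/
theorem IsTopForm.exists_inner_of_eq_zero [CharP F p] [IsAlgClosed F]
    (h : IsTopForm p v μ r δ) (hp : 5 ≤ p) (hφ : Cocycle v r φ) (hα : v 0 ≠ -1) (hμ : μ = 0)
    (hh : ∀ i, δ (φ (hG i)) = 0) (hf : ∀ f, IsF f → δ ((r f ^ (p - 1)) (φ f)) = 0) :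
    ∃ m, ∀ a, φ a = r a m := by
  have h2 : (2 : F) ≠ 0 := two_ne_zero_of_le hp
  refine h.exists_inner_of_highest hp hφ (h.pos_eq_zero hφ h2 hα fun a ha => ?_) hh hf
  by_contra h0
  have key := h.wt_eq hφ ha h0
  simp only [List.mem_cons, List.not_mem_nil, or_false] at ha
  rcases ha with rfl | rfl | rfl
  · exact h2 (by simpa [hμ, D21.wt] using (key 1).symm)
  · exact h2 (by simpa [hμ, D21.wt] using (key 2).symm)
  · exact one_ne_zero (α := F) (by simpa [hμ, D21.wt] using (key 0).symm)

end

/-! ### The linear form on the baby Verma module -/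

section

variable {F : Type*} [Field F] {p : ℕ} [Fact p.Prime] [CharP F p]

theorem modelRep_isTopForm (hp : 5 ≤ p) {v : ℕ → F}
    (hα : v 0 ≠ -1) (hv : ∀ i : Fin 3, v (i + 1) ^ p = v (i + 1)) :
    IsTopForm p v (fun i => v (i + 1) - (![2, -2, -2] : Fin 3 → F) i) (modelRep F p v)
      (topCoef F p) where
  isRep := modelRep_isRep hp v
  pos := by
    have hR := modelRep_isRep (F := F) hp v
    intro a ha z
    refine LinearMap.congr_fun (f := topCoef F p ∘ₗ modelRep F p v a) (g := 0) ?_ z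
    refine eq_zero_of_pos (v := v) (c := fun a => topCoef F p ∘ₗ modelRep F p v a)
      (two_ne_zero_of_le hp) hα (fun a b _ _ ha hb => LinearMap.ext fun z => ?_) ?_ a ha
    · have h1 := congrArg (topCoef F p) (LinearMap.congr_fun (hR a b) z)
      have ha' (z) : topCoef F p (modelRep F p v a z) = 0 := LinearMap.congr_fun ha z
      have hb' (z) : topCoef F p (modelRep F p v b z) = 0 := LinearMap.congr_fun hb z
      simp only [Module.End.mul_apply, LinearMap.add_apply, LinearMap.smul_apply, map_add,
        map_smul, ha', hb', ev_apply, map_ev, smul_zero, zero_add] at h1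
      refine (map_ev (M := Module.Dual F (Model F p)) (LinearMap.applyₗ z) v _ _).trans ?_
      exact h1.symm
    · simp only [List.mem_cons, List.not_mem_nil, or_false, forall_eq_or_imp, forall_eq]
      exact ⟨topCoef_e2 v, topCoef_e3 v, topCoef_x4 v⟩
  wt i z := LinearMap.congr_fun (topCoef_h v i) z
  center b hb := modelRep_pCenter hp hv hb
  socle K hK h0 := by
    by_contra hne
    obtain ⟨z, hz, hz'⟩ := exists_topCoef_ne_zero hp v hK hne
    exact hz' (h0 z hz)
  finite := inferInstance
  finrank := Module.finrank_finsupp_self F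
  surj := ⟨_, (topCoef_mono hp v (i := topIx) (by simp [topIx]) (by simp [topIx])
    (by simp [topIx])).trans (if_pos rfl)⟩

end

/-! ### The first cohomology of a module with a detecting linear map -/

section

variable {F g M W : Type*} [Field F] [AddCommGroup g] [Module F g] [AddCommGroup M] [Module F M]
  [AddCommGroup W] [Module F W]
variable {B : g →ₗ[F] g →ₗ[F] g} {G : ZMod 2 → Submodule F g} {ρ : g →ₗ[F] Module.End F M}
  {GM : ZMod 2 → Submodule F M}

/-- If a linear map `L` kills the inner derivations and detects the derivations of parity `i`,
and all other derivations are inner, then `L` identifies `H¹` with its target, provided that it has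
a section by derivations. -/
theorem H1.of_section (L : (g →ₗ[F] M) →ₗ[F] W) (hI : ∀ φ ∈ Ider G ρ GM, L φ = 0) (i : ZMod 2)
    (hinj : ∀ φ ∈ DerHom B G ρ GM i, L φ = 0 → φ ∈ Ider G ρ GM)
    (hother : ∀ φ ∈ DerHom B G ρ GM (i + 1), φ ∈ Ider G ρ GM)
    (ψ : W → (g →ₗ[F] M)) (hψ : ∀ w, ψ w ∈ DerHom B G ρ GM i) (hL : ∀ w, L (ψ w) = w) :
    ∃ E : H1 B G ρ GM ≃ₗ[F] W,
      (∀ φ, E (H1.cls B G ρ GM φ) = L φ) ∧ (∀ w,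
        E (H1.cls B G ρ GM ⟨ψ w, le_iSup (DerHom B G ρ GM) i (hψ w)⟩) = w) ∧
      H1.part B G ρ GM i = ⊤ ∧ H1.part B G ρ GM (i + 1) = ⊥ := by
  have hle : Der B G ρ GM ≤ DerHom B G ρ GM i ⊔ Ider G ρ GM := by
    refine iSup_le fun j => ?_
    have hj : j = i ∨ j = i + 1 := by
      clear hψ hother hinj
      revert i j
      decide
    rcases hj with rfl | rfl
    · exact le_sup_left
    · exact fun φ hφ => Submodule.mem_sup_right (hother φ hφ)
  let L' : H1 B G ρ GM →ₗ[F] W := ((Ider G ρ GM).submoduleOf (Der B G ρ GM)).liftQ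
    (L ∘ₗ (Der B G ρ GM).subtype) fun φ hφ => hI _ hφ
  have hL' (φ) : L' (H1.cls B G ρ GM φ) = L φ := rfl
  have inj : Function.Injective L' := by
    rw [← LinearMap.ker_eq_bot, LinearMap.ker_eq_bot']
    intro x hx
    obtain ⟨φ, rfl⟩ := Submodule.mkQ_surjective _ x
    obtain ⟨φ₀, h₀, φ₁, h₁, he⟩ := Submodule.mem_sup.1 (hle φ.2)
    have hφ : L φ = 0 := hx
    rw [← he, map_add, hI φ₁ h₁, add_zero] at hφ
    rw [Submodule.mkQ_apply, Submodule.Quotient.mk_eq_zero]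
    change φ.1 ∈ Ider G ρ GM
    rw [← he]
    exact add_mem (hinj φ₀ h₀ hφ) h₁
  have hsec (w) : L' (H1.cls B G ρ GM ⟨ψ w, le_iSup (DerHom B G ρ GM) i (hψ w)⟩) = w := hL w
  refine ⟨LinearEquiv.ofBijective L' ⟨inj, fun w => ⟨_, hsec w⟩⟩, hL', hsec, ?_, ?_⟩
  · rw [eq_top_iff]
    intro x _
    have : x = H1.cls B G ρ GM ⟨ψ (L' x), le_iSup (DerHom B G ρ GM) i (hψ (L' x))⟩ :=
      inj (hsec _).symm
    rw [this]
    exact ⟨_, hψ (L' x), rfl⟩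
  · rw [eq_bot_iff]
    rintro _ ⟨φ, hφ, rfl⟩
    exact (Submodule.Quotient.mk_eq_zero _).2 (hother φ hφ)

end

/-! ### Derivations and cocycles -/

section

variable {F M : Type*} [Field F] [AddCommGroup M] [Module F M] {α : F} {v : ℕ → F}
  {ρ : Alg F →ₗ[F] Module.End F M} {GM : ZMod 2 → Submodule F M}

theorem superSign_mul_self (i j : ZMod 2) : superSign F i j * superSign F i j = 1 := by
  unfold superSign
  rw [← pow_add, ← two_mul, pow_mul]
  simp

theorem superSign_cocycle (i j k : ZMod 2) :
    superSign F i (j + k) * superSign F i j = superSign F i k ∧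
      superSign F i (j + k) * superSign F k (i + j) = superSign F j k * superSign F i j := by
  have h : ∀ i j k : ZMod 2,
      ((i * (j + k)).val + (i * j).val) % 2 = (i * k).val % 2 ∧
      ((i * (j + k)).val + (k * (i + j)).val) % 2 = ((j * k).val + (i * j).val) % 2 := by decide
  obtain ⟨h1, h2⟩ := h i j k
  simp only [superSign, ← pow_add]
  exact ⟨by rw [neg_one_pow_eq_pow_mod_two, h1, ← neg_one_pow_eq_pow_mod_two],
    by rw [neg_one_pow_eq_pow_mod_two, h2, ← neg_one_pow_eq_pow_mod_two]⟩

/-- The cocycle of a derivation of parity `i`: the sign `(-1)^{i|a|}` turns the derivation rule into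
a form in which `i` does not occur. -/
def twist (i : ZMod 2) (φ : Alg F →ₗ[F] M) (a : Gen) : M :=
  superSign F i (par a) • φ (bas F a)

theorem ev_twist (i : ZMod 2) (φ : Alg F →ₗ[F] M) (a b : Gen) :
    ev v (twist i φ) (brL a b) =
      superSign F i (par a + par b) • φ (ev v (bas F) (brL a b)) := by
  rw [map_ev]
  have := map_ev (LinearMap.lsmul F M (superSign F i (par a + par b))) v
    (fun k => φ (bas F k)) (brL a b)
  simp only [LinearMap.lsmul_apply] at this
  rw [this]
  refine ev_congr v fun t ht => ?_
  have hpar : par t.key = par a + par b := by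
    rw [par_eq, par_eq, par_eq, odd_brL t ht]
    cases odd a <;> cases odd b <;> rfl
  rw [twist, hpar]

theorem twist_cocycle (hv : v 0 = α) {i : ZMod 2} {φ : Alg F →ₗ[F] M}
    (hφ : φ ∈ DerHom (bracket α) (gr F) ρ GM i) : Cocycle v (fun a => ρ (bas F a)) (twist i φ) := by
  intro a b
  rw [ev_twist, ev_brL, hv, hφ.2 (par a) (par b) _ (bas_mem_gr a rfl) _ (bas_mem_gr b rfl),
    smul_sub, smul_smul, smul_smul, (superSign_cocycle i (par a) (par b)).1,
    (superSign_cocycle i (par a) (par b)).2, superSign_par, mul_smul]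
  simp only [twist, map_smul]

/-- A linear map with values of the right parity is a derivation if it is one on the basis. -/
theorem mem_derHom_of_cocycle (hv : v 0 = α) {i : ZMod 2}
    {φ : Alg F →ₗ[F] M} (hg : ∀ a, φ (bas F a) ∈ GM (i + par a))
    (hφ : Cocycle v (fun a => ρ (bas F a)) (twist i φ)) : φ ∈ DerHom (bracket α) (gr F) ρ GM i := by
  refine ⟨fun j x hx => ?_, fun j k x hx y hy => ?_⟩
  · induction hx using Submodule.span_induction with
    | zero => simp
    | add x y _ _ hx hy => rw [map_add]; exact add_mem hx hy
    | smul c x _ hx => rw [map_smul]; exact Submodule.smul_mem _ c hx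
    | mem x hx =>
      obtain ⟨b, rfl, rfl⟩ := hx
      exact hg b
  · induction hx using Submodule.span_induction with
    | zero => simp
    | add x x' _ _ hx hx' =>
      simp only [map_add, LinearMap.add_apply, hx, hx', smul_add]
      abel
    | smul c x _ hx =>
      simp only [map_smul, LinearMap.smul_apply, hx, smul_sub]
      rw [smul_comm c, smul_comm c]
    | mem x hx =>
      obtain ⟨a, rfl, rfl⟩ := hx
      induction hy using Submodule.span_induction with
      | zero => simp
      | add y y' _ _ hy hy' =>
        simp only [map_add, LinearMap.add_apply, hy, hy', smul_add]
        abel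
      | smul c y _ hy =>
        simp only [map_smul, LinearMap.smul_apply, hy, smul_sub]
        rw [smul_comm c, smul_comm c]
      | mem y hy =>
        obtain ⟨b, rfl, rfl⟩ := hy
        have h := congrArg (superSign F i (par a + par b) • ·) (hφ a b)
        simp only [ev_twist, ev_brL, hv, smul_smul, superSign_mul_self, one_smul] at h
        rw [h]
        simp only [twist, map_smul]
        have h1 := (superSign_cocycle (F := F) i (par a) (par b)).1
        have h2 := (superSign_cocycle (F := F) i (par a) (par b)).2
        have s1 := superSign_mul_self (F := F) i (par a)
        have s2 := superSign_mul_self (F := F) i (par b)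
        have s3 := superSign_mul_self (F := F) i (par a + par b)
        rw [← h1, ← superSign_par]
        rw [smul_sub, smul_smul, smul_smul, smul_smul, ← mul_assoc, s3, one_mul]
        congr 1
        · congr 1
          rw [← one_mul (superSign F (par b) (i + par a)), ← s3,
            mul_assoc _ _ (superSign F (par b) _), h2]
          ring

/-- A derivation whose cocycle is inner by means of a homogeneous vector is inner. -/
theorem mem_ider_of_twist {i : ZMod 2} {φ : Alg F →ₗ[F] M}
    {m : M} (hm : m ∈ GM i)
    (h : ∀ a, twist i φ a = ρ (bas F a) m) :
    φ ∈ Ider (gr F) ρ GM := by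
  refine Submodule.subset_span ⟨i, m, hm, fun j x hx => ?_⟩
  induction hx using Submodule.span_induction with
  | zero => simp
  | add x y _ _ hx hy => simp only [map_add, LinearMap.add_apply, hx, hy, smul_add]
  | smul c x _ hx =>
    simp only [map_smul, LinearMap.smul_apply, hx]
    rw [smul_comm]
  | mem x hx =>
    obtain ⟨b, rfl, rfl⟩ := hx
    have := congrArg (superSign F i (par b) • ·) (h b)
    simp only [twist, smul_smul, superSign_mul_self, one_smul] at this
    rw [this, show superSign F (par b) i = superSign F i (par b) by simp [superSign, mul_comm]]

/-- A linear map that vanishes on `b M` vanishes on the values of inner derivations at `b`. -/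
theorem apply_eq_zero_of_mem_ider {φ : Alg F →ₗ[F] M} {N : Type*} [AddCommGroup N]
    [Module F N] (L : M →ₗ[F] N) {b : Gen}
    (hL : ∀ m, L (ρ (bas F b) m) = 0)
    (hφ : φ ∈ Ider (gr F) ρ GM) : L (φ (bas F b)) = 0 := by
  induction hφ using Submodule.span_induction with
  | zero => simp
  | add x y _ _ hx hy => rw [LinearMap.add_apply, map_add, hx, hy, add_zero]
  | smul c x _ hx => rw [LinearMap.smul_apply, map_smul, hx, smul_zero]
  | mem x hx =>
    obtain ⟨i, m, _, h⟩ := hx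
    rw [h (par b) _ (bas_mem_gr b rfl), map_smul]
    exact (congrArg _ (hL m)).trans (smul_zero _)

end

section

variable {F : Type*} [Field F] {p : ℕ} {α : F} {χ : Module.Dual F (gr F 0)} {lam : Fin 3 → F}

/-- If the value of the `p`-character at some even basis element is nonzero, every derivation is
inner: `b^p - b^{[p]}` acts as a nonzero scalar on the module and as zero on the trivial module. -/
theorem mem_ider_of_ne_zero [Fact p.Prime] [CharP F p] {b : Gen} (hb : par b = 0)
    (hχ : χ (evenBas F b hb) ^ p ≠ 0) {i : ZMod 2} {φ : Alg F →ₗ[F] BabyVerma p α χ lam}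
    (hφ : φ ∈ DerHomZ p α χ lam i) : φ ∈ Ider (gr F) (action p α χ lam) (vermaGr p α χ lam) := by
  have hc : Cocycle (fun _ => α) (zRep p α χ lam) (twist i φ) := twist_cocycle rfl hφ
  have hmem : centerVec p (zRep p α χ lam) (twist i φ) b ∈ vermaGr p α χ lam i := by
    have h0 : twist i φ b ∈ vermaGr p α χ lam i := by
      have := Submodule.smul_mem _ (superSign F i (par b)) (hφ.1 (par b) _ (bas_mem_gr b rfl))
      rwa [hb, add_zero, ← hb] at this
    have hpow (n : ℕ) : (zRep p α χ lam b ^ n) (twist i φ b) ∈ vermaGr p α χ lam i := by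
      induction n with
      | zero => simpa using h0
      | succ n ih =>
        rw [pow_succ', Module.End.mul_apply]
        have := zRep_vermaGr b ih
        rwa [hb, zero_add] at this
    unfold centerVec
    split_ifs
    · exact sub_mem (hpow _) h0
    · exact sub_mem (hpow _) (zero_mem _)
  refine mem_ider_of_twist (Submodule.smul_mem _ (χ (evenBas F b hb) ^ p)⁻¹ hmem) fun a => ?_
  change _ = zRep p α χ lam a _
  rw [map_smul, hc.apply_centerVec (zRep_isRep rfl) (odd_eq_false hb), zRep_pCenter b hb]
  exact (inv_smul_smul₀ hχ (twist i φ a)).symm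

variable [Fact p.Prime] [CharP F p] {v : ℕ → F}

/-- The coefficient of the lowest monomial, as a linear form on the baby Verma module. -/
theorem zRep_isTopForm (hp : 5 ≤ p) (hα : α ≠ -1) (hv0 : v 0 = α)
    (hv : ∀ i : Fin 3, v (i + 1) = lam i) (hlam : lam ∈ weightSet p χ)
    (hχ : ∀ b hb, χ (evenBas F b hb) ^ p = 0) :
    ∃ δ : BabyVerma p α χ lam →ₗ[F] F,
      IsTopForm p v (fun i => lam i - (![2, -2, -2] : Fin 3 → F) i) (zRep p α χ lam) δ ∧
      (∀ z ∈ vermaGr p α χ lam 1, δ z = 0) ∧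
      δ (mono p (zRep p α χ lam) (word (zRep p α χ lam) (hwv p α χ lam)) topIx) = 1 := by
  obtain ⟨P, hP, hP0⟩ := exists_equiv_model hp hv0 hv hlam hχ
  have hv' (i : Fin 3) : v (i + 1) ^ p = v (i + 1) := by
    rw [hv, ← sub_eq_zero, lam_pow hlam]
    exact hχ _ (par_hG i)
  have hT := modelRep_isTopForm (F := F) hp (hv0 ▸ hα) hv'
  have hmon := modelRep_hasMonomials (F := F) (p := p) v
  refine ⟨topCoef F p ∘ₗ P.toLinearMap, ⟨zRep_isRep hv0, fun a ha z => ?_, fun i z => ?_,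
    fun b hb => ?_, fun K hK h0 => ?_, ?_, ?_, ?_⟩, fun z hz => ?_, ?_⟩
  · exact (congrArg _ (hP a z)).trans (hT.pos a ha _)
  · have := hT.wt i (P z)
    rw [← hP, hv] at this
    exact this
  · have hb' : par b = 0 := by rw [par_eq, hb]; rfl
    rw [zRep_pCenter b hb', hχ b hb']
    exact zero_smul F (1 : Module.End F (BabyVerma p α χ lam))
  · have := hT.socle (K.map P.toLinearMap) ?_ ?_
    · exact Submodule.map_injective_of_injective P.injective (this.trans (Submodule.map_bot _).symm)
    · rintro a _ ⟨z, hz, rfl⟩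
      exact ⟨_, hK a z hz, hP a z⟩
    · rintro _ ⟨z, hz, rfl⟩
      exact h0 z hz
  · exact Module.Finite.equiv P.symm
  · rw [P.finrank_eq]
    exact hT.finrank
  · obtain ⟨z, hz⟩ := hT.surj
    exact ⟨P.symm z, by simpa using hz⟩
  · have key (l : List Gen) : ∃ s : Bool, (if s then 1 else 0 : ZMod 2) = (l.map par).sum ∧
        P ((l.map fun b => toEnv p α χ (bas F b)).prod • hwv p α χ lam) ∈
          monoSpan (modelRep F p v) (modelY 0) s := by
      induction l with
      | nil =>
        refine ⟨false, by simp, ?_⟩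
        rw [List.map_nil, List.prod_nil, one_smul, hP0]
        exact Submodule.subset_span ⟨0, 0, 0, [], by decide, rfl, by simp⟩
      | cons a l ih =>
        obtain ⟨s, hs, h⟩ := ih
        refine ⟨s ^^ odd a, ?_, ?_⟩
        · rw [List.map_cons, List.sum_cons, ← hs, par_eq]
          cases s <;> cases odd a <;> rfl
        · rw [List.map_cons, List.prod_cons, mul_smul]
          have := hP a ((l.map fun b => toEnv p α χ (bas F b)).prod • hwv p α χ lam)
          rw [zRep_apply] at this
          rw [this]
          exact hmon.apply_mem_monoSpan a h
    induction hz using Submodule.span_induction with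
    | zero => simp
    | add x y _ _ hx hy => rw [map_add, hx, hy, add_zero]
    | smul c x _ hx => rw [map_smul, hx, smul_zero]
    | mem x hx =>
      obtain ⟨l, hl, rfl⟩ := hx
      obtain ⟨s, hs, h⟩ := key l
      rw [hl] at hs
      cases s
      · exact absurd hs (by decide)
      · exact topCoef_monoSpan v h
  · have hpow (a : Gen) (n : ℕ) (z) :
        P ((zRep p α χ lam a ^ n) z) = (modelRep F p v a ^ n) (P z) := by
      induction n with
      | zero => simp
      | succ n ih => rw [pow_succ', Module.End.mul_apply, hP, ih, pow_succ', Module.End.mul_apply]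
    have hw (J : List Gen) : P (word (zRep p α χ lam) (hwv p α χ lam) J) =
        word (modelRep F p v) (modelY 0 []) J := by
      induction J with
      | nil => exact hP0
      | cons j J ih => rw [word_cons, word_cons, hP, ih]
    have h := topCoef_mono hp v (i := topIx) (by simp [topIx]) (by simp [topIx]) (by simp [topIx])
    rw [if_pos rfl, mono, ← word_modelY v (by decide), ← hw, ← hpow, ← hpow, ← hpow] at h
    exact h

omit [CharP F p] in
/-- A homogeneous derivation whose cocycle is inner is inner: the components of an inner
derivation are inner, because the two homogeneous parts of the module intersect in a submodule
on which the linear form vanishes. -/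
theorem mem_ider_of_exists {μ : Fin 3 → F} {δ : BabyVerma p α χ lam →ₗ[F] F}
    (hδ : IsTopForm p v μ (zRep p α χ lam) δ) (h1 : ∀ z ∈ vermaGr p α χ lam 1, δ z = 0)
    {i : ZMod 2} {φ : Alg F →ₗ[F] BabyVerma p α χ lam} (hφ : φ ∈ DerHomZ p α χ lam i)
    (h : ∃ m, ∀ a, twist i φ a = zRep p α χ lam a m) :
    φ ∈ Ider (gr F) (action p α χ lam) (vermaGr p α χ lam) := by
  have hdisj : vermaGr p α χ lam 0 ⊓ vermaGr p α χ lam 1 = ⊥ := by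
    refine hδ.socle _ (fun a z hz => ?_) fun z hz => h1 z hz.2
    have h0 := zRep_vermaGr a hz.1
    have h1 := zRep_vermaGr a hz.2
    rw [par_eq] at h0 h1
    cases ho : odd a <;> rw [ho] at h0 h1
    · exact ⟨by simpa using h0, by simpa using h1⟩
    · exact ⟨h1, by simpa using h0⟩
  have hdisj' (j : ZMod 2) : vermaGr p α χ lam j ⊓ vermaGr p α χ lam (j + 1) = ⊥ := by
    have hj : j = 0 ∨ j = 1 := by revert j; decide
    rcases hj with rfl | rfl
    · exact hdisj
    · rw [inf_comm]; exact hdisj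
  have hsup : vermaGr p α χ lam i ⊔ vermaGr p α χ lam (i + 1) = ⊤ := by
    have hj : i = 0 ∨ i = 1 := by clear hφ h; revert i; decide
    rcases hj with rfl | rfl
    · exact vermaGr_sup
    · rw [sup_comm]; exact vermaGr_sup
  obtain ⟨m, hm⟩ := h
  obtain ⟨m₀, h₀, m₁, h₁, rfl⟩ := Submodule.mem_sup.1 (hsup ▸ Submodule.mem_top : m ∈ _)
  refine mem_ider_of_twist h₀ fun a => ?_
  have e := hm a
  rw [map_add] at e
  have t0 : twist i φ a ∈ vermaGr p α χ lam (par a + i) := by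
    rw [add_comm]
    exact Submodule.smul_mem _ _ (hφ.1 _ _ (bas_mem_gr a rfl))
  have t1 := zRep_vermaGr a h₀
  have t2 := zRep_vermaGr a h₁
  have t3 : zRep p α χ lam a m₁ ∈ vermaGr p α χ lam (par a + i) := by
    have : zRep p α χ lam a m₁ = twist i φ a - zRep p α χ lam a m₀ := by rw [e]; abel
    rw [this]
    exact sub_mem t0 t1
  have t4 : zRep p α χ lam a m₁ ∈ vermaGr p α χ lam (par a + i) ⊓
      vermaGr p α χ lam (par a + i + 1) := ⟨t3, by rwa [add_assoc]⟩
  rw [hdisj', Submodule.mem_bot] at t4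
  rw [e, t4, add_zero]
  rfl

end

/-! ### Relations that follow from those of generators -/

section

variable {F M : Type*} [Field F] [AddCommGroup M] [Module F M]
variable {p : ℕ} {v : ℕ → F} {r : Gen → Module.End F M} {φ : Gen → M}

/-- The operator of `a` satisfies its relations with all basis elements. -/
def RelFor (v : ℕ → F) (r : Gen → Module.End F M) (a : Gen) : Prop :=
  ∀ b, r a * r b = (sgn a b : F) • (r b * r a) + ev v r (brL a b)

/-- If two elements satisfy their relations, so does their bracket, by the Jacobi identity. -/
theorem RelFor.bracket {a b : Gen} (ha : RelFor v r a) (hb : RelFor v r b) (c : Gen) :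
    ev v (fun g => r g * r c) (brL a b) =
      ((sgn a c : F) * sgn b c) • ev v (fun g => r c * r g) (brL a b) +
        ev v r (subst (brL a b) fun g => brL g c) := by
  have hX (d g : Gen) (hd : RelFor v r d) (e : Gen) : ev v r (subst (brL g e) (brL d)) =
      r d * ev v r (brL g e) - ((sgn d g : F) * sgn d e) • (ev v r (brL g e) * r d) := by
    have h1 := ev_add_smul v (-((sgn d g : F) * sgn d e)) (fun k => r k * r d) (fun k => r d * r k)
      (brL g e)
    rw [ev_subst, mul_ev, ev_mul]
    rw [sub_eq_add_neg, ← neg_smul, add_comm, ← h1]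
    refine ev_congr v fun t ht => ?_
    rw [hd t.key, sgn_brL t ht]
    push_cast
    module
  have j := ev_jacobi (v := v) r a b c
  rw [hX a b ha c, hX b a hb c] at j
  have e1 : ev v r (brL a b) = r a * r b - (sgn a b : F) • (r b * r a) := by
    rw [ha b]; abel
  have e2 : ev v r (brL a c) = r a * r c - (sgn a c : F) • (r c * r a) := by
    rw [ha c]; abel
  have e3 : ev v r (brL b c) = r b * r c - (sgn b c : F) • (r c * r b) := by
    rw [hb c]; abel
  rw [← ev_mul, ← mul_ev, eq_sub_of_add_eq j.symm, e1, e2, e3, sgn_comm b a]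
  have s1 := sgn_eq (F := F) a b
  have s2 := sgn_eq (F := F) a c
  have s3 := sgn_eq (F := F) b c
  generalize ((sgn a b : ℤ) : F) = ε at *
  generalize ((sgn a c : ℤ) : F) = ζ at *
  generalize ((sgn b c : ℤ) : F) = η at *
  simp only [mul_sub, sub_mul, smul_mul_assoc, mul_smul_comm, mul_assoc]
  rcases s1 with rfl | rfl <;> rcases s2 with rfl | rfl <;> rcases s3 with rfl | rfl <;> module

/-- The elements `e₂, e₃, x₄, f₂, f₃, y₁` generate `D(2,1;α)`. -/
theorem isRep_of_generators (two : (2 : F) ≠ 0) (hα : v 0 ≠ -1)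
    (h : ∀ a ∈ [e2, e3, x4, f2, f3, y1], RelFor v r a) : IsRep v r := by
  have br {a b g : Gen} (c : F) (hc : c ≠ 0)
      (hg : ∀ w : Gen → Module.End F M, ev v w (brL a b) = c • w g)
      (hs : ∀ d, sgn g d = sgn a d * sgn b d)
      (ha : RelFor v r a) (hb : RelFor v r b) : RelFor v r g := by
    intro d
    have h1 := ha.bracket hb d
    rw [ev_subst, hg, hg, hg, smul_comm, ← smul_add] at h1
    rw [smul_right_injective _ hc h1, hs]
    push_cast
    rfl
  have one {a b g : Gen} (hg : brL a b = [⟨1, [], g⟩]) (hs : ∀ d, sgn g d = sgn a d * sgn b d)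
      (ha : RelFor v r a) (hb : RelFor v r b) : RelFor v r g :=
    br 1 one_ne_zero (fun w => by simp [hg, ev]) hs ha hb
  simp only [List.mem_cons, List.not_mem_nil, or_false, forall_eq_or_imp, forall_eq] at h
  obtain ⟨he2, he3, hx4, hf2, hf3, hy1⟩ := h
  have hh2 := one (g := h2) rfl (by decide) he2 hf2
  have hh3 := one (g := h3) rfl (by decide) he3 hf3
  have hx2 := one (g := x2) rfl (by decide) he2 hx4
  have hx3 := one (g := x3) rfl (by decide) he3 hx4
  have hx1 := one (g := x1) rfl (by decide) he2 hx3
  have hy2 := one (g := y2) rfl (by decide) hf3 hy1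
  have hy3 := one (g := y3) rfl (by decide) hf2 hy1
  have hy4 := one (g := y4) rfl (by decide) hf3 hy3
  have hα' : 1 + v 0 ≠ 0 := fun h => hα (by linear_combination h)
  have he1 := br (g := e1) (2 * (1 + v 0)) (mul_ne_zero two hα') (fun w => by
    simp [brL, halfL, sgn, odd, scale, mulMon, ev]
    module) (by decide) hx1 hx4
  have hf1 := br (g := f1) (-2 * (1 + v 0)) (mul_ne_zero (neg_ne_zero.2 two) hα') (fun w => by
    simp [brL, halfL, sgn, odd, scale, mulMon, ev]
    module) (by decide) hy1 hy4
  have hh1 := one (g := h1) rfl (by decide) he1 hf1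
  intro a
  cases a <;> assumption

end

/-! ### Derivations given by formal combinations of monomials -/

/-- Substitution of the integers `l 0, l 1, l 2` for the variables `X₁, X₂, X₃`. -/
def spec {κ : Type} (l : Fin 3 → ℤ) (L : Comb κ) : Comb κ :=
  L.map fun t => ⟨t.coef * (t.mon.map fun n => if n = 1 then l 0 else if n = 2 then l 1 else
    if n = 3 then l 2 else 1).prod, t.mon.filter fun n => !(n == 1 || n == 2 || n == 3), t.key⟩

theorem ev_spec {F M : Type*} [Field F] [AddCommGroup M] [Module F M] {κ : Type} {v : ℕ → F}
    {l : Fin 3 → ℤ} (h : ∀ i : Fin 3, v (i + 1) = l i) (f : κ → M) (L : Comb κ) :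
    ev v f (spec l L) = ev v f L := by
  have hm (m : List ℕ) : (((m.map fun n => if n = 1 then l 0 else if n = 2 then l 1 else
      if n = 3 then l 2 else 1).prod : ℤ) : F) *
      ((m.filter fun n => !(n == 1 || n == 2 || n == 3)).map v).prod = (m.map v).prod := by
    have h0 := h 0
    have h1 := h 1
    have h2 := h 2
    simp only [Fin.val_zero, zero_add, Fin.val_one, Fin.val_two, Nat.reduceAdd] at h0 h1 h2
    induction m with
    | nil => simp
    | cons n m ih =>
      by_cases n1 : n = 1
      · subst n1
        simp [← ih, ← h0, mul_assoc]
      by_cases n2 : n = 2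
      · subst n2
        simp [← ih, ← h1, mul_assoc]
      by_cases n3 : n = 3
      · subst n3
        simp [← ih, ← h2, mul_assoc]
      simp [← ih, n1, n2, n3]
      ring
  induction L with
  | nil => rfl
  | cons t L ih =>
    have e : spec l (t :: L) = ⟨t.coef * (t.mon.map fun n => if n = 1 then l 0 else
      if n = 2 then l 1 else if n = 3 then l 2 else 1).prod,
      t.mon.filter fun n => !(n == 1 || n == 2 || n == 3), t.key⟩ :: spec l L := rfl
    rw [e, ev_cons, ev_cons, ih, ← hm t.mon]
    push_cast
    rw [mul_assoc]

/-- The exponents `(j₁, j₂, j₃, j₄)` of the `y_j`. -/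
abbrev Theta : Type := ℕ × ℕ × ℕ × ℕ

/-- The product of the `y_j` with exponents `θ`. -/
def yList (θ : Theta) : List Gen :=
  List.replicate θ.1 y1 ++ (List.replicate θ.2.1 y2 ++ (List.replicate θ.2.2.1 y3 ++
    List.replicate θ.2.2.2 y4))

/-- Twice the exponents of `f₁, f₂, f₃` in `w_β^θ`. -/
def wExp (l β : Fin 3 → ℤ) (θ : Theta) : Fin 3 → ℤ :=
  ![l 0 - β 0 - θ.1 - θ.2.1 - θ.2.2.1 - θ.2.2.2, l 1 - β 1 + θ.1 + θ.2.1 - θ.2.2.1 - θ.2.2.2,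
    l 2 - β 2 + θ.1 - θ.2.1 + θ.2.2.1 - θ.2.2.2]

/-- The label of the monomial `w_β^θ`. -/
def wIx (l β : Fin 3 → ℤ) (θ : Theta) : Ix :=
  ⟨wExp l β θ 0 / 2, wExp l β θ 1 / 2, wExp l β θ 2 / 2, yList θ⟩

/-- The label of `w_β^θ` is in the range in which the action can be computed. -/
def wOk (l β : Fin 3 → ℤ) (θ : Theta) : Bool :=
  Js.contains (yList θ) && ([0, 1, 2] : List (Fin 3)).all fun i =>
    wExp l β θ i % 2 == 0 && decide (-3 ≤ wExp l β θ i / 2) && decide (wExp l β θ i / 2 ≤ 4)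

/-- The cocycle condition for the pair `a, b`. -/
def cocL (L : Gen → Comb Ix) (a b : Gen) : Comb Ix :=
  subst (L b) (act a) ++ scale (-sgn a b) [] (subst (L a) (act b)) ++
    scale (-1) [] (subst (brL a b) L)

/-- The sign `(-1)^{i|b|}`. -/
def twSign (i : Bool) (b : Gen) : ℤ := if i && odd b then -1 else 1

/-- The twisted values of a linear map whose values on the basis are the combinations `K b` of
the `w^θ`. -/
def ixComb (i : Bool) (l : Fin 3 → ℤ) (K : Gen → Comb Theta) (b : Gen) : Comb Ix :=
  (K b).map fun t => ⟨twSign i b * t.coef, t.mon, wIx l (wt b) t.key⟩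

/-- The check that the `K b` are the values of a derivation of parity `i`. The relations are tested
for the members of a generating set only, as those of the other basis elements follow. -/
def derCheck (i : Bool) (l : Fin 3 → ℤ) (K : Gen → Comb Theta) : Bool :=
  (gens.all fun b => (K b).all fun t =>
    wOk l (wt b) t.key && oddLen (yList t.key) == (i ^^ odd b)) &&
  [e2, e3, x4, f2, f3, y1].all fun a => gens.all fun b => isZero (spec l (cocL (ixComb i l K) a b))

section

variable {F : Type*} [Field F] {p : ℕ} {α : F} {χ : Module.Dual F (gr F 0)} {lam : Fin 3 → F}
  {v : ℕ → F}

theorem word_replicate {M : Type*} [AddCommGroup M] [Module F M] (r : Gen → Module.End F M) (m : M)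
    (n : ℕ) (y : Gen) (J : List Gen) :
    word r m (List.replicate n y ++ J) = (r y ^ n) (word r m J) := by
  simp [word]

variable [Fact p.Prime]

theorem halfMod_eq (hp : 5 ≤ p) {n : ℤ} (h : n % 2 = 0) (h1 : -3 ≤ n / 2) (h2 : n / 2 ≤ 4) :
    halfMod p n = rep p (n / 2) := by
  have h0 : (2 : ZMod p) ≠ 0 := two_ne_zero_of_le hp
  have e : (n : ZMod p) * 2⁻¹ = ((n / 2 : ℤ) : ZMod p) := by
    obtain ⟨k, rfl⟩ := Int.dvd_of_emod_eq_zero h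
    rw [Int.mul_ediv_cancel_left _ two_ne_zero]
    push_cast
    field_simp
  rw [halfMod, e, ← rep_natCast (F := ZMod p) (p := p) (by omega), ZMod.val_natCast_of_lt]
  unfold rep
  split_ifs <;> omega

/-- The vector `w_β^θ` as a monomial. -/
theorem w_eq_mono (hp : 5 ≤ p) {l β : Fin 3 → ℤ} {θ : Theta} (h : wOk l β θ = true) :
    w p α χ lam l β θ.1 θ.2.1 θ.2.2.1 θ.2.2.2 =
      mono p (zRep p α χ lam) (word (zRep p α χ lam) (hwv p α χ lam)) (wIx l β θ) := by
  simp only [wOk, Bool.and_eq_true, List.all_cons, List.all_nil, Bool.and_true, beq_iff_eq,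
    decide_eq_true_eq] at h
  obtain ⟨-, ⟨⟨a1, a2⟩, a3⟩, ⟨⟨b1, b2⟩, b3⟩, ⟨⟨c1, c2⟩, c3⟩⟩ := h
  have e0 := halfMod_eq hp a1 a2 a3
  have e1 := halfMod_eq hp b1 b2 b3
  have e2 := halfMod_eq hp c1 c2 c3
  have hw : word (zRep p α χ lam) (hwv p α χ lam) (yList θ) =
      (toEnv p α χ (bas F y1) ^ θ.1 * toEnv p α χ (bas F y2) ^ θ.2.1 *
        toEnv p α χ (bas F y3) ^ θ.2.2.1 * toEnv p α χ (bas F y4) ^ θ.2.2.2) • hwv p α χ lam := by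
    rw [yList, ← List.append_nil (List.replicate θ.2.2.2 y4)]
    simp only [word_replicate, zRep_pow_apply]
    simp only [mul_smul]
    rfl
  rw [mono, wIx]
  simp only [hw, zRep_pow_apply, ← mul_smul, ← e0, ← e1, ← e2, mul_assoc]
  rw [w]
  simp only [mul_assoc]
  rfl

omit [Fact p.Prime] in
theorem mono_mem_vermaGr {i : Ix} (hi : i.J ∈ Js) :
    mono p (zRep p α χ lam) (word (zRep p α χ lam) (hwv p α χ lam)) i ∈
      vermaGr p α χ lam (if oddLen i.J then 1 else 0) := by
  have hf (a : Gen) (ha : par a = 0) (n : ℕ) {j : ZMod 2} {z} (hz : z ∈ vermaGr p α χ lam j) :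
      (zRep p α χ lam a ^ n) z ∈ vermaGr p α χ lam j := by
    induction n with
    | zero => simpa using hz
    | succ n ih =>
      rw [pow_succ', Module.End.mul_apply]
      have := zRep_vermaGr a ih
      rwa [ha, zero_add] at this
  have hJ := isY_of_mem_Js hi
  refine hf _ rfl _ (hf _ rfl _ (hf _ rfl _ ?_))
  generalize i.J = J at hJ
  induction J with
  | nil => exact hwv_mem
  | cons j J ih =>
    have h1 := zRep_vermaGr j (ih fun j hj => hJ j (List.mem_cons_of_mem _ hj))
    have h2 : par j = 1 := by
      have := hJ j (by simp)
      cases j <;> first | rfl | exact absurd this (by decide)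
    rw [h2] at h1
    rw [word_cons, oddLen]
    cases h : oddLen J <;> rw [h] at h1
    · simpa using h1
    · exact h1

theorem eq_sub_smul_of_add_eq_zero {M : Type*} [AddCommGroup M] [Module F M] {x y z : M} {s : F}
    (h : x + -s • y + (-1 : F) • z = 0) : z = x - s • y := by
  rw [← sub_eq_zero, ← neg_eq_zero, ← h]
  module

/-- Soundness of the check: it makes the extension of the trivial module by the baby Verma module a
representation. -/
theorem mem_derHom_of_derCheck [CharP F p] (hp : 5 ≤ p) (hα : α ≠ -1) {i : Bool}
    {l : Fin 3 → ℤ} {K : Gen → Comb Theta} (h : derCheck i l K = true) (hv0 : v 0 = α)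
    (hl : ∀ i : Fin 3, v (i + 1) = l i) (hv : ∀ i : Fin 3, v (i + 1) = lam i)
    (hf : ∀ i, χ (fE F i) ^ p = 0) {φ : Alg F →ₗ[F] BabyVerma p α χ lam}
    (hφ : ∀ b, φ (bas F b) = ev v (fun θ : Theta =>
      w p α χ lam l (wt b) θ.1 θ.2.1 θ.2.2.1 θ.2.2.2) (K b)) :
    φ ∈ DerHomZ p α χ lam (if i then 1 else 0) := by
  rw [derCheck, Bool.and_eq_true] at h
  obtain ⟨hc1, hc2⟩ := h
  have ok (b : Gen) : ∀ t ∈ K b, wOk l (wt b) t.key = true ∧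
      oddLen (yList t.key) = (i ^^ odd b) := by
    intro t ht
    have := List.all_eq_true.1 (List.all_eq_true.1 hc1 b (mem_gens b)) t ht
    simpa using this
  have okJ (b : Gen) : ∀ t ∈ K b, (wIx l (wt b) t.key).J ∈ Js := by
    intro t ht
    have := (ok b t ht).1
    rw [wOk, Bool.and_eq_true] at this
    simpa [wIx] using this.1
  have hR := zRep_isRep (p := p) (χ := χ) (lam := lam) hv0
  have hmon := hR.hasMonomials hp (zRep_isHighest hv hf)
  have hφ' (b : Gen) : φ (bas F b) = ev v (fun θ : Theta => mono p (zRep p α χ lam)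
      (word (zRep p α χ lam) (hwv p α χ lam)) (wIx l (wt b) θ)) (K b) := by
    rw [hφ]
    exact ev_congr v fun t ht => w_eq_mono hp (ok b t ht).1
  have htw (b : Gen) : twist (if i then 1 else 0) φ b = ev v (mono p (zRep p α χ lam)
      (word (zRep p α χ lam) (hwv p α χ lam))) (ixComb i l K b) := by
    rw [ixComb, ev_map_mul, ← hφ', twist, par_eq, twSign]
    have : (1 : ZMod 2).val = 1 := rfl
    cases i <;> cases odd b <;> simp [superSign, this]
  refine mem_derHom_of_cocycle hv0 (fun b => ?_) ?_
  · rw [hφ']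
    refine ev_mem v _ fun t ht => ?_
    have h1 := mono_mem_vermaGr (p := p) (α := α) (χ := χ) (lam := lam) (okJ b t ht)
    have h2 : (if oddLen (wIx l (wt b) t.key).J then (1 : ZMod 2) else 0) =
        (if i then 1 else 0) + par b := by
      have := (ok b t ht).2
      rw [wIx, this, par_eq]
      cases i <;> cases odd b <;> rfl
    rwa [h2] at h1
  · refine cocycle_of_isRep (isRep_of_generators (two_ne_zero_of_le hp) (hv0 ▸ hα)
      fun a ha b => extRep_rel hR ?_)
    have h0 := List.all_eq_true.1 (List.all_eq_true.1 hc2 a ha) b (mem_gens b)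
    have h1 := ev_eq_zero v (mono p (zRep p α χ lam)
      (word (zRep p α χ lam) (hwv p α χ lam))) h0
    have rng (b : Gen) : ∀ t ∈ ixComb i l K b,
        t.key.J ∈ Js ∧ -3 ≤ t.key.k1 ∧ -3 ≤ t.key.k2 ∧ -3 ≤ t.key.k3 := by
      intro t ht
      obtain ⟨s, hs, rfl⟩ := List.mem_map.1 ht
      have hw := (ok b s hs).1
      simp only [wOk, Bool.and_eq_true, List.all_cons, List.all_nil, Bool.and_true, beq_iff_eq,
        decide_eq_true_eq] at hw
      obtain ⟨-, ⟨⟨a1, a2⟩, a3⟩, ⟨⟨b1, b2⟩, b3⟩, ⟨⟨c1, c2⟩, c3⟩⟩ := hw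
      exact ⟨okJ b s hs, a2, b2, c2⟩
    rw [ev_spec hl, cocL, ev_append, ev_append, ev_scale, ev_scale, ← hmon.act_ev hp (rng b) a,
      ← hmon.act_ev hp (rng a) b, ev_subst, ← htw, ← htw] at h1
    rw [show ev v (twist (if i then 1 else 0) φ) (brL a b) = ev v (fun k => ev v
      (mono p (zRep p α χ lam) (word (zRep p α χ lam) (hwv p α χ lam))) (ixComb i l K k))
      (brL a b) from ev_congr v fun t _ => htw t.key]
    simp only [List.map_nil, List.prod_nil, mul_one] at h1
    push_cast at h1
    exact eq_sub_smul_of_add_eq_zero h1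

end

/-! ### The derivations `ψ₁, …, ψ₄` -/

/-- The combination `n (1 + X₀) X₇ θ`; the variables `X₄, X₅, X₆` and `X₇, X₈, X₉` stand for the
parameters `a` and `c`. -/
def termC (n : ℤ) (θ : Theta) : Comb Theta := [⟨n, [7], θ⟩, ⟨n, [0, 7], θ⟩]

/-- The combination `(x (1 + X₀) X₄ + y X₅ + z X₀ X₆) θ`. -/
def termA (x y z : ℤ) (θ : Theta) : Comb Theta :=
  [⟨x, [4], θ⟩, ⟨x, [0, 4], θ⟩, ⟨y, [5], θ⟩, ⟨z, [0, 6], θ⟩]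

/-- The values of `ψ₁`. -/
def psi1K : Gen → Comb Theta
  | h1 => [⟨1, [4], (1, 1, 1, 1)⟩]
  | h2 => [⟨1, [5], (1, 1, 1, 1)⟩]
  | h3 => [⟨1, [6], (1, 1, 1, 1)⟩]
  | f1 => [⟨1, [7], (1, 1, 1, 1)⟩]
  | f2 => [⟨1, [8], (1, 1, 1, 1)⟩]
  | f3 => [⟨1, [9], (1, 1, 1, 1)⟩]
  | e1 => termC (-8) (0, 0, 0, 0) ++ [⟨2, [8], (1, 1, 0, 0)⟩] ++ [⟨-2, [0, 9], (1, 0, 1, 0)⟩] ++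
      termA 1 (-1) 1 (1, 0, 0, 1) ++ termA (-1) 1 1 (0, 1, 1, 0) ++ [⟨-1, [4], (1, 1, 1, 1)⟩]
  | e2 => termC 2 (1, 1, 0, 0) ++ [⟨-1, [5], (1, 1, 1, 1)⟩]
  | e3 => [⟨-1, [6], (1, 1, 1, 1)⟩]
  | x1 => termC 4 (1, 0, 0, 0) ++ termC 4 (0, 1, 0, 0) ++ termC 4 (0, 0, 1, 0) ++
      termC 4 (0, 0, 0, 1) ++ termA 1 (-1) (-1) (1, 1, 1, 0) ++ termA 1 (-1) 1 (1, 1, 0, 1) ++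
      termA (-1) (-1) 1 (1, 0, 1, 1) ++ termA (-1) (-1) (-1) (0, 1, 1, 1)
  | x2 => termC 4 (0, 1, 0, 0) ++ termC 4 (0, 0, 0, 1) ++ [⟨-2, [0, 9], (1, 1, 1, 0)⟩] ++
      termA 1 (-1) 1 (1, 1, 0, 1) ++ [⟨2, [0, 9], (1, 0, 1, 1)⟩] ++
      termA (-1) (-1) (-1) (0, 1, 1, 1)
  | x3 => termC 4 (0, 0, 1, 0) ++ termC 4 (0, 0, 0, 1) ++ [⟨-2, [8], (1, 1, 1, 0)⟩] ++
      [⟨-2, [8], (1, 1, 0, 1)⟩] ++ termA (-1) (-1) 1 (1, 0, 1, 1) ++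
      termA (-1) (-1) (-1) (0, 1, 1, 1)
  | x4 => termC 4 (0, 0, 0, 1) ++ [⟨-2, [8], (1, 1, 0, 1)⟩] ++ [⟨2, [0, 9], (1, 0, 1, 1)⟩] ++
      termA (-1) (-1) (-1) (0, 1, 1, 1)
  | y1 => termC (-2) (1, 0, 1, 1) ++ termC (-2) (0, 1, 1, 1)
  | y2 => termC (-2) (0, 1, 1, 1)
  | y3 => termC (-2) (1, 0, 1, 1) ++ termC (-2) (0, 1, 1, 1)
  | y4 => termC (-2) (0, 1, 1, 1)

/-- The values of `ψ₂`. -/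
def psi2K : Gen → Comb Theta
  | e1 => [⟨2, [0], (0, 1, 0, 1)⟩]
  | e3 => [⟨1, [], (1, 1, 1, 1)⟩]
  | x1 => [⟨-2, [0], (1, 1, 0, 1)⟩, ⟨2, [0], (0, 1, 1, 1)⟩]
  | x3 => [⟨2, [0], (0, 1, 1, 1)⟩]
  | _ => []

/-- The values of `ψ₃`. -/
def psi3K : Gen → Comb Theta
  | e1 => [⟨-2, [], (0, 0, 1, 1)⟩]
  | e2 => [⟨1, [], (1, 1, 1, 1)⟩]
  | x1 => [⟨2, [], (1, 0, 1, 1)⟩, ⟨2, [], (0, 1, 1, 1)⟩]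
  | x2 => [⟨2, [], (0, 1, 1, 1)⟩]
  | _ => []

/-- The values of `ψ₄`. -/
def psi4K : Gen → Comb Theta
  | e1 => [⟨1, [], (1, 1, 1, 0)⟩]
  | x1 => [⟨-1, [], (1, 1, 1, 1)⟩]
  | x2 => [⟨-1, [], (1, 1, 1, 1)⟩]
  | x3 => [⟨-1, [], (1, 1, 1, 1)⟩]
  | x4 => [⟨-1, [], (1, 1, 1, 1)⟩]
  | _ => []

set_option maxRecDepth 100000 in
theorem psi1_check : derCheck false ![2, -2, -2] psi1K = true := by decide +kernel

set_option maxRecDepth 100000 in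
theorem psi2_check : derCheck false ![2, -2, 0] psi2K = true := by decide +kernel

set_option maxRecDepth 100000 in
theorem psi3_check : derCheck false ![2, 0, -2] psi3K = true := by decide +kernel

set_option maxRecDepth 100000 in
theorem psi4_check : derCheck true ![3, -3, -3] psi4K = true := by decide +kernel

section Values

variable {F M : Type*} [Field F] [AddCommGroup M] [Module F M]

/-- The values of the variables: `α`, the highest weight, and the parameters of `ψ₁`. -/
def vars (α : F) (lam a c : Fin 3 → F) : ℕ → F
  | 0 => α
  | 1 => lam 0
  | 2 => lam 1
  | 3 => lam 2
  | 4 => a 0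
  | 5 => a 1
  | 6 => a 2
  | 7 => c 0
  | 8 => c 1
  | 9 => c 2
  | _ => 0

theorem vars_lam (α : F) (lam a c : Fin 3 → F) (i : Fin 3) :
    vars α lam a c (i + 1) = lam i := by
  fin_cases i <;> rfl

theorem ev_psi1K (α : F) (lam a c : Fin 3 → F) (W : ℕ → ℕ → ℕ → ℕ → M) (b : Gen) :
    (let A : F := (1 + α) * a 0
    let C : F := (1 + α) * c 0
    match b with
    | h1 => a 0 • W 1 1 1 1
    | h2 => a 1 • W 1 1 1 1
    | h3 => a 2 • W 1 1 1 1
    | f1 => c 0 • W 1 1 1 1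
    | f2 => c 1 • W 1 1 1 1
    | f3 => c 2 • W 1 1 1 1
    | e1 => (-8 * C) • W 0 0 0 0 + (2 * c 1) • W 1 1 0 0 - (2 * α * c 2) • W 1 0 1 0
        + (A - a 1 + α * a 2) • W 1 0 0 1 - (A - a 1 - α * a 2) • W 0 1 1 0 - a 0 • W 1 1 1 1
    | e2 => (2 * C) • W 1 1 0 0 - a 1 • W 1 1 1 1
    | e3 => -(a 2 • W 1 1 1 1)
    | x1 => (4 * C) • (W 1 0 0 0 + W 0 1 0 0 + W 0 0 1 0 + W 0 0 0 1)
        + (A - a 1 - α * a 2) • W 1 1 1 0 + (A - a 1 + α * a 2) • W 1 1 0 1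
        - (A + a 1 - α * a 2) • W 1 0 1 1 - (A + a 1 + α * a 2) • W 0 1 1 1
    | x2 => (4 * C) • (W 0 1 0 0 + W 0 0 0 1)
        - (2 * α * c 2) • W 1 1 1 0 + (A - a 1 + α * a 2) • W 1 1 0 1
        + (2 * α * c 2) • W 1 0 1 1 - (A + a 1 + α * a 2) • W 0 1 1 1
    | x3 => (4 * C) • (W 0 0 1 0 + W 0 0 0 1)
        - (2 * c 1) • W 1 1 1 0 - (2 * c 1) • W 1 1 0 1
        - (A + a 1 - α * a 2) • W 1 0 1 1 - (A + a 1 + α * a 2) • W 0 1 1 1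
    | x4 => (4 * C) • W 0 0 0 1
        - (2 * c 1) • W 1 1 0 1 + (2 * α * c 2) • W 1 0 1 1 - (A + a 1 + α * a 2) • W 0 1 1 1
    | y1 => (-2 * C) • (W 1 0 1 1 + W 0 1 1 1)
    | y2 => (-2 * C) • W 0 1 1 1
    | y3 => (-2 * C) • (W 1 0 1 1 + W 0 1 1 1)
    | y4 => (-2 * C) • W 0 1 1 1) =
      ev (vars α lam a c) (fun θ : Theta => W θ.1 θ.2.1 θ.2.2.1 θ.2.2.2) (psi1K b) := by
  cases b <;> simp only [psi1K, termC, termA, ev, vars, List.map_cons, List.map_nil, List.sum_cons,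
    List.sum_nil, List.prod_cons, List.prod_nil, List.cons_append, List.nil_append] <;>
    push_cast <;> module

theorem ev_psi2K (α : F) (lam a c : Fin 3 → F) (W : ℕ → ℕ → ℕ → ℕ → M) (b : Gen) :
    (match b with
    | e1 => (2 * α) • W 0 1 0 1
    | e3 => W 1 1 1 1
    | x1 => (-2 * α) • W 1 1 0 1 + (2 * α) • W 0 1 1 1
    | x3 => (2 * α) • W 0 1 1 1
    | _ => 0) =
      ev (vars α lam a c) (fun θ : Theta => W θ.1 θ.2.1 θ.2.2.1 θ.2.2.2) (psi2K b) := by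
  cases b <;> simp [psi2K, ev, vars]

theorem ev_psi3K (α : F) (lam a c : Fin 3 → F) (W : ℕ → ℕ → ℕ → ℕ → M) (b : Gen) :
    (match b with
    | e1 => (-2 : F) • W 0 0 1 1
    | e2 => W 1 1 1 1
    | x1 => (2 : F) • W 1 0 1 1 + (2 : F) • W 0 1 1 1
    | x2 => (2 : F) • W 0 1 1 1
    | _ => 0) =
      ev (vars α lam a c) (fun θ : Theta => W θ.1 θ.2.1 θ.2.2.1 θ.2.2.2) (psi3K b) := by
  cases b <;> simp [psi3K, ev]

theorem ev_psi4K (α : F) (lam a c : Fin 3 → F) (W : ℕ → ℕ → ℕ → ℕ → M) (b : Gen) :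
    (match b with
    | e1 => W 1 1 1 0
    | x1 => -W 1 1 1 1
    | x2 => -W 1 1 1 1
    | x3 => -W 1 1 1 1
    | x4 => -W 1 1 1 1
    | _ => 0) =
      ev (vars α lam a c) (fun θ : Theta => W θ.1 θ.2.1 θ.2.2.1 θ.2.2.2) (psi4K b) := by
  cases b <;> simp [psi4K, ev]

end Values

section

variable {F : Type*} [Field F] {p : ℕ} {α : F} {χ : Module.Dual F (gr F 0)} {lam : Fin 3 → F}

theorem constr_bas {N : Type*} [AddCommGroup N] [Module F N] (f : Gen → N) (b : Gen) :
    (Pi.basisFun F Gen).constr F f (bas F b) = f b := by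
  have : bas F b = Pi.basisFun F Gen b := by simp [bas]
  rw [this, Module.Basis.constr_basis]

theorem psi1_bas (a c : Fin 3 → F) (b : Gen) : psi1 p α χ lam a c (bas F b) =
    ev (vars α lam a c) (fun θ : Theta =>
      w p α χ lam ![2, -2, -2] (wt b) θ.1 θ.2.1 θ.2.2.1 θ.2.2.2) (psi1K b) := by
  refine (constr_bas _ b).trans ?_
  refine Eq.trans ?_ (ev_psi1K α lam a c (w p α χ lam ![2, -2, -2] (wt b)) b)
  cases b <;> rfl

theorem psi2_bas (a c : Fin 3 → F) (b : Gen) : psi2 p α χ lam (bas F b) =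
    ev (vars α lam a c) (fun θ : Theta =>
      w p α χ lam ![2, -2, 0] (wt b) θ.1 θ.2.1 θ.2.2.1 θ.2.2.2) (psi2K b) := by
  refine (constr_bas _ b).trans ?_
  refine Eq.trans ?_ (ev_psi2K α lam a c (w p α χ lam ![2, -2, 0] (wt b)) b)
  cases b <;> rfl

theorem psi3_bas (a c : Fin 3 → F) (b : Gen) : psi3 p α χ lam (bas F b) =
    ev (vars α lam a c) (fun θ : Theta =>
      w p α χ lam ![2, 0, -2] (wt b) θ.1 θ.2.1 θ.2.2.1 θ.2.2.2) (psi3K b) := by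
  refine (constr_bas _ b).trans ?_
  refine Eq.trans ?_ (ev_psi3K α lam a c (w p α χ lam ![2, 0, -2] (wt b)) b)
  cases b <;> rfl

theorem psi4_bas (a c : Fin 3 → F) (b : Gen) : psi4 p α χ lam (bas F b) =
    ev (vars α lam a c) (fun θ : Theta =>
      w p α χ lam ![3, -3, -3] (wt b) θ.1 θ.2.1 θ.2.2.1 θ.2.2.2) (psi4K b) := by
  refine (constr_bas _ b).trans ?_
  refine Eq.trans ?_ (ev_psi4K α lam a c (w p α χ lam ![3, -3, -3] (wt b)) b)
  cases b <;> rfl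

end

/-! ### The first cohomology of the baby Verma modules -/

section

variable {F g M : Type*} [Field F] [AddCommGroup g] [Module F g] [AddCommGroup M] [Module F M]
  {B : g →ₗ[F] g →ₗ[F] g} {G : ZMod 2 → Submodule F g} {ρ : g →ₗ[F] Module.End F M}
  {GM : ZMod 2 → Submodule F M}

theorem H1.subsingleton_of_le (h : ∀ i, DerHom B G ρ GM i ≤ Ider G ρ GM) :
    Subsingleton (H1 B G ρ GM) ∧ H1.sdim B G ρ GM = (0, 0) := by
  have hs : Subsingleton (H1 B G ρ GM) :=
    Submodule.Quotient.subsingleton_iff.2 (Submodule.submoduleOf_eq_top.2 (iSup_le h))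
  exact ⟨hs, Prod.ext (rank_subsingleton' F _) (rank_subsingleton' F _)⟩

end

section

variable {F : Type*} [Field F] {p : ℕ} {α : F} {χ : Module.Dual F (gr F 0)} {lam : Fin 3 → F}

/-- A form that kills the odd part of the module kills the values of odd cocycles at even
elements and of even cocycles at odd elements. -/
theorem form_twist_eq_zero {δ : BabyVerma p α χ lam →ₗ[F] F}
    (h1 : ∀ z ∈ vermaGr p α χ lam 1, δ z = 0) {i : ZMod 2} {φ : Alg F →ₗ[F] BabyVerma p α χ lam}
    (hφ : φ ∈ DerHomZ p α χ lam i) {a : Gen} (ha : i + par a = 1) : δ (twist i φ a) = 0 := by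
  refine h1 _ (Submodule.smul_mem _ _ ?_)
  have := hφ.1 _ _ (bas_mem_gr a rfl)
  rwa [ha] at this

theorem form_twist (δ : BabyVerma p α χ lam →ₗ[F] F) (i : ZMod 2)
    {φ : Alg F →ₗ[F] BabyVerma p α χ lam} {a : Gen} (h : δ (φ (bas F a)) = 0) :
    δ (twist i φ a) = 0 :=
  (map_smul δ _ _).trans ((congrArg _ h).trans (smul_zero _))

theorem twist_zero (φ : Alg F →ₗ[F] BabyVerma p α χ lam) (a : Gen) :
    twist 0 φ a = φ (bas F a) := by
  have : superSign F 0 (par a) = 1 := by simp [superSign]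
  exact (congrArg (· • φ (bas F a)) this).trans (one_smul F _)

end

section

variable {F : Type*} [Field F] {p : ℕ} [Fact p.Prime] [CharP F p]

/-- The weights of `e₂, e₃, x₄` in `F` are distinct. -/
theorem eq_of_wt_eq (h2 : (2 : F) ≠ 0) {a b : Gen} (ha : a ∈ [e2, e3, x4]) (hb : b ∈ [e2, e3, x4])
    (h : ∀ i, (wt a i : F) = (wt b i : F)) : a = b := by
  have h0 := h 0
  have h1 := h 1
  simp only [List.mem_cons, List.not_mem_nil, or_false] at ha hb
  rcases ha with rfl | rfl | rfl <;> rcases hb with rfl | rfl | rfl <;>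
    first
    | rfl
    | (exfalso; simp [wt] at h0; done)
    | (exfalso; simp [wt] at h1; first | exact h2 h1 | exact h2 h1.symm)

theorem wt_ne_zero (h2 : (2 : F) ≠ 0) {a : Gen} (ha : a ∈ [e2, e3, x4]) :
    ∃ i, (wt a i : F) ≠ 0 := by
  simp only [List.mem_cons, List.not_mem_nil, or_false] at ha
  rcases ha with rfl | rfl | rfl
  · exact ⟨1, by simpa [wt] using h2⟩
  · exact ⟨2, by simpa [wt] using h2⟩
  · exact ⟨0, by simp [wt]⟩

variable {α : F} {χ : Module.Dual F (gr F 0)} {lam : Fin 3 → F}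

/-- For integral weights the `p`-character vanishes as soon as it vanishes at the `e_i` and
`f_i`. -/
theorem pow_eq_zero_of_intCast (hχ : ∀ i, χ (eE F i) = 0) (hlam : lam ∈ weightSet p χ)
    {l : Fin 3 → ℤ} (hl : ∀ i, lam i = l i) (hf : ∀ i, χ (fE F i) ^ p = 0) (b : Gen)
    (hb : par b = 0) : χ (evenBas F b hb) ^ p = 0 := by
  have he (i : Fin 3) : χ (eE F i) ^ p = 0 := by
    rw [hχ, zero_pow (Fact.out : p.Prime).ne_zero]
  have hh (i : Fin 3) : χ (hE F i) ^ p = 0 := by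
    rw [← lam_pow hlam, hl, sub_eq_zero]
    exact map_intCast (frobenius F p) (l i)
  cases b
  · exact hh 0
  · exact hh 1
  · exact hh 2
  · exact he 0
  · exact he 1
  · exact he 2
  · exact hf 0
  · exact hf 1
  · exact hf 2
  all_goals exact absurd hb (by decide)

omit [CharP F p] in
theorem w_eq_top (hp : 5 ≤ p) {l β : Fin 3 → ℤ} (h : wOk l β (1, 1, 1, 1) = true ∧
    wIx l β (1, 1, 1, 1) = topIx) : w p α χ lam l β 1 1 1 1 =
      mono p (zRep p α χ lam) (word (zRep p α χ lam) (hwv p α χ lam)) topIx :=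
  h.2 ▸ w_eq_mono (θ := (1, 1, 1, 1)) hp h.1

theorem wIx_h : ∀ i, wOk ![2, -2, -2] (wt (hG i)) (1, 1, 1, 1) = true ∧
    wIx ![2, -2, -2] (wt (hG i)) (1, 1, 1, 1) = topIx := by decide

theorem wIx_f : ∀ i, wOk ![2, -2, -2] (wt (fG i)) (1, 1, 1, 1) = true := by decide

omit [Fact (Nat.Prime p)] [CharP F p] in
/-- The exponents `0` become `p - 1`. -/
theorem pow_f_mono {M : Type*} [AddCommGroup M] [Module F M] {v : ℕ → F} {r : Gen → Module.End F M}
    (hR : IsRep v r) (hp : 5 ≤ p) (u : List Gen → M) (J : List Gen) :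
    (r f1 ^ (p - 1)) (mono p r u ⟨0, -1, -1, J⟩) = mono p r u ⟨-1, -1, -1, J⟩ ∧
    (r f2 ^ (p - 1)) (mono p r u ⟨-1, 0, -1, J⟩) = mono p r u ⟨-1, -1, -1, J⟩ ∧
    (r f3 ^ (p - 1)) (mono p r u ⟨-1, -1, 0, J⟩) = mono p r u ⟨-1, -1, -1, J⟩ := by
  have h12 : Commute (r f1) (r f2) := comm_f_f hR.comm_f (by simp [IsF]) (by simp [IsF])
  have h13 : Commute (r f1) (r f3) := comm_f_f hR.comm_f (by simp [IsF]) (by simp [IsF])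
  have h23 : Commute (r f2) (r f3) := comm_f_f hR.comm_f (by simp [IsF]) (by simp [IsF])
  have e0 : rep p 0 = 0 := by simp [rep]
  have e1 : rep p (-1) = p - 1 := by unfold rep; split_ifs <;> omega
  simp only [mono, e0, e1, pow_zero, Module.End.one_apply, true_and]
  refine ⟨?_, ?_⟩
  · exact LinearMap.congr_fun (h12.symm.pow_pow (p - 1) (p - 1)).eq _
  · refine (LinearMap.congr_fun (h13.symm.pow_pow (p - 1) (p - 1)).eq _).trans ?_
    refine congrArg (r f1 ^ (p - 1)) ?_
    exact LinearMap.congr_fun (h23.symm.pow_pow (p - 1) (p - 1)).eq _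

variable [IsAlgClosed F]

/-- The baby Verma modules for which `δ` has the weight of `g = e₂`, `e₃` or `x₄`: the cohomology
is detected by `δ (φ g)`. -/
theorem H1Z_of_wt (hp : 5 ≤ p) (hα : α ≠ -1) (hlam : lam ∈ weightSet p χ)
    (hχ : ∀ b hb, χ (evenBas F b hb) ^ p = 0) {g : Gen} (hg : g ∈ [e2, e3, x4])
    (hμ : ∀ i, lam i - (![2, -2, -2] : Fin 3 → F) i = (wt g i : F))
    {ψ : Alg F →ₗ[F] BabyVerma p α χ lam} (hψ : ψ ∈ DerHomZ p α χ lam (par g)) {c : F}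
    (hc : c ≠ 0) (hψg : ∀ N : BabyVerma p α χ lam →ₗ[F] F, N (ψ (bas F g)) =
      c * N (mono p (zRep p α χ lam) (word (zRep p α χ lam) (hwv p α χ lam)) topIx)) :
    Submodule.span F {clsZ p α χ lam ⟨ψ, DerHomZ_le p α χ lam _ hψ⟩} = ⊤ ∧
      Module.rank F (H1.part (bracket α) (gr F) (action p α χ lam) (vermaGr p α χ lam) (par g)) =
        1 ∧
      Module.rank F (H1.part (bracket α) (gr F) (action p α χ lam) (vermaGr p α χ lam)
        (par g + 1)) = 0 := by
  have h2 : (2 : F) ≠ 0 := two_ne_zero_of_le hp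
  obtain ⟨δ, hδ, h1, hδ1⟩ :=
    zRep_isTopForm (v := vars α lam 0 0) hp hα rfl (vars_lam α lam 0 0) hlam hχ
  have hμ0 : (fun i => lam i - (![2, -2, -2] : Fin 3 → F) i) ≠ 0 := by
    obtain ⟨i, hi⟩ := wt_ne_zero h2 hg
    exact fun h => hi ((hμ i).symm.trans (congrFun h i))
  have inner {j : ZMod 2} {φ} (hφ : φ ∈ DerHomZ p α χ lam j) (h0 : δ (twist j φ g) = 0) :
      φ ∈ Ider (gr F) (action p α χ lam) (vermaGr p α χ lam) := by
    have hc : Cocycle (vars α lam 0 0) (zRep p α χ lam) (twist j φ) := twist_cocycle rfl hφ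
    refine mem_ider_of_exists hδ h1 hφ (hδ.exists_inner_of_ne hp hc hα hμ0 fun a ha => ?_)
    by_contra hne
    have := hδ.wt_eq hc ha hne
    exact hne (eq_of_wt_eq h2 ha hg (fun i => (this i).symm.trans (hμ i)) ▸ h0)
  have hψ1 : δ (ψ (bas F g)) = c := by
    rw [hψg, hδ1, mul_one]
  obtain ⟨E, hE, -, htop, hbot⟩ := H1.of_section (δ ∘ₗ LinearMap.applyₗ (bas F g))
    (B := bracket α) (G := gr F) (ρ := action p α χ lam) (GM := vermaGr p α χ lam)
    (fun φ hφ => apply_eq_zero_of_mem_ider δ (hδ.pos g (by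
      simp only [List.mem_cons, List.not_mem_nil, or_false] at hg ⊢
      tauto)) hφ)
    (par g) (fun φ hφ h0 => inner hφ (form_twist δ _ h0))
    (fun φ hφ => inner hφ (form_twist_eq_zero h1 hφ (by generalize par g = j; revert j; decide)))
    (fun x => (x / c) • ψ) (fun x => Submodule.smul_mem _ _ hψ) fun x => by
      refine (map_smul (δ ∘ₗ LinearMap.applyₗ (bas F g)) (x / c) ψ).trans ?_
      exact (congrArg (x / c * ·) hψ1).trans (div_mul_cancel₀ x hc)
  refine ⟨?_, ?_, ?_⟩
  · rw [eq_top_iff]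
    intro x _
    refine Submodule.mem_span_singleton.2 ⟨E x / c, E.injective ?_⟩
    rw [map_smul, hE]
    exact (congrArg (E x / c * ·) hψ1).trans (div_mul_cancel₀ _ hc)
  · rw [htop, rank_top, E.rank_eq, Module.rank_self]
  · rw [hbot, rank_bot]

/-- The baby Verma module for which `δ` has weight zero: the cohomology is detected by the numbers
`δ (φ h_i)` and `δ (f_i ^ (p - 1) φ f_i)`. -/
theorem H1Z_of_wt_zero (hp : 5 ≤ p) (hα : α ≠ -1) (hlam : lam ∈ weightSet p χ)
    (hχ : ∀ b hb, χ (evenBas F b hb) ^ p = 0) (hμ : lam = ![2, -2, -2])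
    (hψ : ∀ a c, psi1 p α χ lam a c ∈ DerHomZ p α χ lam 0) :
    Function.Bijective (fun ac : (Fin 3 → F) × (Fin 3 → F) =>
      clsZ p α χ lam ⟨_, DerHomZ_le p α χ lam 0 (hψ ac.1 ac.2)⟩) ∧
      sdimZ p α χ lam = (6, 0) := by
  obtain ⟨δ, hδ, h1, hδ1⟩ :=
    zRep_isTopForm (v := vars α lam 0 0) hp hα rfl (vars_lam α lam 0 0) hlam hχ
  have hμ0 : (fun i => lam i - (![2, -2, -2] : Fin 3 → F) i) = 0 := by
    rw [hμ]
    exact funext fun i => sub_self _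
  let L : (Alg F →ₗ[F] BabyVerma p α χ lam) →ₗ[F] (Fin 3 → F) × (Fin 3 → F) :=
    (LinearMap.pi fun i => δ ∘ₗ LinearMap.applyₗ (bas F (hG i))).prod
      (LinearMap.pi fun i => δ ∘ₗ (zRep p α χ lam (fG i) ^ (p - 1)) ∘ₗ
        LinearMap.applyₗ (bas F (fG i)))
  have inner {j : ZMod 2} {φ} (hφ : φ ∈ DerHomZ p α χ lam j)
      (hh : ∀ i, δ (twist j φ (hG i)) = 0)
      (hf : ∀ i, δ ((zRep p α χ lam (fG i) ^ (p - 1)) (twist j φ (fG i))) = 0) :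
      φ ∈ Ider (gr F) (action p α χ lam) (vermaGr p α χ lam) := by
    have hc : Cocycle (vars α lam 0 0) (zRep p α χ lam) (twist j φ) := twist_cocycle rfl hφ
    refine mem_ider_of_exists hδ h1 hφ
      (hδ.exists_inner_of_eq_zero hp hc hα hμ0 hh fun f hF => ?_)
    rcases hF with rfl | rfl | rfl
    exacts [hf 0, hf 1, hf 2]
  have hLψ (ac : (Fin 3 → F) × (Fin 3 → F)) : L (psi1 p α χ lam ac.1 ac.2) = ac := by
    obtain ⟨a, c⟩ := ac
    have smul_form (N : BabyVerma p α χ lam →ₗ[F] F) (x : F) {z : BabyVerma p α χ lam}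
        (hz : N z = 1) : N (x • z) = x :=
      (map_smul N x z).trans ((congrArg (x * ·) hz).trans (mul_one x))
    obtain ⟨m1, m2, m3⟩ := pow_f_mono hδ.isRep hp (word (zRep p α χ lam) (hwv p α χ lam))
      [y1, y2, y3, y4]
    refine Prod.ext (funext fun i => ?_) (funext fun i => ?_)
    · have hz : δ (w p α χ lam ![2, -2, -2] (wt (hG i)) 1 1 1 1) = 1 := by
        rw [w_eq_top hp (wIx_h i), hδ1]
      have e : psi1 p α χ lam a c (bas F (hG i)) =
          a i • w p α χ lam ![2, -2, -2] (wt (hG i)) 1 1 1 1 := by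
        refine (constr_bas _ _).trans ?_
        fin_cases i <;> rfl
      exact (congrArg δ e).trans (smul_form δ (a i) hz)
    · have hz : (δ ∘ₗ (zRep p α χ lam (fG i) ^ (p - 1)))
          (w p α χ lam ![2, -2, -2] (wt (fG i)) 1 1 1 1) = 1 := by
        have h0 := w_eq_mono (α := α) (χ := χ) (lam := lam) hp (wIx_f i)
        refine (congrArg _ h0).trans (Eq.trans ?_ hδ1)
        refine congrArg δ ?_
        fin_cases i
        · exact m1
        · exact m2
        · exact m3
      have e : psi1 p α χ lam a c (bas F (fG i)) =
          c i • w p α χ lam ![2, -2, -2] (wt (fG i)) 1 1 1 1 := by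
        refine (constr_bas _ _).trans ?_
        fin_cases i <;> rfl
      exact (congrArg (δ ∘ₗ (zRep p α χ lam (fG i) ^ (p - 1))) e).trans (smul_form _ (c i) hz)
  have hI : ∀ φ ∈ Ider (gr F) (action p α χ lam) (vermaGr p α χ lam), L φ = 0 := by
    intro φ hφ
    refine Prod.ext (funext fun i => ?_) (funext fun i => ?_)
    · refine apply_eq_zero_of_mem_ider δ (fun m => ?_) hφ
      refine (hδ.wt i m).trans ?_
      rw [congrFun hμ0 i]
      exact zero_mul _
    · refine apply_eq_zero_of_mem_ider (δ ∘ₗ (zRep p α χ lam (fG i) ^ (p - 1))) (fun m => ?_) hφ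
      have hz : pCenter p (zRep p α χ lam) (fG i) = zRep p α χ lam (fG i) ^ p := by
        unfold pCenter
        rw [if_neg (by revert i; decide), sub_zero]
      have h0 : zRep p α χ lam (fG i) ^ p = 0 :=
        hz ▸ hδ.center (fG i) (odd_eq_false (par_fG i))
      have : (zRep p α χ lam (fG i) ^ (p - 1)) (zRep p α χ lam (fG i) m) = 0 := by
        rw [← Module.End.mul_apply, ← pow_succ, Nat.sub_add_cancel (by omega), h0]
        rfl
      exact (congrArg δ this).trans (map_zero δ)
  have hinj : ∀ φ ∈ DerHomZ p α χ lam 0, L φ = 0 →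
      φ ∈ Ider (gr F) (action p α χ lam) (vermaGr p α χ lam) := by
    intro φ hφ h0
    refine inner hφ (fun i => ?_) fun i => ?_
    · rw [twist_zero]
      exact congrFun (congrArg Prod.fst h0) i
    · rw [twist_zero]
      exact congrFun (congrArg Prod.snd h0) i
  have hother : ∀ φ ∈ DerHomZ p α χ lam (0 + 1),
      φ ∈ Ider (gr F) (action p α χ lam) (vermaGr p α χ lam) := by
    intro φ hφ
    refine inner hφ (fun i => form_twist_eq_zero h1 hφ ?_) fun i => h1 _ ?_
    · rw [par_hG]
      rfl
    · have hpow (n : ℕ) : (zRep p α χ lam (fG i) ^ n) (twist (0 + 1) φ (fG i)) ∈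
          vermaGr p α χ lam 1 := by
        induction n with
        | zero =>
          have := Submodule.smul_mem _ (superSign F (0 + 1) (par (fG i)))
            (hφ.1 _ _ (bas_mem_gr (fG i) rfl))
          rw [par_fG] at this
          simpa [twist, par_fG] using this
        | succ n ih =>
          rw [pow_succ', Module.End.mul_apply]
          have := zRep_vermaGr (fG i) ih
          rwa [par_fG, zero_add] at this
      exact hpow _
  obtain ⟨E, -, hsec, htop, hbot⟩ := H1.of_section L hI 0 hinj hother
    (fun ac => psi1 p α χ lam ac.1 ac.2) (fun ac => hψ ac.1 ac.2) hLψ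
  replace hbot : H1.part (bracket α) (gr F) (action p α χ lam) (vermaGr p α χ lam) 1 = ⊥ := hbot
  refine ⟨?_, Prod.ext ?_ ?_⟩
  · refine (Function.Bijective.of_comp_iff' E.bijective _).1 ?_
    have : (E ∘ fun ac : (Fin 3 → F) × (Fin 3 → F) =>
        clsZ p α χ lam ⟨_, DerHomZ_le p α χ lam 0 (hψ ac.1 ac.2)⟩) = id := funext hsec
    rw [this]
    exact Function.bijective_id
  · change Module.rank F (H1.part _ _ _ _ 0) = 6
    rw [htop, rank_top, E.rank_eq, rank_prod', rank_fun']
    norm_num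
  · change Module.rank F (H1.part _ _ _ _ 1) = 0
    rw [hbot, rank_bot]

/-- If `δ` has neither weight zero nor the weight of `e₂`, `e₃` or `x₄`, or if the `p`-character
does not vanish, all derivations are inner. -/
theorem derHom_le_ider (hp : 5 ≤ p) (hα : α ≠ -1) (hlam : lam ∈ weightSet p χ)
    (h : ¬ ((lam = ![2, -2, -2] ∨ lam = ![2, -2, 0] ∨ lam = ![2, 0, -2] ∨ lam = ![3, -3, -3]) ∧
      ∀ i, χ (fE F i) ^ p = 0)) (i : ZMod 2) :
    DerHomZ p α χ lam i ≤ Ider (gr F) (action p α χ lam) (vermaGr p α χ lam) := by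
  intro φ hφ
  by_cases hχ : ∀ b hb, χ (evenBas F b hb) ^ p = 0
  swap
  · push Not at hχ
    obtain ⟨b, hb, hne⟩ := hχ
    exact mem_ider_of_ne_zero hb hne hφ
  replace h : ¬ (lam = ![2, -2, -2] ∨ lam = ![2, -2, 0] ∨ lam = ![2, 0, -2] ∨
    lam = ![3, -3, -3]) := fun h' => h ⟨h', fun i => hχ _ _⟩
  obtain ⟨δ, hδ, h1, -⟩ :=
    zRep_isTopForm (v := vars α lam 0 0) hp hα rfl (vars_lam α lam 0 0) hlam hχ
  have hc : Cocycle (vars α lam 0 0) (zRep p α χ lam) (twist i φ) := twist_cocycle rfl hφ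
  refine mem_ider_of_exists hδ h1 hφ (hδ.exists_inner_of_ne hp hc hα (fun hμ => h (Or.inl ?_))
    fun a ha => ?_)
  · exact funext fun i => sub_eq_zero.1 (congrFun hμ i)
  · by_contra hne
    have hw := hδ.wt_eq hc ha hne
    have hl (i : Fin 3) : lam i = (![2, -2, -2] : Fin 3 → F) i + (wt a i : F) := by
      rw [← hw i]
      ring
    refine h (Or.inr ?_)
    simp only [List.mem_cons, List.not_mem_nil, or_false] at ha
    rcases ha with rfl | rfl | rfl
    · refine Or.inr (Or.inl (funext fun i => (hl i).trans ?_))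
      fin_cases i <;> simp [wt]
    · refine Or.inl (funext fun i => (hl i).trans ?_)
      fin_cases i <;> simp [wt]
    · refine Or.inr (Or.inr (funext fun i => (hl i).trans ?_))
      fin_cases i <;> simp [wt] <;> norm_num

end

end D21

theorem theorem3p6 {F : Type*} [Field F] [IsAlgClosed F] (p : ℕ) [Fact p.Prime] [CharP F p]
    (hp : 3 < p) (α : F) (hα0 : α ≠ 0) (hα1 : α ≠ -1)
    (χ : Module.Dual F (D21.gr F 0)) (hχ : ∀ i, χ (D21.eE F i) = 0)
    (lam : Fin 3 → F) (hlam : lam ∈ D21.weightSet p χ) :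
    -- the first case; in `F` the weight `(2,-2,-2)` is `(2p+2, 2p-2, 2p-2)`, and so on
    ((lam = ![2, -2, -2] ∧ ∀ i, χ (D21.fE F i) ^ p = 0) →
      (∃ hψ : ∀ a c, D21.psi1 p α χ lam a c ∈ D21.DerHomZ p α χ lam 0,
        Function.Bijective fun ac : (Fin 3 → F) × (Fin 3 → F) =>
          D21.clsZ p α χ lam ⟨_, D21.DerHomZ_le p α χ lam 0 (hψ ac.1 ac.2)⟩) ∧
      D21.sdimZ p α χ lam = (6, 0)) ∧
    -- the second case
    ((lam = ![2, -2, 0] ∧ ∀ i, χ (D21.fE F i) ^ p = 0) →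
      (∃ hψ : D21.psi2 p α χ lam ∈ D21.DerHomZ p α χ lam 0,
        Submodule.span F {D21.clsZ p α χ lam ⟨_, D21.DerHomZ_le p α χ lam 0 hψ⟩} = ⊤) ∧
      D21.sdimZ p α χ lam = (1, 0)) ∧
    -- the third case
    ((lam = ![2, 0, -2] ∧ ∀ i, χ (D21.fE F i) ^ p = 0) →
      (∃ hψ : D21.psi3 p α χ lam ∈ D21.DerHomZ p α χ lam 0,
        Submodule.span F {D21.clsZ p α χ lam ⟨_, D21.DerHomZ_le p α χ lam 0 hψ⟩} = ⊤) ∧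
      D21.sdimZ p α χ lam = (1, 0)) ∧
    -- the fourth case
    ((lam = ![3, -3, -3] ∧ ∀ i, χ (D21.fE F i) ^ p = 0) →
      (∃ hψ : D21.psi4 p α χ lam ∈ D21.DerHomZ p α χ lam 1,
        Submodule.span F {D21.clsZ p α χ lam ⟨_, D21.DerHomZ_le p α χ lam 1 hψ⟩} = ⊤) ∧
      D21.sdimZ p α χ lam = (0, 1)) ∧
    -- all other cases
    (¬ ((lam = ![2, -2, -2] ∨ lam = ![2, -2, 0] ∨ lam = ![2, 0, -2] ∨ lam = ![3, -3, -3]) ∧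
        ∀ i, χ (D21.fE F i) ^ p = 0) →
      Subsingleton (D21.H1Z p α χ lam) ∧ D21.sdimZ p α χ lam = (0, 0)) := by
  have hp5 : 5 ≤ p := by
    have h4 : p ≠ 4 := by
      rintro rfl
      exact absurd (Fact.out : (4 : ℕ).Prime) (by norm_num)
    omega
  refine ⟨?_, ?_, ?_, ?_, fun h => ?_⟩
  · rintro ⟨h, hf⟩
    have hl (i : Fin 3) : lam i = ((![2, -2, -2] : Fin 3 → ℤ) i : F) := by
      rw [h]
      fin_cases i <;> simp
    have hψ (a c) : D21.psi1 p α χ lam a c ∈ D21.DerHomZ p α χ lam 0 :=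
      D21.mem_derHom_of_derCheck hp5 hα1 D21.psi1_check rfl
        (fun i => (D21.vars_lam α lam a c i).trans (hl i)) (D21.vars_lam α lam a c) hf
        (D21.psi1_bas a c)
    have := D21.H1Z_of_wt_zero hp5 hα1 hlam (D21.pow_eq_zero_of_intCast hχ hlam hl hf) h hψ
    exact ⟨⟨hψ, this.1⟩, this.2⟩
  · rintro ⟨h, hf⟩
    have hl (i : Fin 3) : lam i = ((![2, -2, 0] : Fin 3 → ℤ) i : F) := by
      rw [h]
      fin_cases i <;> simp
    have hψ : D21.psi2 p α χ lam ∈ D21.DerHomZ p α χ lam 0 :=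
      D21.mem_derHom_of_derCheck hp5 hα1 D21.psi2_check rfl
        (fun i => (D21.vars_lam α lam 0 0 i).trans (hl i)) (D21.vars_lam α lam 0 0) hf
        (D21.psi2_bas 0 0)
    obtain ⟨h1, h2, h3⟩ := D21.H1Z_of_wt hp5 hα1 hlam
      (D21.pow_eq_zero_of_intCast hχ hlam hl hf) (g := D21.Gen.e3) (by decide)
      (fun i => by rw [h]; fin_cases i <;> simp [D21.wt]) hψ one_ne_zero
      fun N => (congrArg N ((D21.constr_bas _ _).trans (D21.w_eq_top hp5 (by decide)))).trans
        (one_mul _).symm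
    exact ⟨⟨hψ, h1⟩, Prod.ext h2 h3⟩
  · rintro ⟨h, hf⟩
    have hl (i : Fin 3) : lam i = ((![2, 0, -2] : Fin 3 → ℤ) i : F) := by
      rw [h]
      fin_cases i <;> simp
    have hψ : D21.psi3 p α χ lam ∈ D21.DerHomZ p α χ lam 0 :=
      D21.mem_derHom_of_derCheck hp5 hα1 D21.psi3_check rfl
        (fun i => (D21.vars_lam α lam 0 0 i).trans (hl i)) (D21.vars_lam α lam 0 0) hf
        (D21.psi3_bas 0 0)
    obtain ⟨h1, h2, h3⟩ := D21.H1Z_of_wt hp5 hα1 hlam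
      (D21.pow_eq_zero_of_intCast hχ hlam hl hf) (g := D21.Gen.e2) (by decide)
      (fun i => by rw [h]; fin_cases i <;> simp [D21.wt]) hψ one_ne_zero
      fun N => (congrArg N ((D21.constr_bas _ _).trans (D21.w_eq_top hp5 (by decide)))).trans
        (one_mul _).symm
    exact ⟨⟨hψ, h1⟩, Prod.ext h2 h3⟩
  · rintro ⟨h, hf⟩
    have hl (i : Fin 3) : lam i = ((![3, -3, -3] : Fin 3 → ℤ) i : F) := by
      rw [h]
      fin_cases i <;> simp
    have hψ : D21.psi4 p α χ lam ∈ D21.DerHomZ p α χ lam 1 :=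
      D21.mem_derHom_of_derCheck hp5 hα1 D21.psi4_check rfl
        (fun i => (D21.vars_lam α lam 0 0 i).trans (hl i)) (D21.vars_lam α lam 0 0) hf
        (D21.psi4_bas 0 0)
    obtain ⟨h1, h2, h3⟩ := D21.H1Z_of_wt hp5 hα1 hlam
      (D21.pow_eq_zero_of_intCast hχ hlam hl hf) (g := D21.Gen.x4) (by decide)
      (fun i => by rw [h]; fin_cases i <;> simp [D21.wt] <;> norm_num) hψ
      (neg_ne_zero.2 one_ne_zero)
      fun N => (congrArg N (D21.constr_bas _ _)).trans ((map_neg N _).trans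
        ((congrArg (-N ·) (D21.w_eq_top hp5 (by decide))).trans (neg_one_mul _).symm))
    exact ⟨⟨hψ, h1⟩, Prod.ext h3 h2⟩
  · exact D21.H1.subsingleton_of_le (D21.derHom_le_ider hp5 hα1 hlam h)
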